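/- Graphs are finite multigraphs (loops and parallel edges allowed). A graph is *cubic* if every vertex belongs either to exactly three edges, none a loop, or to exactly two edges, exactly one of them a loop. A *coloring* $C$ of a cubic graph $G$ assigns to each edge one of three colors (red, blue, purple) so that all three colors occur at every vertex. $\Delta(G,C)$ denotes the number of *two-color circuits*, i.e. circuits of $G$ (subgraphs homeomorphic to a circle) whose edges carry exactly two colors, and the *parity* $\pi(G,C)$ is $\Delta(G,C) \bmod 2$. A *simple operation* on $C$ interchanges the two colors along one two-color circuit. A *plane formation* $F$ is a finite collection of Jordan curves in the plane, each colored red or blue, such that the red curves are pairwise disjoint, the blue curves are pairwise disjoint, and each red curve meets each blue curve in a finite (possibly empty) union of pairwise disjoint nondegenerate arcs. Let $R$ and $B$ also denote the unions of the red and of the blue curves. An *alternating circuit* of $F$ is a Jordan curve contained in the closure of the symmetric difference $R \mathbin{\triangle} B$ and contained neither in $R$ nor in $B$. Put $\Delta(F) = (\text{number of red curves}) + (\text{number of blue curves}) + (\text{number of alternating circuits})$; the parity of $F$ is $\Delta(F) \bmod 2$. The *idemposition* of two sets $X,Y$ of curves of the same color is $\overline{X \mathbin{\triangle} Y}$. A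 *simple operation* on $F$ passes to a plane formation $F'$ as follows: for a red curve $d$, replace $B$ by $\overline{B \mathbin{\triangle} d}$ and keep $R$; for a blue curve $d$, replace $R$ by $\overline{R \mathbin{\triangle} d}$ and keep $B$; for an alternating circuit $d$, replace $R$ by $\overline{R \mathbin{\triangle} d}$ and $B$ by $\overline{B \mathbin{\triangle} d}$. **Parity Lemma.** 1. If $C$ is a coloring of a planar cubic graph $G$ and $C'$ is obtained from $C$ by a simple operation, then $\pi(G,C') = \pi(G,C)$. 2. If $F$ and $F'$ are plane formations and $F'$ is obtained from $F$ by a simple operation, then $\Delta(F') \equiv \Delta(F) \pmod 2$. 3. The first statement fails without planarity: let $G$ be the cubic graph on $8$ vertices obtained from the Petersen graph by removing an edge and suppressing the two resulting vertices of degree two. Then $G$ is not planar, and it has colorings $C, C'$, with $C'$ obtained from $C$ by a simple operation, such that $\Delta(G,C) = 5$ and $\Delta(G,C') = 4$. -/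

import Mathlib

namespace KempeParity

open scoped Graph

/-! ### Cubic multigraphs, colorings and two-colored circuits -/

/-- A multigraph is cubic if every vertex either belongs to exactly three edges, none of them a
loop, or belongs to exactly two edges, exactly one of which is a loop. -/
def IsCubic {α β : Type*} (G : Graph α β) : Prop :=
  ∀ v ∈ V(G), ((G.incidenceSet v).ncard = 3 ∧ G.loopSet v = ∅) ∨
    ((G.incidenceSet v).ncard = 2 ∧ (G.loopSet v).ncard = 1)

/-- The three colors. -/
inductive Color
  | red
  | blue
  | purple
  deriving DecidableEq

/-- A (proper) coloring of a cubic graph: all three colors occur at every vertex. Only the values of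
`C` on the edges of `G` matter. -/
def IsColoring {α β : Type*} (G : Graph α β) (C : β → Color) : Prop :=
  ∀ v ∈ V(G), ∀ c : Color, ∃ e, G.Inc e v ∧ C e = c

/-- A circuit of `G`: a subgraph that is a cycle graph with `n ≥ 1` vertices `v 0, …, v (n - 1)` and
`n` edges, the edge `e i` joining `v i` to `v (i + 1)`, indices modulo `n`. For `n = 1` it is a
loop, for `n = 2` a pair of parallel edges. -/
def IsCircuit {α β : Type*} (G H : Graph α β) : Prop :=
  H ≤ G ∧ ∃ (n : ℕ) (v : ZMod n → α) (e : ZMod n → β), 0 < n ∧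
    Function.Injective v ∧ Function.Injective e ∧
    V(H) = Set.range v ∧ E(H) = Set.range e ∧ ∀ i, H.IsLink (e i) (v i) (v (i + 1))

/-- The circuits of `G` that contain exactly two colors. -/
def twoColorCircuits {α β : Type*} (G : Graph α β) (C : β → Color) : Set (Graph α β) :=
  {H | IsCircuit G H ∧ (C '' E(H)).ncard = 2}

/-- `Δ(G, C)`: the number of two-color circuits. -/
noncomputable def circuitCount {α β : Type*} (G : Graph α β) (C : β → Color) : ℕ :=
  (twoColorCircuits G C).ncard

/-- The parity of a coloring. -/
noncomputable def parity {α β : Type*} (G : Graph α β) (C : β → Color) : ZMod 2 :=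
  (circuitCount G C : ZMod 2)

/-- `C'` is obtained from `C` by a simple operation: by interchanging the two colors along one
two-color circuit. -/
def IsSimpleOperation {α β : Type*} (G : Graph α β) (C C' : β → Color) : Prop :=
  ∃ d ∈ twoColorCircuits G C, ∃ a b : Color, C '' E(d) = {a, b} ∧
    (∀ e ∈ E(d), C' e = Equiv.swap a b (C e)) ∧ ∀ e ∈ E(G) \ E(d), C' e = C e

/-! ### Planarity -/

/-- A drawing of `G` in the plane (taken to be `ℂ`) without crossings: distinct vertices go to
distinct points, every edge to a path between its ends which is simple except that the two end
points of a loop coincide, and the interior of an edge contains no vertex and meets no other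
edge. -/
structure PlaneEmbedding {α β : Type*} (G : Graph α β) where
  point : α → ℂ
  arc : β → unitInterval → ℂ
  point_injOn : Set.InjOn point V(G)
  arc_continuous : ∀ e ∈ E(G), Continuous (arc e)
  arc_ends : ∀ e ∈ E(G), ∃ x y, G.IsLink e x y ∧ arc e 0 = point x ∧ arc e 1 = point y
  arc_simple : ∀ e ∈ E(G), ∀ s ∈ Set.Ioo (0 : unitInterval) 1, ∀ t, arc e s = arc e t → s = t
  arc_ne_point : ∀ e ∈ E(G), ∀ s ∈ Set.Ioo (0 : unitInterval) 1, ∀ v ∈ V(G), arc e s ≠ point v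
  arc_disjoint : ∀ e ∈ E(G), ∀ f ∈ E(G), e ≠ f →
    ∀ s ∈ Set.Ioo (0 : unitInterval) 1, ∀ t ∈ Set.Ioo (0 : unitInterval) 1, arc e s ≠ arc f t

/-- A graph is planar if it has a crossing-free drawing in the plane. -/
def IsPlanar {α β : Type*} (G : Graph α β) : Prop :=
  Nonempty (PlaneEmbedding G)

/-! ### Plane formations -/

/-- A simple closed curve in the plane. -/
def IsJordanCurve (J : Set ℂ) : Prop :=
  ∃ f : Circle → ℂ, Continuous f ∧ Function.Injective f ∧ Set.range f = J

/-- A segment: a simple, nondegenerate arc in the plane. -/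
def IsSegment (A : Set ℂ) : Prop :=
  ∃ f : unitInterval → ℂ, Continuous f ∧ Function.Injective f ∧ Set.range f = A

/-- A plane formation: a finite collection of red and blue Jordan curves, the red ones disjoint from
one another, the blue ones disjoint from one another, such that a red and a blue curve meet in a
finite (possibly empty) collection of disjoint segments. -/
structure PlaneFormation where
  red : Set (Set ℂ)
  blue : Set (Set ℂ)
  red_finite : red.Finite
  blue_finite : blue.Finite
  red_jordan : ∀ A ∈ red, IsJordanCurve A
  blue_jordan : ∀ A ∈ blue, IsJordanCurve A
  red_disjoint : red.PairwiseDisjoint id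
  blue_disjoint : blue.PairwiseDisjoint id
  meet : ∀ A ∈ red, ∀ B ∈ blue, ∃ S : Set (Set ℂ), S.Finite ∧ (∀ s ∈ S, IsSegment s) ∧
    S.PairwiseDisjoint id ∧ A ∩ B = ⋃₀ S

/-- The result of superimposing the curve systems `X` and `Y` of the same color: the shared segments
cancel, and the curves are joined at the end points of the canceled segments. -/
def idempose (X Y : Set ℂ) : Set ℂ :=
  closure (symmDiff X Y)

/-- The red-blue alternating circuits of a formation: the two-colored closed curves that avoid the
places where red and blue are superimposed (which leaves the end points of those places). -/
def PlaneFormation.alternating (F : PlaneFormation) : Set (Set ℂ) :=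
  {J | IsJordanCurve J ∧ J ⊆ closure (symmDiff (⋃₀ F.red) (⋃₀ F.blue)) ∧
    ¬ J ⊆ ⋃₀ F.red ∧ ¬ J ⊆ ⋃₀ F.blue}

/-- `Δ(F) = R + B + Alt`, the number of red, blue and alternating circuits. -/
noncomputable def PlaneFormation.curveCount (F : PlaneFormation) : ℕ :=
  F.red.ncard + F.blue.ncard + F.alternating.ncard

/-- The parity of a formation. -/
noncomputable def PlaneFormation.parity (F : PlaneFormation) : ZMod 2 :=
  (F.curveCount : ZMod 2)

/-- `F'` is obtained from `F` by a simple operation along a curve `d`. On a red curve, a blue copy of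
it is superimposed and idemposed with the blue curves; on a blue curve, a red copy with the red
curves; on an alternating circuit, a red copy with the red curves and a blue copy with the blue
ones. The curves of `F'` are determined by the sets that they fill. -/
def PlaneFormation.IsSimpleOperation (F F' : PlaneFormation) : Prop :=
  ∃ d : Set ℂ,
    (d ∈ F.red ∧ ⋃₀ F'.red = ⋃₀ F.red ∧ ⋃₀ F'.blue = idempose (⋃₀ F.blue) d) ∨
    (d ∈ F.blue ∧ ⋃₀ F'.red = idempose (⋃₀ F.red) d ∧ ⋃₀ F'.blue = ⋃₀ F.blue) ∨
    (d ∈ F.alternating ∧ ⋃₀ F'.red = idempose (⋃₀ F.red) d ∧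
      ⋃₀ F'.blue = idempose (⋃₀ F.blue) d)

/-! ### The Petersen graph with one edge removed -/

/-- Take the Petersen graph with outer vertices `o 0, …, o 4` (edges `o i — o (i + 1)`), inner
vertices `p 0, …, p 4` (edges `p i — p (i + 2)`) and spokes `o i — p i`, indices modulo 5. Remove the
spoke `o 0 — p 0` and suppress its two ends, which now have degree two, so that `o 4 — o 0 — o 1` and
`p 3 — p 0 — p 2` become single edges. The vertices `o 1, …, o 4, p 1, …, p 4` are numbered
`0, …, 7` in this order. -/
def oneDeletedPetersenEnds : Fin 12 → Fin 8 × Fin 8 :=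
  ![(0, 1), (1, 2), (2, 3), (3, 0),
    (4, 6), (6, 5), (5, 7), (7, 4),
    (0, 4), (1, 5), (2, 6), (3, 7)]

/-- The Petersen graph with one edge removed, as a cubic graph. -/
def oneDeletedPetersen : Graph (Fin 8) (Fin 12) where
  vertexSet := Set.univ
  IsLink e x y := oneDeletedPetersenEnds e = (x, y) ∨ oneDeletedPetersenEnds e = (y, x)
  isLink_symm _ _ := ⟨fun _ _ h => h.symm⟩
  eq_or_eq_of_isLink_of_isLink := by
    rintro e x y v w (h | h) (h' | h') <;> rw [h] at h' <;> simp_all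
  left_mem_of_isLink := by simp

end KempeParity

/-! ### Winding parities of plane paths, in place of the Jordan curve theorem. -/

namespace KempeParity

open Complex

/-! ### The parity of a path around a point -/

/-! Statements 1 and 2 reduce to one fact about three fixed-point-free involutions `ρ c`, one for
each color, on the vertices of a plane cubic graph. Two-color circuits are the orbits of two of
them, and exchanging colors a and b along such an orbit D must preserve the parity of the total
number of orbits (`colorCount_exchange`).

The a-b orbits stay the same vertex sets. Of the other orbits only those meeting D matter. Cutting
them at D leaves two matchings of D: M, formed by the walks outside D that use c and a, and N,
formed by those that use c and b (`orbCount_eq_add`). Writing #(s,t) for a number of orbits, the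
contribution is #(a,M) + #(b,N) before the exchange and #(b,M) + #(a,N) after it, so what is needed
is #(a,M) + #(a,N) ≡ #(b,M) + #(b,N) mod 2 (`orbCount_add_orbCount_eq`).

Planarity enters here. Each chord of M or N leaves and reaches the closed curve D on one side,
interlacing chords of the same matching lie on different sides, and the side is read off from the
c-edge at the vertex, so that M and N share it (`isSideLabelling_side`). Counting mod 2 the earlier
places of D on the same side, with a constant shift on one of the sides (`rank`), gives a 2-coloring
of D reversed by M, N and a, and with another shift one reversed by M, N and b. If three matchings
reverse a common 2-coloring of 2k points, their pairwise orbit numbers add up to k mod 2: s ∘ t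
permutes a color class with sign (-1)^(k + #(s,t)), and signs multiply (`orbCount_triple`). Applying
this to a, M, N and to b, M, N and cancelling #(M,N) gives the claim.

The sides are winding parities. A logarithm of γ(s) - δ(t) for disjoint paths relates the turns of γ
around the ends of δ to those of δ around the ends of γ (`turn_relation`); extended to mod 2 chains,
this shows that disjoint interlacing chords see different winding parities
(`chainTurn_add_chainTurn_of_interlace`).

For statement 2, the ends of the overlaps of red with blue curves are the vertices of a plane cubic
graph: overlaps are purple edges, the rest of the curves red and blue edges. Apart from curves
without overlaps, the red curves, blue curves and alternating circuits are its red-purple,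
blue-purple and red-blue circuits, and a simple operation is an exchange
(`PlaneFormation.exists_isCurveNet`, `IsCurveNet.idempose_circuit`). Statement 3 is a finite check,
and the nonplanarity follows from statement 1. -/

theorem exists_continuous_log {X : Type*} [TopologicalSpace X] [LocallyPathConnectedSpace X]
    [SimplyConnectedSpace X] {f : X → ℂ} (hf : Continuous f) (h0 : ∀ x, f x ≠ 0) :
    ∃ L : X → ℂ, Continuous L ∧ ∀ x, exp (L x) = f x := by
  have hne : Nonempty X := inferInstance
  obtain ⟨x₀⟩ := hne
  obtain ⟨F, ⟨-, hF⟩, -⟩ := isCoveringMapOn_exp.existsUnique_continuousMap_lifts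
    ⟨f, hf⟩ (exp_log (h0 x₀)) h0
  exact ⟨F, F.continuous, fun x => congrFun hF x⟩

/-- Uniqueness of lifts through the covering `exp`: once `L'` is shifted by a constant so as to
agree with `L` at `y`, the two agree everywhere. -/
theorem log_sub_log_eq_of_exp_eq {X : Type*} [TopologicalSpace X] [PreconnectedSpace X]
    {L L' : X → ℂ} (hL : Continuous L) (hL' : Continuous L')
    (h : ∀ x, exp (L x) = exp (L' x)) (x y : X) : L x - L y = L' x - L' y := by
  have key := isCoveringMap_exp.eq_of_comp_eq (g₁ := L) (g₂ := fun z => L' z + (L y - L' y)) hL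
    (by fun_prop) (by
      funext z
      refine Subtype.ext ?_
      change exp (L z) = exp (L' z + (L y - L' y))
      rw [exp_add, exp_sub, h y, h z, div_self (exp_ne_zero _), mul_one]) y (by simp)
  have := congrFun key x
  rw [this]; ring

/-- `n` counts the full turns of the path `γ` around `z`, relative to the principal logarithm. -/
def IsTurnNumber (γ : ℝ → ℂ) (z : ℂ) (n : ℤ) : Prop :=
  ∃ L : ℝ → ℂ, Continuous L ∧ (∀ t, exp (L t) = γ t - z) ∧
    L 1 - L 0 = log (γ 1 - z) - log (γ 0 - z) + n * (2 * Real.pi * I)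

theorem two_pi_I_cancel {m n : ℤ} (h : (m : ℂ) * (2 * Real.pi * I) = n * (2 * Real.pi * I)) :
    m = n := by
  have := mul_right_cancel₀ two_pi_I_ne_zero h
  exact_mod_cast this

theorem exists_turnNumber {L : ℝ → ℂ} {γ : ℝ → ℂ} {z : ℂ} (hL : Continuous L)
    (h : ∀ t, exp (L t) = γ t - z) : ∃ n, IsTurnNumber γ z n := by
  have h0 : ∀ t, γ t - z ≠ 0 := fun t => h t ▸ exp_ne_zero _
  obtain ⟨m, hm⟩ := exp_eq_exp_iff_exists_int.1 ((h 1).trans (exp_log (h0 1)).symm)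
  obtain ⟨k, hk⟩ := exp_eq_exp_iff_exists_int.1 ((h 0).trans (exp_log (h0 0)).symm)
  refine ⟨m - k, L, hL, h, ?_⟩
  rw [hm, hk]; push_cast; ring

theorem IsTurnNumber.unique {γ : ℝ → ℂ} {z : ℂ} {m n : ℤ} (hm : IsTurnNumber γ z m)
    (hn : IsTurnNumber γ z n) : m = n := by
  obtain ⟨L, hL, h, e⟩ := hm
  obtain ⟨L', hL', h', e'⟩ := hn
  have := log_sub_log_eq_of_exp_eq hL hL' (fun t => (h t).trans (h' t).symm) 1 0
  rw [e, e'] at this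
  exact two_pi_I_cancel (by linear_combination this)

open Classical in
/-- The number of full turns of the path `γ` around `z`, modulo 2. -/
noncomputable def turn (γ : ℝ → ℂ) (z : ℂ) : ZMod 2 :=
  if h : ∃ n, IsTurnNumber γ z n then (h.choose : ZMod 2) else 0

theorem IsTurnNumber.turn_eq {γ : ℝ → ℂ} {z : ℂ} {n : ℤ} (h : IsTurnNumber γ z n) :
    turn γ z = n := by
  have h' : ∃ n, IsTurnNumber γ z n := ⟨n, h⟩
  rw [turn, dif_pos h', h'.choose_spec.unique h]

/-- A priori the two logarithms differ by an odd multiple of πi; both imaginary parts lie in (-π,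
π], which leaves only ±πi. -/
theorem log_neg_eq (w : ℂ) (hw : w ≠ 0) :
    log (-w) = log w + Real.pi * I ∨ log (-w) = log w - Real.pi * I := by
  have h := exp_log (neg_ne_zero.2 hw)
  have h' : exp (log w + Real.pi * I) = -w := by rw [exp_add, exp_log hw, exp_pi_mul_I]; ring
  obtain ⟨n, hn⟩ := exp_eq_exp_iff_exists_int.1 (h.trans h'.symm)
  have him := congrArg Complex.im hn
  simp [log_im] at him
  have a1 := arg_le_pi w
  have a2 := neg_pi_lt_arg w
  have a3 := arg_le_pi (-w)
  have a4 := neg_pi_lt_arg (-w)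
  have pp := Real.pi_pos
  have n1 : (n : ℝ) < 1 := by
    by_contra hc
    push Not at hc
    nlinarith
  have n2 : (-2 : ℝ) < n := by
    by_contra hc
    push Not at hc
    nlinarith
  have n1' : n < 1 := by exact_mod_cast n1
  have n2' : -2 < n := by exact_mod_cast n2
  obtain rfl | rfl : n = 0 ∨ n = -1 := by omega
  · left; rw [hn]; push_cast; ring
  · right; rw [hn]; push_cast; ring

open Classical in
/-- Which of two points precedes the other, as seen by the principal logarithm. -/
noncomputable def precedes (z w : ℂ) : ℤ :=
  if log (w - z) = log (z - w) + Real.pi * I then 0 else 1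

theorem log_sub_comm {z w : ℂ} (h : z ≠ w) :
    log (w - z) = log (z - w) + (1 - 2 * precedes z w) * (Real.pi * I) := by
  have := log_neg_eq (z - w) (sub_ne_zero.2 h)
  rw [neg_sub] at this
  unfold precedes
  split_ifs with h1
  · rw [h1]; simp
  · rw [this.resolve_left h1]; push_cast; ring

theorem precedes_add_precedes {z w : ℂ} (h : z ≠ w) : precedes z w + precedes w z = 1 := by
  have h1 := log_sub_comm h
  have h2 := log_sub_comm h.symm
  have : ((precedes z w + precedes w z : ℤ) : ℂ) * (2 * Real.pi * I)
      = (1 : ℤ) * (2 * Real.pi * I) := by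
    push_cast; linear_combination h1 + h2
  exact two_pi_I_cancel this

/-- As the paths never meet, γ(s) - δ(t) has a continuous logarithm on the whole parameter plane,
and its increments around the boundary of the unit square cancel. Two opposite sides of the square
measure the turns of γ around the ends of δ, the other two the turns of δ around the ends of γ. What
remains are differences of principal logarithms at the four corners, which the precedences record.
-/
theorem turn_relation {γ δ : ℝ → ℂ} (hγ : Continuous γ) (hδ : Continuous δ)
    (h : ∀ s t, γ s ≠ δ t) :
    turn γ (δ 1) + turn γ (δ 0) + turn δ (γ 1) + turn δ (γ 0) =
      precedes (γ 1) (δ 1) + precedes (γ 1) (δ 0) + precedes (γ 0) (δ 1) +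
        precedes (γ 0) (δ 0) := by
  obtain ⟨L, hL, hexp⟩ := exists_continuous_log (X := ℝ × ℝ) (f := fun p => γ p.1 - δ p.2)
    (by fun_prop) (fun p => sub_ne_zero.2 (h _ _))
  have A : ∀ t, ∃ n : ℤ, turn γ (δ t) = n ∧
      L (1, t) - L (0, t) = log (γ 1 - δ t) - log (γ 0 - δ t) + n * (2 * Real.pi * I) := by
    intro t
    have hc : Continuous fun s => L (s, t) := by fun_prop
    obtain ⟨n, hn⟩ := exists_turnNumber (γ := γ) (z := δ t) hc (fun s => hexp (s, t))
    refine ⟨n, hn.turn_eq, ?_⟩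
    obtain ⟨L', hL', h', e⟩ := hn
    rw [← e]
    exact log_sub_log_eq_of_exp_eq hc hL' (fun s => (hexp (s, t)).trans (h' s).symm) 1 0
  have B : ∀ s, ∃ n : ℤ, turn δ (γ s) = n ∧
      L (s, 1) - L (s, 0) = log (δ 1 - γ s) - log (δ 0 - γ s) + n * (2 * Real.pi * I) := by
    intro s
    -- Adding πi turns a logarithm of γ(s) - δ(t) into one of δ(t) - γ(s).
    have hc : Continuous fun t => L (s, t) + Real.pi * I := by fun_prop
    have he : ∀ t, exp (L (s, t) + Real.pi * I) = δ t - γ s := by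
      intro t
      rw [exp_add, hexp, exp_pi_mul_I]; ring
    obtain ⟨n, hn⟩ := exists_turnNumber hc he
    refine ⟨n, hn.turn_eq, ?_⟩
    obtain ⟨L', hL', h', e⟩ := hn
    rw [← e, ← log_sub_log_eq_of_exp_eq hc hL' (fun t => (he t).trans (h' t).symm) 1 0]
    ring
  obtain ⟨n1, t1, e1⟩ := A 1
  obtain ⟨n0, t0, e0⟩ := A 0
  obtain ⟨m1, s1, f1⟩ := B 1
  obtain ⟨m0, s0, f0⟩ := B 0
  rw [t1, t0, s1, s0]
  have key : ((n1 - n0 - m1 + m0 : ℤ) : ℂ) * (2 * Real.pi * I) =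
      ((-precedes (γ 1) (δ 1) + precedes (γ 1) (δ 0) + precedes (γ 0) (δ 1) -
        precedes (γ 0) (δ 0) : ℤ) : ℂ) * (2 * Real.pi * I) := by
    push_cast
    linear_combination -e1 + e0 + f1 - f0 + log_sub_comm (h 1 1) - log_sub_comm (h 1 0)
      - log_sub_comm (h 0 1) + log_sub_comm (h 0 0)
  have key' := congrArg (Int.cast : ℤ → ZMod 2) (two_pi_I_cancel key)
  push_cast at key'
  simp only [sub_eq_add_neg, CharTwo.neg_eq] at key'
  exact key'

end KempeParity

namespace KempeParity

/-! ### Chains of paths -/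

/-- A list of paths that together form a mod 2 chain with boundary `{x, y}`. -/
def IsChain (A : List (ℝ → ℂ)) (x y : ℂ) : Prop :=
  (∀ γ ∈ A, Continuous γ) ∧ ∀ φ : ℂ → ZMod 2, (A.map fun γ => φ (γ 0) + φ (γ 1)).sum = φ x + φ y

/-- The turns modulo 2 of a chain around a point. -/
noncomputable def chainTurn (A : List (ℝ → ℂ)) (z : ℂ) : ZMod 2 :=
  (A.map fun γ => turn γ z).sum

/-- No path of `A` meets a path of `B`. -/
def ChainDisjoint (A B : List (ℝ → ℂ)) : Prop :=
  ∀ γ ∈ A, ∀ δ ∈ B, ∀ s t, γ s ≠ δ t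

theorem ChainDisjoint.symm {A B : List (ℝ → ℂ)} (h : ChainDisjoint A B) : ChainDisjoint B A :=
  fun γ hγ δ hδ s t e => h δ hδ γ hγ t s e.symm

theorem ChainDisjoint.append_left {A B E : List (ℝ → ℂ)} (h : ChainDisjoint A E)
    (h' : ChainDisjoint B E) : ChainDisjoint (A ++ B) E := fun γ hγ =>
  (List.mem_append.1 hγ).elim (h γ) (h' γ)

theorem ChainDisjoint.append_right {A B E : List (ℝ → ℂ)} (h : ChainDisjoint E A)
    (h' : ChainDisjoint E B) : ChainDisjoint E (A ++ B) :=
  (h.symm.append_left h'.symm).symm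

@[simp]
theorem chainTurn_append (A B : List (ℝ → ℂ)) (z : ℂ) :
    chainTurn (A ++ B) z = chainTurn A z + chainTurn B z := by
  simp [chainTurn]

theorem IsChain.nil (x : ℂ) : IsChain [] x x :=
  ⟨by simp, fun φ => by simp [CharTwo.add_self_eq_zero]⟩

theorem IsChain.single {γ : ℝ → ℂ} (h : Continuous γ) : IsChain [γ] (γ 0) (γ 1) :=
  ⟨by simpa, fun φ => by simp⟩

theorem IsChain.symm {A : List (ℝ → ℂ)} {x y : ℂ} (h : IsChain A x y) : IsChain A y x :=
  ⟨h.1, fun φ => by rw [h.2, add_comm]⟩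

theorem IsChain.append {A B : List (ℝ → ℂ)} {x y z : ℂ} (h : IsChain A x y)
    (h' : IsChain B y z) : IsChain (A ++ B) x z := by
  refine ⟨fun γ hγ => (List.mem_append.1 hγ).elim (h.1 γ) (h'.1 γ), fun φ => ?_⟩
  rw [List.map_append, List.sum_append, h.2, h'.2]
  grind

/-- The sum of the precedences between two pairs of points. -/
noncomputable def pairing (x y u v : ℂ) : ZMod 2 :=
  precedes x u + precedes x v + precedes y u + precedes y v

/-- `turn_relation` is summed over the paths of `B`. The terms that depend on the ends of these
paths collapse to `u` and `v` by the boundary condition of `B`, taken with φ the turn of γ and with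
φ the precedences. -/
theorem turn_chain_relation {γ : ℝ → ℂ} (hγ : Continuous γ) {B : List (ℝ → ℂ)} {u v : ℂ}
    (hB : IsChain B u v) (h : ChainDisjoint [γ] B) :
    turn γ u + turn γ v + (chainTurn B (γ 0) + chainTurn B (γ 1)) = pairing (γ 0) (γ 1) u v := by
  have e1 := hB.2 (turn γ)
  have e2 := hB.2 fun z => (precedes (γ 0) z + precedes (γ 1) z : ZMod 2)
  have e3 : chainTurn B (γ 0) + chainTurn B (γ 1) =
      (B.map fun δ => turn δ (γ 0) + turn δ (γ 1)).sum := by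
    simp [chainTurn, List.sum_map_add]
  have e4 : (B.map fun δ => turn γ (δ 0) + turn γ (δ 1)).sum +
      (B.map fun δ => turn δ (γ 0) + turn δ (γ 1)).sum =
      (B.map fun δ => ((precedes (γ 0) (δ 0) + precedes (γ 1) (δ 0) : ZMod 2) +
        (precedes (γ 0) (δ 1) + precedes (γ 1) (δ 1)))).sum := by
    rw [← List.sum_map_add]
    congr 1
    refine List.map_congr_left fun δ hδ => ?_
    have := turn_relation hγ (hB.1 δ hδ) (h γ (by simp) δ hδ)
    grind
  simp only [pairing]
  grind

/-- The same summation in the other variable: all terms that depend on the ends of the paths of `A`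
form a single φ, to which the boundary condition of `A` applies. -/
theorem chain_relation {A B : List (ℝ → ℂ)} {x y u v : ℂ} (hA : IsChain A x y)
    (hB : IsChain B u v) (h : ChainDisjoint A B) :
    chainTurn A u + chainTurn A v + (chainTurn B x + chainTurn B y) = pairing x y u v := by
  have e1 := hA.2 fun z => chainTurn B z + precedes z u + precedes z v
  have e2 : chainTurn A u + chainTurn A v = (A.map fun γ => turn γ u + turn γ v).sum := by
    simp [chainTurn, List.sum_map_add]
  have e3 : (A.map fun γ => turn γ u + turn γ v).sum =
      (A.map fun γ => (chainTurn B (γ 0) + precedes (γ 0) u + precedes (γ 0) v) +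
        (chainTurn B (γ 1) + precedes (γ 1) u + precedes (γ 1) v)).sum := by
    congr 1
    refine List.map_congr_left fun γ hγ => ?_
    have := turn_chain_relation (hA.1 γ hγ) hB fun γ' hγ' δ hδ => by
      rw [List.mem_singleton.1 hγ']; exact h γ hγ δ hδ
    simp only [pairing] at this
    grind
  simp only [pairing]
  grind

theorem pairing_self (x y w : ℂ) : pairing x y w w = 0 := by
  simp only [pairing]; grind

/-- A closed chain has boundary `{w, w}`, which cancels mod 2. This is the constancy of the winding
parity along chains that avoid a closed curve. -/
theorem chainTurn_eq_of_disjoint {A Z : List (ℝ → ℂ)} {x y w : ℂ} (hZ : IsChain Z w w)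
    (hA : IsChain A x y) (h : ChainDisjoint A Z) : chainTurn Z x = chainTurn Z y := by
  have := chain_relation hA hZ h
  rw [pairing_self] at this
  grind

theorem precedes_add_precedes_mod_two {z w : ℂ} (h : z ≠ w) :
    (precedes z w : ZMod 2) + precedes w z = 1 := by
  exact_mod_cast congrArg (Int.cast : ℤ → ZMod 2) (precedes_add_precedes h)

/-- Two disjoint chords of a closed curve whose ends interlace lie on different sides of it. -/
theorem chainTurn_add_chainTurn_of_interlace {α β γ δ P₁ P₂ Q₁ Q₂ : List (ℝ → ℂ)}
    {x u y v m m' : ℂ} (hα : IsChain α x u) (hβ : IsChain β u y) (hγ : IsChain γ y v)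
    (hδ : IsChain δ v x) (hP₁ : IsChain P₁ x m) (hP₂ : IsChain P₂ m y) (hQ₁ : IsChain Q₁ u m')
    (hQ₂ : IsChain Q₂ m' v) (hxu : x ≠ u) (hyu : y ≠ u) (hxy : x ≠ y)
    (hαγ : ChainDisjoint α γ) (hβδ : ChainDisjoint β δ)
    (hPQ : ChainDisjoint (P₁ ++ P₂) (Q₁ ++ Q₂))
    (h1β : ChainDisjoint P₁ β) (h1γ : ChainDisjoint P₁ γ) (h2α : ChainDisjoint P₂ α)
    (h2δ : ChainDisjoint P₂ δ) (h1γ' : ChainDisjoint Q₁ γ) (h1δ' : ChainDisjoint Q₁ δ)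
    (h2α' : ChainDisjoint Q₂ α) (h2β' : ChainDisjoint Q₂ β) :
    chainTurn (α ++ β ++ γ ++ δ) m + chainTurn (α ++ β ++ γ ++ δ) m' = 1 := by
  have hP := hP₁.append hP₂
  have hQ := hQ₁.append hQ₂
  have hP₁Q : ChainDisjoint P₁ (Q₁ ++ Q₂) := fun γ hγ => hPQ γ (by simp [hγ])
  have hP₂Q : ChainDisjoint P₂ (Q₁ ++ Q₂) := fun γ hγ => hPQ γ (by simp [hγ])
  have hQ₁P : ChainDisjoint Q₁ (P₁ ++ P₂) := fun γ hγ δ hδ s t e =>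
    hPQ δ hδ γ (by simp [hγ]) t s e.symm
  have hQ₂P : ChainDisjoint Q₂ (P₁ ++ P₂) := fun γ hγ δ hδ s t e =>
    hPQ δ hδ γ (by simp [hγ]) t s e.symm
  have r1 := chain_relation hP hQ hPQ
  have r2 := chain_relation hα hγ hαγ
  have r3 := chain_relation hβ hδ hβδ
  -- Mod 2 the closed curve is the sum of the cycles β + γ + Q and δ + α + Q, since Q cancels. The
  -- first avoids P₁, so its turn around m may be read at x; the second avoids P₂, so its turn may
  -- be read at y. In the same way the turn around m' is read at u and v through γ + δ + P and α + β
  -- + P. The resulting terms are the left sides of `r1`, `r2` and `r3`; on the right all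
  -- precedences cancel except three pairs of opposite ones, each contributing 1.
  have s1 := chainTurn_eq_of_disjoint ((hβ.append hγ).append hQ.symm) hP₁
    ((h1β.append_right h1γ).append_right hP₁Q)
  have s2 := chainTurn_eq_of_disjoint ((hδ.append hα).append hQ) hP₂
    ((h2δ.append_right h2α).append_right hP₂Q)
  have s3 := chainTurn_eq_of_disjoint ((hγ.append hδ).append hP) hQ₁
    ((h1γ'.append_right h1δ').append_right hQ₁P)
  have s4 := chainTurn_eq_of_disjoint ((hα.append hβ).append hP.symm) hQ₂
    ((h2α'.append_right h2β').append_right hQ₂P)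
  have g1 := precedes_add_precedes_mod_two hxu
  have g2 := precedes_add_precedes_mod_two hyu
  have g3 := precedes_add_precedes_mod_two hxy
  simp only [chainTurn_append, pairing] at *
  grind

end KempeParity

/-! ### Orbits of two or three matchings: the combinatorial core. -/

namespace KempeParity

/-! ### Perfect matchings and the orbits of a pair of them -/

open Set Function

/-- An involution without fixed points. -/
structure IsMatching {V : Type*} (s : V → V) : Prop where
  invol : Involutive s
  ne : ∀ x, s x ≠ x

/-- A minimal nonempty set closed under `s` and `t`. -/
def IsOrb {V : Type*} (s t : V → V) (S : Set V) : Prop :=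
  S.Nonempty ∧ MapsTo s S S ∧ MapsTo t S S ∧
    ∀ T ⊆ S, T.Nonempty → MapsTo s T T → MapsTo t T T → T = S

/-- The least set containing `x` that is closed under `s` and `t`. -/
def orb {V : Type*} (s t : V → V) (x : V) : Set V :=
  {y | ∀ S : Set V, MapsTo s S S → MapsTo t S S → x ∈ S → y ∈ S}

/-- The number of orbits. -/
noncomputable def orbCount {V : Type*} (s t : V → V) : ℕ :=
  {S | IsOrb s t S}.ncard

section
variable {V : Type*} {s t : V → V}

theorem mem_orb_self (x : V) : x ∈ orb s t x := fun _ _ _ h => h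

theorem orb_mapsTo_left (x : V) : MapsTo s (orb s t x) (orb s t x) :=
  fun _ hy S h h' hx => h (hy S h h' hx)

theorem orb_mapsTo_right (x : V) : MapsTo t (orb s t x) (orb s t x) :=
  fun _ hy S h h' hx => h' (hy S h h' hx)

theorem involutive_mapsTo_compl (hs : Involutive s) {S : Set V} (h : MapsTo s S S) :
    MapsTo s Sᶜ Sᶜ := fun y hy h' => hy (by simpa [hs y] using h h')

theorem involutive_mem_iff (hs : Involutive s) {S : Set V} (h : MapsTo s S S) (x : V) :
    s x ∈ S ↔ x ∈ S :=
  ⟨fun h' => by simpa [hs x] using h h', fun h' => h h'⟩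

/-- If a nonempty closed subset missed `x`, its complement would be closed too, as `s` and `t` are
involutions, and would contain `x`, hence the whole orbit. -/
theorem isOrb_orb (hs : Involutive s) (ht : Involutive t) (x : V) : IsOrb s t (orb s t x) := by
  refine ⟨⟨x, mem_orb_self x⟩, orb_mapsTo_left x, orb_mapsTo_right x, fun T hT hne h h' => ?_⟩
  refine hT.antisymm fun y hy => hy T h h' ?_
  by_contra hx
  obtain ⟨z, hz⟩ := hne
  exact hT hz Tᶜ (involutive_mapsTo_compl hs h) (involutive_mapsTo_compl ht h')
    hx hz

theorem IsOrb.eq_orb {S : Set V} (h : IsOrb s t S) {x : V} (hx : x ∈ S) : orb s t x = S :=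
  h.2.2.2 _ (fun _ hy => hy S h.2.1 h.2.2.1 hx) ⟨x, mem_orb_self x⟩ (orb_mapsTo_left x)
    (orb_mapsTo_right x)

theorem IsOrb.eq_of_mem {S S' : Set V} (h : IsOrb s t S) (h' : IsOrb s t S') {x : V} (hx : x ∈ S)
    (hx' : x ∈ S') : S = S' := by rw [← h.eq_orb hx, h'.eq_orb hx']

theorem IsOrb.disjoint {S S' : Set V} (h : IsOrb s t S) (h' : IsOrb s t S') (hne : S ≠ S') :
    Disjoint S S' :=
  Set.disjoint_left.2 fun _ hx hx' => hne (h.eq_of_mem h' hx hx')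

theorem IsOrb.swap {S : Set V} (h : IsOrb s t S) : IsOrb t s S :=
  ⟨h.1, h.2.2.1, h.2.1, fun T hT hn h1 h2 => h.2.2.2 T hT hn h2 h1⟩

theorem orbCount_comm (s t : V → V) : orbCount s t = orbCount t s := by
  unfold orbCount
  congr 1
  ext S
  exact ⟨IsOrb.swap, IsOrb.swap⟩

theorem isOrb_congr {s' t' : V → V} {S : Set V} (h : ∀ x ∈ S, s x = s' x)
    (h' : ∀ x ∈ S, t x = t' x) : IsOrb s t S ↔ IsOrb s' t' S := by
  have e1 : ∀ T ⊆ S, (MapsTo s T T ↔ MapsTo s' T T) := fun T hT =>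
    ⟨fun k x hx => h x (hT hx) ▸ k hx, fun k x hx => (h x (hT hx)).symm ▸ k hx⟩
  have e2 : ∀ T ⊆ S, (MapsTo t T T ↔ MapsTo t' T T) := fun T hT =>
    ⟨fun k x hx => h' x (hT hx) ▸ k hx, fun k x hx => (h' x (hT hx)).symm ▸ k hx⟩
  unfold IsOrb
  rw [e1 S subset_rfl, e2 S subset_rfl]
  refine and_congr_right fun _ => and_congr_right fun _ => and_congr_right fun _ => ?_
  exact forall_congr' fun T => forall_congr' fun hT => by rw [e1 T hT, e2 T hT]

/-! ### First return maps -/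

/-- The word t(st)^k is a palindrome in two involutions, hence is itself an involution. -/
theorem iterate_palindrome (hs : Involutive s) (ht : Involutive t) (k : ℕ) (z : V) :
    t ((s ∘ t)^[k] (t ((s ∘ t)^[k] z))) = z := by
  induction k with
  | zero => simp [ht z]
  | succ k ih =>
    have e : (s ∘ t)^[k + 1] (t ((s ∘ t)^[k + 1] z)) = (s ∘ t)^[k] (t ((s ∘ t)^[k] z)) := by
      rw [iterate_succ_apply, iterate_succ_apply']
      congr 1
      simp only [comp_apply]
      rw [ht, hs]
    rw [e, ih]

/-- The palindrome t(st)^n has odd length and is conjugate to its middle letter, which has no fixed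
point. Conjugating by `s ∘ t` removes two letters at each end, whence the descent from n + 2 to n.
-/
theorem iterate_ne (hs : IsMatching s) (ht : IsMatching t) :
    ∀ (n : ℕ) (z : V), t ((s ∘ t)^[n] z) ≠ z
  | 0, z => ht.ne z
  | 1, z => fun h => hs.ne (t z) (by
      have := congrArg t h
      rwa [ht.invol] at this)
  | n + 2, z => fun h => by
      refine iterate_ne hs ht n ((s ∘ t) z) ?_
      rw [← iterate_succ_apply (s ∘ t)]
      rw [iterate_succ_apply'] at h
      have h1 := congrArg t h
      rw [ht.invol] at h1
      have h2 := congrArg s h1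
      simp only [comp_apply] at h2 ⊢
      rw [hs.invol] at h2
      exact h2

variable {D : Set V}

/-- The permutation `s ∘ t` of a finite set brings `x` back to itself; the point just before the
closing step along `s` lies in `D`, because `D` is closed under `s`. -/
theorem exists_return [Finite V] (hs : Involutive s) (ht : Involutive t) (hD : MapsTo s D D)
    {x : V} (hx : x ∈ D) : ∃ n, t ((s ∘ t)^[n] x) ∈ D := by
  have hinj : Injective (s ∘ t) := hs.injective.comp ht.injective
  obtain ⟨N, hN, h⟩ := hinj.mem_periodicPts x
  obtain ⟨n, rfl⟩ := Nat.exists_eq_succ_of_ne_zero hN.ne'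
  refine ⟨n, ?_⟩
  have h' : (s ∘ t)^[n + 1] x = x := h
  rw [iterate_succ_apply'] at h'
  rw [← involutive_mem_iff hs hD]
  simp only [comp_apply] at h'
  rw [h']
  exact hx

open Classical in
/-- The number of double steps of the alternating walk from `x` to its return to `D`. -/
noncomputable def returnTime (s t : V → V) (D : Set V) (x : V) : ℕ :=
  if h : ∃ n, t ((s ∘ t)^[n] x) ∈ D then Nat.find h else 0

/-- The end of the alternating walk that starts at `x` with a step along `t` and stops at its
return to `D`. -/
noncomputable def firstReturn (s t : V → V) (D : Set V) (x : V) : V :=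
  t ((s ∘ t)^[returnTime s t D x] x)

/-- The places visited by the walk from `x` to its first return. -/
def returnPath (s t : V → V) (D : Set V) (x : V) : Set V :=
  {y | ∃ i ≤ returnTime s t D x, y = (s ∘ t)^[i] x ∨ y = t ((s ∘ t)^[i] x)}

theorem firstReturn_mem [Finite V] (hs : Involutive s) (ht : Involutive t) (hD : MapsTo s D D)
    {x : V} (hx : x ∈ D) : firstReturn s t D x ∈ D := by
  classical
  have h := exists_return hs ht hD hx
  unfold firstReturn returnTime
  rw [dif_pos h]
  exact Nat.find_spec h

theorem iterate_notMem_of_lt {x : V} {i : ℕ} (hi : i < returnTime s t D x) :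
    t ((s ∘ t)^[i] x) ∉ D := by
  classical
  unfold returnTime at hi
  split_ifs at hi with h
  · exact Nat.find_min h hi
  · omega

theorem iterate_succ_notMem (hs : Involutive s) (hD : MapsTo s D D) {x : V} {i : ℕ}
    (hi : i < returnTime s t D x) : (s ∘ t)^[i + 1] x ∉ D := by
  rw [iterate_succ_apply', comp_apply, involutive_mem_iff hs hD]
  exact iterate_notMem_of_lt hi

theorem returnTime_eq {x : V} {n : ℕ} (h : t ((s ∘ t)^[n] x) ∈ D)
    (h' : ∀ i < n, t ((s ∘ t)^[i] x) ∉ D) : returnTime s t D x = n := by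
  classical
  have hex : ∃ n, t ((s ∘ t)^[n] x) ∈ D := ⟨n, h⟩
  unfold returnTime
  rw [dif_pos hex]
  exact (Nat.find_eq_iff hex).2 ⟨h, fun i hi => h' i hi⟩

/-- The walk from the return point retraces the first walk backwards, so it meets no point of `D`
before it reaches `x`. -/
theorem firstReturn_firstReturn (hs : Involutive s) (ht : Involutive t)
    (hD : MapsTo s D D) {x : V} (hx : x ∈ D) :
    firstReturn s t D (firstReturn s t D x) = x := by
  set n := returnTime s t D x with hn
  have key : ∀ i ≤ n, t ((s ∘ t)^[i] (firstReturn s t D x)) = (s ∘ t)^[n - i] x := by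
    intro i hi
    have e : firstReturn s t D x = t ((s ∘ t)^[i] ((s ∘ t)^[n - i] x)) := by
      rw [← iterate_add_apply, Nat.add_sub_cancel' hi]; rfl
    rw [e, iterate_palindrome hs ht]
  have hr : returnTime s t D (firstReturn s t D x) = n := by
    refine returnTime_eq ?_ fun i hi => ?_
    · rw [key n le_rfl]; simpa using hx
    · rw [key i hi.le]
      obtain ⟨j, hj⟩ : ∃ j, n - i = j + 1 := ⟨n - i - 1, by omega⟩
      rw [hj]
      exact iterate_succ_notMem hs hD (by omega)
  conv_lhs => rw [firstReturn]
  rw [hr, key n le_rfl]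
  simp

theorem firstReturn_ne (hs : IsMatching s) (ht : IsMatching t) (x : V) :
    firstReturn s t D x ≠ x := iterate_ne hs ht _ _

theorem self_mem_returnPath (x : V) : x ∈ returnPath s t D x := ⟨0, Nat.zero_le _, Or.inl rfl⟩

theorem firstReturn_mem_returnPath (x : V) : firstReturn s t D x ∈ returnPath s t D x :=
  ⟨_, le_rfl, Or.inr rfl⟩

theorem returnPath_mapsTo (ht : Involutive t) (x : V) :
    MapsTo t (returnPath s t D x) (returnPath s t D x) := by
  rintro y ⟨i, hi, rfl | rfl⟩
  · exact ⟨i, hi, Or.inr rfl⟩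
  · exact ⟨i, hi, Or.inl (ht _)⟩

theorem returnPath_of_mem [Finite V] (hs : Involutive s) (ht : Involutive t) (hD : MapsTo s D D)
    {x y : V} (hx : x ∈ D) (hy : y ∈ returnPath s t D x) :
    (y ∈ D → y = x ∨ y = firstReturn s t D x) ∧ (y ∉ D → s y ∈ returnPath s t D x) := by
  obtain ⟨i, hi, rfl | rfl⟩ := hy
  · rcases i with - | i
    · exact ⟨fun _ => Or.inl rfl, fun h => (h hx).elim⟩
    · refine ⟨fun h => (iterate_succ_notMem hs hD hi h).elim, fun _ => ⟨i, by omega, Or.inr ?_⟩⟩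
      rw [iterate_succ_apply', comp_apply, hs]
  · rcases hi.lt_or_eq with h | h
    · refine ⟨fun h' => (iterate_notMem_of_lt h h').elim, fun _ => ⟨i + 1, h, Or.inl ?_⟩⟩
      rw [iterate_succ_apply', comp_apply]
    · subst h
      exact ⟨fun _ => Or.inr rfl, fun h' => (h' (firstReturn_mem hs ht hD hx)).elim⟩

/-- A return path is closed under `t`, and under `s` at its points off `D`; its only points in `D`
are its two ends. A walk from another point of `D` therefore never enters it before its own return.
-/
theorem returnPath_disjoint [Finite V] (hs : Involutive s) (ht : Involutive t)
    (hD : MapsTo s D D) {x u : V} (hx : x ∈ D) (hu : u ∈ D) (h1 : u ≠ x)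
    (h2 : u ≠ firstReturn s t D x) : Disjoint (returnPath s t D x) (returnPath s t D u) := by
  have hstep : ∀ z, z ∉ returnPath s t D x → t z ∉ returnPath s t D x := fun z hz h =>
    hz (by simpa [ht z] using returnPath_mapsTo ht x h)
  have key : ∀ i ≤ returnTime s t D u, (s ∘ t)^[i] u ∉ returnPath s t D x := by
    intro i
    induction i with
    | zero =>
      intro _ h
      rcases (returnPath_of_mem hs ht hD hx h).1 hu with e | e
      · exact h1 e
      · exact h2 e
    | succ i ih =>
      intro hi h
      have h3 := (returnPath_of_mem hs ht hD hx h).2 (iterate_succ_notMem hs hD hi)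
      rw [iterate_succ_apply', comp_apply, hs] at h3
      exact hstep _ (ih (by omega)) h3
  refine Set.disjoint_right.2 ?_
  rintro y ⟨i, hi, rfl | rfl⟩
  · exact key i hi
  · exact hstep _ (key i hi)

theorem returnPath_subset (x : V) {S : Set V} (hs : MapsTo s S S) (ht : MapsTo t S S)
    (hx : x ∈ S) : returnPath s t D x ⊆ S := by
  have key : ∀ i, (s ∘ t)^[i] x ∈ S := by
    intro i
    induction i with
    | zero => exact hx
    | succ i ih => rw [iterate_succ_apply']; exact hs (ht ih)
  rintro y ⟨i, -, rfl | rfl⟩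
  · exact key i
  · exact ht (key i)

/-- The restriction of a map to a set that it preserves; the identity if it does not. -/
noncomputable def restrictTo (s : V → V) (D : Set V) : D → D := by
  classical exact fun x => if h : s x ∈ D then ⟨s x, h⟩ else x

theorem restrictTo_coe {x : D} (h : s x ∈ D) : (restrictTo s D x : V) = s x := by
  simp [restrictTo, h]

theorem IsMatching.restrictTo (hs : IsMatching s) (hD : MapsTo s D D) :
    IsMatching (restrictTo s D) where
  invol x := by
    apply Subtype.ext
    rw [restrictTo_coe, restrictTo_coe (hD x.2), hs.invol]
    rw [restrictTo_coe (hD x.2)]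
    exact hD (hD x.2)
  ne x h := hs.ne x (by rw [← restrictTo_coe (hD x.2), h])

theorem isMatching_firstReturn [Finite V] (hs : IsMatching s) (ht : IsMatching t)
    (hD : MapsTo s D D) : IsMatching (restrictTo (firstReturn s t D) D) where
  invol x := by
    have h := firstReturn_mem hs.invol ht.invol hD x.2
    apply Subtype.ext
    rw [restrictTo_coe, restrictTo_coe h, firstReturn_firstReturn hs.invol ht.invol hD x.2]
    rw [restrictTo_coe h, firstReturn_firstReturn hs.invol ht.invol hD x.2]
    exact x.2
  ne x h := by
    have h' := firstReturn_mem hs.invol ht.invol hD x.2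
    exact firstReturn_ne hs ht (x : V) (by rw [← restrictTo_coe h', h])

theorem isOrb_preimage [Finite V] (hs : IsMatching s) (ht : IsMatching t) (hD : MapsTo s D D)
    {S : Set V} (hS : IsOrb s t S) (hSD : (S ∩ D).Nonempty) :
    IsOrb (restrictTo s D) (restrictTo (firstReturn s t D) D) (Subtype.val ⁻¹' S) := by
  have hM : ∀ x : D, (restrictTo (firstReturn s t D) D x : V) = firstReturn s t D x := fun x =>
    restrictTo_coe (firstReturn_mem hs.invol ht.invol hD x.2)
  have hr : ∀ x : D, (restrictTo s D x : V) = s x := fun x => restrictTo_coe (hD x.2)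
  refine ⟨?_, fun x hx => ?_, fun x hx => ?_, fun T hT hne h1 h2 => ?_⟩
  · obtain ⟨x, hx, hxD⟩ := hSD
    exact ⟨⟨x, hxD⟩, hx⟩
  · rw [mem_preimage, hr]; exact hS.2.1 hx
  · rw [mem_preimage, hM]
    exact returnPath_subset (x : V) hS.2.1 hS.2.2.1 hx (firstReturn_mem_returnPath _)
  -- For minimality: the return paths that start in a closed set `T` fill a subset of `S` closed
  -- under `s` and `t`, so they fill `S`. Their points in `D` are starting points and returns, which
  -- all lie in `T`.
  · have hU : (⋃ u ∈ T, returnPath s t D (u : V)) = S := by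
      refine hS.2.2.2 _ ?_ ?_ ?_ ?_
      · exact iUnion₂_subset fun u hu => returnPath_subset _ hS.2.1 hS.2.2.1 (hT hu)
      · obtain ⟨u, hu⟩ := hne
        exact ⟨u, mem_iUnion₂.2 ⟨u, hu, self_mem_returnPath _⟩⟩
      · intro y hy
        obtain ⟨u, hu, hy⟩ := mem_iUnion₂.1 hy
        have h3 := returnPath_of_mem hs.invol ht.invol hD u.2 hy
        by_cases hyD : y ∈ D
        · rcases h3.1 hyD with rfl | rfl
          · exact mem_iUnion₂.2 ⟨_, h1 hu, by rw [hr]; exact self_mem_returnPath _⟩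
          · exact mem_iUnion₂.2 ⟨_, h1 (h2 hu), by rw [hr, hM]; exact self_mem_returnPath _⟩
        · exact mem_iUnion₂.2 ⟨u, hu, h3.2 hyD⟩
      · intro y hy
        obtain ⟨u, hu, hy⟩ := mem_iUnion₂.1 hy
        exact mem_iUnion₂.2 ⟨u, hu, returnPath_mapsTo ht.invol _ hy⟩
    refine hT.antisymm fun y hy => ?_
    have hy' : (y : V) ∈ S := hy
    rw [← hU] at hy'
    obtain ⟨u, hu, hy⟩ := mem_iUnion₂.1 hy'
    rcases (returnPath_of_mem hs.invol ht.invol hD u.2 hy).1 y.2 with e | e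
    · rwa [Subtype.ext e]
    · rw [← hM] at e
      rw [Subtype.ext e]
      exact h2 hu

/-- Orbits either avoid `D` or correspond to the orbits of the induced matchings on `D`. -/
theorem orbCount_eq_add [Finite V] (hs : IsMatching s) (ht : IsMatching t) (hD : MapsTo s D D) :
    orbCount s t = {S | IsOrb s t S ∧ Disjoint S D}.ncard +
      orbCount (restrictTo s D) (restrictTo (firstReturn s t D) D) := by
  have e1 : {S | IsOrb s t S} = {S | IsOrb s t S ∧ Disjoint S D} ∪
      {S | IsOrb s t S ∧ ¬ Disjoint S D} := by
    ext S; simp only [mem_ofPred_eq, mem_union]; tauto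
  have e2 : {S : Set V | IsOrb s t S ∧ ¬ Disjoint S D}.ncard =
      orbCount (restrictTo s D) (restrictTo (firstReturn s t D) D) := by
    refine Set.ncard_congr (fun S _ => Subtype.val ⁻¹' S) ?_ ?_ ?_
    · rintro S ⟨hS, hSD⟩
      exact isOrb_preimage hs ht hD hS (not_disjoint_iff_nonempty_inter.1 hSD)
    · rintro S S' ⟨hS, hSD⟩ ⟨hS', -⟩ h
      obtain ⟨x, hx, hxD⟩ := not_disjoint_iff_nonempty_inter.1 hSD
      have : (⟨x, hxD⟩ : D) ∈ (Subtype.val ⁻¹' S' : Set D) := h ▸ (show _ ∈ Subtype.val ⁻¹' S from hx)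
      exact hS.eq_of_mem hS' hx this
    · intro T hT
      obtain ⟨x, hx⟩ := hT.1
      have ho := isOrb_orb hs.invol ht.invol (x : V)
      have hne : (orb s t (x : V) ∩ D).Nonempty := ⟨x, mem_orb_self _, x.2⟩
      refine ⟨orb s t (x : V), ⟨ho, not_disjoint_iff_nonempty_inter.2 hne⟩, ?_⟩
      exact (isOrb_preimage hs ht hD ho hne).eq_of_mem hT (x := x) (mem_orb_self _) hx
  unfold orbCount at e2 ⊢
  rw [e1, Set.ncard_union_eq _ (Set.toFinite _) (Set.toFinite _), e2]
  exact Set.disjoint_left.2 fun S h h' => h'.2 h.2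

end

end KempeParity

namespace KempeParity

/-! ### The sign of a pair of matchings -/

open Set Function Equiv

/-- `ε` changes along `s`. -/
def Reverses {X : Type*} (s : X → X) (ε : X → ZMod 2) : Prop := ∀ x, ε (s x) = ε x + 1

section
variable {X : Type*} {s t : X → X} {ε : X → ZMod 2}

theorem zmod_two_ne_zero {a : ZMod 2} : a ≠ 0 ↔ a = 1 := by revert a; decide

open Classical in
/-- The permutation `s ∘ t` of the zero set of `ε`, extended by the identity. -/
noncomputable def alternatingPerm (hs : IsMatching s) (ht : IsMatching t) (hsε : Reverses s ε)
    (htε : Reverses t ε) : Perm X where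
  toFun x := if ε x = 0 then s (t x) else x
  invFun x := if ε x = 0 then t (s x) else x
  left_inv x := by
    by_cases h : ε x = 0
    · have : ε (s (t x)) = 0 := by rw [hsε, htε, h]; rfl
      simp only [h, this, if_true]
      rw [hs.invol, ht.invol]
    · simp [h]
  right_inv x := by
    by_cases h : ε x = 0
    · have : ε (t (s x)) = 0 := by rw [htε, hsε, h]; rfl
      simp only [h, this, if_true]
      rw [ht.invol, hs.invol]
    · simp [h]

variable (hs : IsMatching s) (ht : IsMatching t) (hsε : Reverses s ε) (htε : Reverses t ε)

theorem alternatingPerm_of_eq {x : X} (h : ε x = 0) :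
    alternatingPerm hs ht hsε htε x = s (t x) := if_pos h

theorem alternatingPerm_of_ne {x : X} (h : ε x ≠ 0) :
    alternatingPerm hs ht hsε htε x = x := if_neg h

theorem mem_orb_iff_sameCycle [Finite X] {x y : X} (hx : ε x = 0) (hy : ε y = 0) :
    y ∈ orb s t x ↔ (alternatingPerm hs ht hsε htε).SameCycle x y := by
  constructor
  · intro h
    set p := alternatingPerm hs ht hsε htε
    -- The candidate for the orbit: the zeros of ε on the cycle of `x`, together with the other
    -- points whose `s`-partner is such a zero.
    have key := h {y | (ε y = 0 → p.SameCycle x y) ∧ (ε y ≠ 0 → p.SameCycle x (s y))} ?_ ?_ ?_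
    · exact key.1 hy
    · rintro z ⟨h1, h2⟩
      by_cases hz : ε z = 0
      · refine ⟨fun h => ?_, fun _ => ?_⟩
        · rw [hsε, hz] at h; exact absurd h (by decide)
        · rw [hs.invol]; exact h1 hz
      · exact ⟨fun _ => h2 hz, fun h => (h (by rw [hsε, zmod_two_ne_zero.1 hz]; rfl)).elim⟩
    · rintro z ⟨h1, h2⟩
      by_cases hz : ε z = 0
      · refine ⟨fun h => ?_, fun _ => ?_⟩
        · rw [htε, hz] at h; exact absurd h (by decide)
        · rw [← alternatingPerm_of_eq hs ht hsε htε hz]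
          exact Perm.sameCycle_apply_right.2 (h1 hz)
      · have h3 : ε (t z) = 0 := by rw [htε, zmod_two_ne_zero.1 hz]; rfl
        refine ⟨fun _ => ?_, fun h => (h h3).elim⟩
        have h4 := alternatingPerm_of_eq hs ht hsε htε h3
        rw [ht.invol] at h4
        rw [← Perm.sameCycle_apply_right]
        change p.SameCycle x (alternatingPerm hs ht hsε htε (t z))
        rw [h4]
        exact h2 hz
    · exact ⟨fun _ => Perm.SameCycle.refl _ _, fun h => (h hx).elim⟩
  · intro h S hS hT hxS
    obtain ⟨n, -, rfl⟩ := h.exists_pow_eq'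
    clear h hy
    induction n with
    | zero => simpa
    | succ n ih =>
      rw [pow_succ', Perm.mul_apply]
      by_cases h0 : ε ((alternatingPerm hs ht hsε htε ^ n) x) = 0
      · rw [alternatingPerm_of_eq hs ht hsε htε h0]
        exact hS (hT ih)
      · rwa [alternatingPerm_of_ne hs ht hsε htε h0]

theorem exists_mem_zero {S : Set X} (hsε : Reverses s ε) (h : IsOrb s t S) :
    ∃ x ∈ S, ε x = 0 := by
  obtain ⟨x, hx⟩ := h.1
  by_cases h0 : ε x = 0
  · exact ⟨x, hx, h0⟩
  · exact ⟨s x, h.2.1 hx, by rw [hsε, zmod_two_ne_zero.1 h0]; rfl⟩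

/-- Every orbit meets the zeros of ε in exactly one cycle of the permutation. Since
`cycleFactorsFinset` omits trivial cycles, the fixed zeros are counted separately. -/
theorem orbCount_eq_card_cycles [Fintype X] [DecidableEq X] :
    orbCount s t = (alternatingPerm hs ht hsε htε).cycleFactorsFinset.card +
      {x | ε x = 0 ∧ alternatingPerm hs ht hsε htε x = x}.ncard := by
  set p := alternatingPerm hs ht hsε htε with hp
  have hSC : ∀ x y, ε x = 0 → ε y = 0 → (y ∈ orb s t x ↔ p.SameCycle x y) := fun x y =>
    mem_orb_iff_sameCycle hs ht hsε htε
  have hsupp : ∀ x ∈ p.support, ε x = 0 := fun x hx => by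
    by_contra h
    exact (Perm.mem_support.1 hx) (alternatingPerm_of_ne hs ht hsε htε h)
  have e1 : {S | IsOrb s t S} = {S | IsOrb s t S ∧ ∃ x ∈ S, ε x = 0 ∧ p x ≠ x} ∪
      {S | IsOrb s t S ∧ ∃ x ∈ S, ε x = 0 ∧ p x = x} := by
    ext S
    simp only [mem_ofPred_eq, mem_union]
    constructor
    · intro h
      obtain ⟨x, hx, h0⟩ := exists_mem_zero hsε h
      by_cases hpx : p x = x
      · exact Or.inr ⟨h, x, hx, h0, hpx⟩
      · exact Or.inl ⟨h, x, hx, h0, hpx⟩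
    · rintro (h | h) <;> exact h.1
  have e2 : {x | ε x = 0 ∧ p x = x}.ncard =
      {S | IsOrb s t S ∧ ∃ x ∈ S, ε x = 0 ∧ p x = x}.ncard := by
    refine Set.ncard_congr (fun x _ => orb s t x) ?_ ?_ ?_
    · rintro x ⟨h0, hx⟩
      exact ⟨isOrb_orb hs.invol ht.invol x, x, mem_orb_self x, h0, hx⟩
    · rintro x y ⟨h0, hx⟩ ⟨h0', hy⟩ h
      have : y ∈ orb s t x := h ▸ mem_orb_self y
      exact (((hSC x y h0 h0').1 this).eq_of_left hx)
    · rintro S ⟨hS, x, hx, h0, hpx⟩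
      exact ⟨x, ⟨h0, hpx⟩, hS.eq_orb hx⟩
  have e3 : (p.cycleFactorsFinset : Set (Perm X)).ncard =
      {S | IsOrb s t S ∧ ∃ x ∈ S, ε x = 0 ∧ p x ≠ x}.ncard := by
    have hmem : ∀ c ∈ p.cycleFactorsFinset, ∀ x, c x ≠ x →
        x ∈ p.support ∧ c = p.cycleOf x := fun c hc x hx =>
      ⟨Perm.mem_cycleFactorsFinset_support_le hc (Perm.mem_support.2 hx),
        Perm.cycle_is_cycleOf (Perm.mem_support.2 hx) hc⟩
    have hex : ∀ c ∈ p.cycleFactorsFinset, ∃ x, c x ≠ x := fun c hc => by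
      obtain ⟨x, hx, -⟩ := (Perm.mem_cycleFactorsFinset_iff.1 hc).1
      exact ⟨x, hx⟩
    refine Set.ncard_congr (fun c hc => orb s t (hex c hc).choose) ?_ ?_ ?_
    · intro c hc
      have h1 := hmem c hc _ (hex c hc).choose_spec
      exact ⟨isOrb_orb hs.invol ht.invol _, _, mem_orb_self _, hsupp _ h1.1,
        Perm.mem_support.1 h1.1⟩
    · intro c c' hc hc' h
      have h1 := hmem c hc _ (hex c hc).choose_spec
      have h2 := hmem c' hc' _ (hex c' hc').choose_spec
      have h3 : (hex c' hc').choose ∈ orb s t (hex c hc).choose := by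
        have := mem_orb_self (s := s) (t := t) (hex c' hc').choose
        rwa [← h] at this
      rw [h1.2, h2.2]
      exact ((hSC _ _ (hsupp _ h1.1) (hsupp _ h2.1)).1 h3).cycleOf_eq
    · rintro S ⟨hS, x, hx, h0, hpx⟩
      have hc : p.cycleOf x ∈ p.cycleFactorsFinset :=
        Perm.cycleOf_mem_cycleFactorsFinset_iff.2 (Perm.mem_support.2 hpx)
      refine ⟨p.cycleOf x, hc, ?_⟩
      have h1 := (hex _ hc).choose_spec
      have h2 : p.SameCycle x (hex _ hc).choose := by
        by_contra hn
        exact h1 (Perm.cycleOf_apply_of_not_sameCycle hn)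
      have h3 := hmem _ hc _ h1
      refine hS.eq_orb ?_
      rw [← hS.eq_orb hx]
      exact (hSC _ _ h0 (hsupp _ h3.1)).2 h2
  unfold orbCount
  rw [e1, Set.ncard_union_eq _ (Set.toFinite _) (Set.toFinite _), ← e2, ← e3, Set.ncard_coe_finset]
  refine Set.disjoint_left.2 ?_
  rintro S ⟨hS, x, hx, h0, hpx⟩ ⟨-, y, hy, h0', hpy⟩
  rw [← hS.eq_orb hy] at hx
  have := ((hSC y x h0' h0).1 hx).eq_of_left hpy
  exact hpx (this ▸ hpy)

/-- The sign is given by the size of the support plus the number of nontrivial cycles. The fixed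
zeros of ε enter both the number of orbits and the number of zeros, so they cancel mod 2. -/
theorem sign_alternatingPerm [Fintype X] [DecidableEq X] :
    Perm.sign (alternatingPerm hs ht hsε htε) = (-1) ^ (orbCount s t + {x | ε x = 0}.ncard) := by
  set p := alternatingPerm hs ht hsε htε with hp
  have h1 : {x | ε x = 0}.ncard = p.support.card + {x | ε x = 0 ∧ p x = x}.ncard := by
    have : {x | ε x = 0} = (p.support : Set X) ∪ {x | ε x = 0 ∧ p x = x} := by
      ext x
      simp only [mem_ofPred_eq, mem_union, Finset.mem_coe, Perm.mem_support]
      constructor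
      · intro h
        by_cases hx : p x = x
        · exact Or.inr ⟨h, hx⟩
        · exact Or.inl hx
      · rintro (h | h)
        · by_contra h0
          exact h (alternatingPerm_of_ne hs ht hsε htε h0)
        · exact h.1
    rw [this, Set.ncard_union_eq _ (Set.toFinite _) (Set.toFinite _), Set.ncard_coe_finset]
    refine Set.disjoint_left.2 fun x hx hx' => ?_
    exact (Perm.mem_support.1 hx) hx'.2
  rw [Perm.sign_of_cycleType, orbCount_eq_card_cycles hs ht hsε htε, h1, Perm.sum_cycleType]
  have h2 : Multiset.card p.cycleType = p.cycleFactorsFinset.card := by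
    rw [Perm.cycleType_def, Multiset.card_map]; rfl
  rw [h2, ← hp]
  have h3 : ∀ a b c : ℕ, ((-1 : ℤˣ)) ^ (a + c + (b + c)) = (-1) ^ (b + a) := fun a b c => by
    rw [show a + c + (b + c) = (b + a) + 2 * c by ring, pow_add, pow_mul]; simp
  rw [h3]

/-- Three matchings that all reverse `ε` have, modulo 2, as many orbits as `ε` has zeros. -/
theorem orbCount_triple [Finite X] {r : X → X} (hr : IsMatching r) (hs : IsMatching s)
    (ht : IsMatching t) (hrε : Reverses r ε) (hsε : Reverses s ε) (htε : Reverses t ε) :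
    (orbCount r s + orbCount r t + orbCount s t : ZMod 2) = {x | ε x = 0}.ncard := by
  classical
  have := Fintype.ofFinite X
  -- On the zeros of ε this is rt = (rs)(st), in which the two factors `s` cancel.
  have key : alternatingPerm hr ht hrε htε =
      alternatingPerm hr hs hrε hsε * alternatingPerm hs ht hsε htε := by
    ext x
    rw [Perm.mul_apply]
    by_cases h : ε x = 0
    · have h' : ε (s (t x)) = 0 := by rw [hsε, htε, h]; rfl
      rw [alternatingPerm_of_eq hs ht hsε htε h, alternatingPerm_of_eq hr hs hrε hsε h',
        alternatingPerm_of_eq hr ht hrε htε h, hs.invol]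
    · rw [alternatingPerm_of_ne hs ht hsε htε h, alternatingPerm_of_ne hr hs hrε hsε h,
        alternatingPerm_of_ne hr ht hrε htε h]
  have h := congrArg Perm.sign key
  rw [Perm.sign_mul, sign_alternatingPerm, sign_alternatingPerm, sign_alternatingPerm,
    ← pow_add] at h
  have h4 : ∀ m n : ℕ, ((-1 : ℤˣ)) ^ m = (-1) ^ n → (m : ZMod 2) = n := by
    intro m n h
    rw [ZMod.natCast_eq_natCast_iff]
    have h5 := Int.units_pow_eq_pow_mod_two (-1) m
    have h6 := Int.units_pow_eq_pow_mod_two (-1) n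
    rw [h5, h6] at h
    rcases Nat.mod_two_eq_zero_or_one m with hm | hm <;>
      rcases Nat.mod_two_eq_zero_or_one n with hn | hn <;> rw [hm, hn] at h
    · exact hm.trans hn.symm
    · exact absurd h (by decide)
    · exact absurd h (by decide)
    · exact hm.trans hn.symm
  have h7 := h4 _ _ h
  push_cast at h7
  grind

theorem card_eq_two_mul_ncard [Finite X] (hs : IsMatching s) (hsε : Reverses s ε) :
    Nat.card X = 2 * {x | ε x = 0}.ncard := by
  have h1 : {x | ε x = 0}.ncard = {x | ε x = 0}ᶜ.ncard := by
    refine Set.ncard_congr (fun x _ => s x) ?_ ?_ ?_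
    · intro x hx h
      simp only [mem_ofPred_eq] at hx h
      rw [hsε, hx] at h
      exact absurd h (by decide)
    · intro x y _ _ h
      exact hs.invol.injective h
    · intro x hx
      refine ⟨s x, ?_, hs.invol x⟩
      have : ε x ≠ 0 := hx
      simp only [mem_ofPred_eq]
      rw [hsε, zmod_two_ne_zero.1 this]; rfl
  have h2 := Set.ncard_add_ncard_compl {x | ε x = 0}
  omega

end

end KempeParity

namespace KempeParity

/-! ### Enumerating an orbit -/

open Set Function

/-- `w 0, …, w (n - 1)` runs once around the orbit `D`, with steps alternately along `a` and `b`. -/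
structure IsEnumeration {V : Type*} (a b : V → V) (D : Set V) (w : ℕ → V) (n : ℕ) : Prop where
  pos : 0 < n
  even : Even n
  step_even : ∀ i, Even i → w (i + 1) = a (w i)
  step_odd : ∀ i, Odd i → w (i + 1) = b (w i)
  closed : w n = w 0
  injOn : InjOn w (Iio n)
  image_eq : w '' Iio n = D

section
variable {V : Type*} {a b : V → V} {D : Set V}

theorem exists_enumeration [Finite V] (ha : IsMatching a) (hb : IsMatching b)
    (hD : IsOrb a b D) : ∃ w n, IsEnumeration a b D w n := by
  obtain ⟨x, hx⟩ := hD.1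
  have hinj : Injective (b ∘ a) := hb.invol.injective.comp ha.invol.injective
  have hper := hinj.mem_periodicPts x
  set k := minimalPeriod (b ∘ a) x with hk
  have hkpos : 0 < k := minimalPeriod_pos_of_mem_periodicPts hper
  set w : ℕ → V := fun i => if Even i then (b ∘ a)^[i / 2] x else a ((b ∘ a)^[i / 2] x) with hw
  have we : ∀ i, w (2 * i) = (b ∘ a)^[i] x := fun i => by simp [hw]
  have wo : ∀ i, w (2 * i + 1) = a ((b ∘ a)^[i] x) := fun i => by
    simp only [hw]
    rw [if_neg (by simp), show (2 * i + 1) / 2 = i by omega]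
  have hse : ∀ i, Even i → w (i + 1) = a (w i) := by
    rintro i hi
    obtain ⟨j, rfl⟩ := even_iff_exists_two_mul.1 hi
    rw [wo, we]
  have hso : ∀ i, Odd i → w (i + 1) = b (w i) := by
    rintro i ⟨j, rfl⟩
    rw [wo, show 2 * j + 1 + 1 = 2 * (j + 1) by ring, we, iterate_succ_apply', comp_apply]
  have hcl : w (2 * k) = w 0 := by
    rw [we, show w 0 = x by simp [hw], hk]
    exact iterate_minimalPeriod
  -- Even and odd places never coincide: otherwise an alternating word of odd length would have a
  -- fixed point, against `iterate_ne`.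
  have hmix : ∀ i j, i < k → (b ∘ a)^[i] x ≠ a ((b ∘ a)^[j] x) := by
    intro i j hi h
    refine iterate_ne hb ha (j + (k - i)) ((b ∘ a)^[i] x) ?_
    rw [← iterate_add_apply, show j + (k - i) + i = j + k by omega, iterate_add_apply]
    rw [hk, iterate_minimalPeriod, ← h]
  refine ⟨w, 2 * k, by omega, by simp, hse, hso, hcl, ?_, ?_⟩
  · intro i hi j hj h
    simp only [mem_Iio] at hi hj
    rcases Nat.even_or_odd' i with ⟨i', rfl | rfl⟩ <;> rcases Nat.even_or_odd' j with ⟨j', rfl | rfl⟩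
    · rw [we, we] at h
      have := iterate_injOn_Iio_minimalPeriod (f := b ∘ a) (x := x)
        (show i' ∈ Iio _ by simp only [mem_Iio]; omega)
        (show j' ∈ Iio _ by simp only [mem_Iio]; omega) h
      omega
    · rw [we, wo] at h
      exact (hmix _ _ (by omega) h).elim
    · rw [we, wo] at h
      exact (hmix _ _ (by omega) h.symm).elim
    · rw [wo, wo] at h
      have := iterate_injOn_Iio_minimalPeriod (f := b ∘ a) (x := x)
        (show i' ∈ Iio _ by simp only [mem_Iio]; omega)
        (show j' ∈ Iio _ by simp only [mem_Iio]; omega) (ha.invol.injective h)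
      omega
  · have hsub : ∀ i, w i ∈ D := by
      intro i
      induction i with
      | zero => simpa [hw] using hx
      | succ i ih =>
        rcases Nat.even_or_odd i with h | h
        · rw [hse i h]; exact hD.2.1 ih
        · rw [hso i h]; exact hD.2.2.1 ih
    refine hD.2.2.2 _ ?_ ⟨w 0, 0, by simp [hkpos], rfl⟩ ?_ ?_
    · rintro y ⟨i, -, rfl⟩
      exact hsub i
    · rintro y ⟨i, hi, rfl⟩
      simp only [mem_Iio] at hi
      rcases Nat.even_or_odd' i with ⟨j, rfl | rfl⟩
      · exact ⟨2 * j + 1, by simp only [mem_Iio]; omega, hse _ (by simp)⟩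
      · refine ⟨2 * j, by simp only [mem_Iio]; omega, ?_⟩
        rw [hse _ (by simp), ha.invol]
    · rintro y ⟨i, hi, rfl⟩
      simp only [mem_Iio] at hi
      rcases Nat.even_or_odd' i with ⟨j, rfl | rfl⟩
      · rcases j with - | j
        · refine ⟨2 * k - 1, by simp only [mem_Iio]; omega, ?_⟩
          have h := hso (2 * k - 1) ⟨k - 1, by omega⟩
          rw [show 2 * k - 1 + 1 = 2 * k by omega, hcl] at h
          rw [Nat.mul_zero, h, hb.invol]
        · refine ⟨2 * j + 1, by simp only [mem_Iio]; omega, ?_⟩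
          rw [show 2 * (j + 1) = 2 * j + 1 + 1 by ring, hso _ ⟨j, rfl⟩, hb.invol]
      · by_cases h : 2 * j + 1 + 1 < 2 * k
        · exact ⟨2 * j + 1 + 1, h, hso _ ⟨j, rfl⟩⟩
        · refine ⟨0, by simp [hkpos], ?_⟩
          rw [← hso _ ⟨j, rfl⟩, ← hcl]
          congr 1
          omega

/-- Chords of `M` with the same label do not interlace. -/
structure IsSideLabelling (M : D → D) (w : ℕ → V) (n : ℕ) (ι : V → ZMod 2) : Prop where
  label_eq : ∀ u : D, ι (M u) = ι u
  interlace : ∀ i₁ i₂ i₃ i₄, i₁ < i₂ → i₂ < i₃ → i₃ < i₄ → i₄ < n →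
    ∀ u v : D, (u : V) = w i₁ → (v : V) = w i₂ → (M u : V) = w i₃ → (M v : V) = w i₄ →
      ι u + ι v = 1

/-- The number of labels before place `j`, twisted by the place if its own label is zero. -/
def rank (w : ℕ → V) (ι : V → ZMod 2) (κ : ZMod 2) (j : ℕ) : ZMod 2 :=
  ∑ i ∈ Finset.range j, ι (w i) + (1 + ι (w j)) * (j + κ)

variable {w : ℕ → V} {n : ℕ}

theorem IsEnumeration.mem (he : IsEnumeration a b D w n) {i : ℕ} (hi : i < n) : w i ∈ D :=
  he.image_eq ▸ ⟨i, hi, rfl⟩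

theorem IsEnumeration.exists_index (he : IsEnumeration a b D w n) :
    ∃ idx : D → ℕ, (∀ u, idx u < n) ∧ (∀ u, w (idx u) = u) ∧
      ∀ (u : D) (i : ℕ), i < n → w i = u → idx u = i := by
  have : ∀ u : D, ∃ i, i < n ∧ w i = u := fun u => by
    obtain ⟨i, hi, h⟩ : (u : V) ∈ w '' Iio n := by rw [he.image_eq]; exact u.2
    exact ⟨i, hi, h⟩
  choose idx h1 h2 using this
  exact ⟨idx, h1, h2, fun u i hi h => he.injOn (h1 u) hi ((h2 u).trans h.symm)⟩

/-- A summand is 1 exactly when place l carries the label of place i. A chord with this label and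
one end strictly between i and j does not interlace the chord from i to j, so its other end is also
between them; `M` thus pairs off the nonzero summands. -/
theorem sum_Ioo_label (he : IsEnumeration a b D w n) {M : D → D} (hM : IsMatching M)
    {ι : V → ZMod 2} (hι : IsSideLabelling M w n ι) {i j : ℕ} (hij : i < j) (hj : j < n) {u : D}
    (hu : (u : V) = w i) (hMu : (M u : V) = w j) :
    ∑ l ∈ Finset.Ioo i j, (1 + ι (w l) + ι (w i)) = 0 := by
  obtain ⟨idx, h1, h2, h3⟩ := he.exists_index
  have hback : ∀ (x : D) (h : w (idx (M x)) ∈ D), idx (M ⟨w (idx (M x)), h⟩) = idx x := by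
    intro x h
    have : (⟨w (idx (M x)), h⟩ : D) = M x := Subtype.ext (h2 _)
    rw [this, hM.invol]
  have hD : ∀ l ∈ Finset.Ioo i j, w l ∈ D := fun l hl => he.mem (by
    have := Finset.mem_Ioo.1 hl; omega)
  have h01 : ∀ x y : ZMod 2, 1 + x + y ≠ 0 → x = y := by decide
  have h10 : ∀ x : ZMod 2, x + x ≠ 1 := by decide
  have e := Finset.sum_filter_ne_zero (s := Finset.Ioo i j) (f := fun l => 1 + ι (w l) + ι (w i))
  rw [← e]
  refine Finset.sum_involution
    (fun l hl => idx (M ⟨w l, hD l (Finset.mem_filter.1 hl).1⟩)) ?_ ?_ ?_ ?_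
  · intro l hl
    have hl' := Finset.mem_filter.1 hl
    have h5 := hι.label_eq ⟨w l, hD l hl'.1⟩
    rw [h2, h5]
    exact CharTwo.add_self_eq_zero _
  · intro l hl _ h
    have hl' := Finset.mem_filter.1 hl
    refine hM.ne ⟨w l, hD l hl'.1⟩ (Subtype.ext ?_)
    rw [← h2, h]
  · intro l hl
    have hl' := Finset.mem_filter.1 hl
    have hlt := Finset.mem_Ioo.1 hl'.1
    set v : D := ⟨w l, hD l hl'.1⟩ with hv
    have h5 : ι (M v) = ι v := hι.label_eq v
    have hlab : ι v = ι u := by rw [hu]; exact h01 _ _ hl'.2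
    have hMM : ∀ z z' : D, M z = z' → M z' = z := fun z z' h => by rw [← h, hM.invol]
    refine Finset.mem_filter.2 ⟨Finset.mem_Ioo.2 ?_, ?_⟩
    · by_contra hc
      have hne1 : idx (M v) ≠ i := fun h => by
        have : M v = u := Subtype.ext (by rw [← h2, h, hu])
        have h6 : (M u : V) = v := by rw [hMM _ _ this]
        have h7 := he.injOn (show l ∈ Iio n by simp only [mem_Iio]; omega) hj (h6.symm.trans hMu)
        omega
      have hne2 : idx (M v) ≠ j := fun h => by
        have : M v = M u := Subtype.ext (by rw [← h2, h, hMu])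
        have h6 : (v : V) = u := by rw [hM.invol.injective this]
        have h7 := he.injOn (show l ∈ Iio n by simp only [mem_Iio]; omega)
          (show i ∈ Iio n by simp only [mem_Iio]; omega) (h6.trans hu)
        omega
      rcases Nat.lt_or_ge (idx (M v)) i with h | h
      · refine h10 (ι u) ?_
        have := hι.interlace (idx (M v)) i l j h hlt.1 hlt.2 hj (M v) u (h2 _).symm hu
          (by rw [hM.invol]) hMu
        rwa [h5, hlab] at this
      · refine h10 (ι u) ?_
        have := hι.interlace i l j (idx (M v)) hlt.1 hlt.2 (by omega) (h1 _) u v hu rfl hMu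
          (h2 _).symm
        rwa [hlab] at this
    · rw [h2, h5]
      exact hl'.2
  · intro l hl
    have hl' := Finset.mem_filter.1 hl
    refine (hback ⟨w l, hD l hl'.1⟩ _).trans (h3 _ _ ?_ rfl)
    have := Finset.mem_Ioo.1 hl'.1
    omega

/-- Mod 2, `rank` at j counts the earlier places with the label of place j, plus κ if that label is
0. Between the ends of a chord there is an even number of such places by `sum_Ioo_label`, and the
first end itself adds 1. -/
theorem rank_reverses_chord (he : IsEnumeration a b D w n) {M : D → D} (hM : IsMatching M)
    {ι : V → ZMod 2} (hι : IsSideLabelling M w n ι) (κ : ZMod 2) {i j : ℕ} (hij : i < j)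
    (hj : j < n) {u : D} (hu : (u : V) = w i) (hMu : (M u : V) = w j) :
    rank w ι κ j = rank w ι κ i + 1 := by
  have e1 := sum_Ioo_label he hM hι hij hj hu hMu
  have e2 : ι (w j) = ι (w i) := by rw [← hu, ← hMu, hι.label_eq]
  have e3 : ∑ l ∈ Finset.range j, ι (w l) =
      ∑ l ∈ Finset.range i, ι (w l) + ι (w i) + ∑ l ∈ Finset.Ioo i j, ι (w l) := by
    rw [← Finset.sum_range_succ, Finset.range_eq_Ico, Finset.range_eq_Ico,
      ← Finset.sum_Ico_consecutive _ (Nat.zero_le (i + 1)) hij]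
    rfl
  obtain ⟨d, rfl⟩ : ∃ d, j = i + 1 + d := ⟨j - (i + 1), by omega⟩
  rw [Finset.sum_add_distrib, Finset.sum_add_distrib, Finset.sum_const, Finset.sum_const,
    Nat.card_Ioo, show i + 1 + d - i - 1 = d by omega] at e1
  simp only [rank, e3, e2]
  simp only [nsmul_eq_mul] at e1
  push_cast
  grind

theorem sum_label_eq_zero (he : IsEnumeration a b D w n) {M : D → D} (hM : IsMatching M)
    {ι : V → ZMod 2} (hι : IsSideLabelling M w n ι) : ∑ l ∈ Finset.range n, ι (w l) = 0 := by
  obtain ⟨idx, h1, h2, h3⟩ := he.exists_index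
  have hback : ∀ (x : D) (h : w (idx (M x)) ∈ D), idx (M ⟨w (idx (M x)), h⟩) = idx x := by
    intro x h
    have : (⟨w (idx (M x)), h⟩ : D) = M x := Subtype.ext (h2 _)
    rw [this, hM.invol]
  refine Finset.sum_involution
    (fun l hl => idx (M ⟨w l, he.mem (Finset.mem_range.1 hl)⟩)) ?_ ?_ ?_ ?_
  · intro l hl
    rw [h2, hι.label_eq]
    exact CharTwo.add_self_eq_zero _
  · intro l hl _ h
    refine hM.ne ⟨w l, he.mem (Finset.mem_range.1 hl)⟩ (Subtype.ext ?_)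
    rw [← h2, h]
  · intro l hl
    exact Finset.mem_range.2 (h1 _)
  · intro l hl
    exact (hback ⟨w l, he.mem (Finset.mem_range.1 hl)⟩ _).trans
      (h3 _ _ (Finset.mem_range.1 hl) rfl)

/-- For two induced matchings with a common side labelling, exchanging the two matchings of the
orbit does not change the parity of the number of orbits. -/
theorem orbCount_add_orbCount_eq [Finite V] (ha : IsMatching a) (hb : IsMatching b)
    (haD : MapsTo a D D) (hbD : MapsTo b D D)
    (he : IsEnumeration a b D w n) {M N : D → D} (hM : IsMatching M) (hN : IsMatching N)
    {ι : V → ZMod 2} (hMι : IsSideLabelling M w n ι) (hNι : IsSideLabelling N w n ι) :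
    (orbCount (restrictTo a D) M + orbCount (restrictTo a D) N : ZMod 2) =
      orbCount (restrictTo b D) M + orbCount (restrictTo b D) N := by
  obtain ⟨idx, h1, h2, h3⟩ := he.exists_index
  have ha' := ha.restrictTo haD
  have hb' := hb.restrictTo hbD
  have hchord : ∀ (κ : ZMod 2) (M : D → D), IsMatching M → IsSideLabelling M w n ι →
      Reverses M fun u => rank w ι κ (idx u) := by
    intro κ M hM hι u
    rcases Nat.lt_trichotomy (idx u) (idx (M u)) with h | h | h
    · exact rank_reverses_chord he hM hι κ h (h1 _) (h2 u).symm (h2 _).symm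
    · exact (hM.ne u (Subtype.ext (by rw [← h2, ← h, h2]))).elim
    · have := rank_reverses_chord he hM hι κ h (h1 _) (u := M u) (h2 _).symm
        (by rw [hM.invol, h2])
      grind
  -- Between neighboring places j and j + 1 the rank changes by 1 if their labels agree and by j + κ
  -- if they differ. Hence κ = 1 makes it change along every even step, that is along `a`, and κ = 0
  -- along every odd step, that is along `b`.
  have hstep : ∀ j, rank w ι 1 (j + 1) + rank w ι 1 j = 1 + (1 + ι (w (j + 1))) * j + (1 + ι (w j)) * j ∧
      rank w ι 0 (j + 1) + rank w ι 0 j = 1 + (1 + ι (w (j + 1))) * (j + 1) +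
        (1 + ι (w j)) * (j + 1) := by
    intro j
    simp only [rank, Finset.sum_range_succ]
    push_cast
    constructor <;> grind
  have hev : ∀ j : ℕ, Even j → (j : ZMod 2) = 0 := fun j hj => (ZMod.natCast_eq_zero_iff_even).2 hj
  have hod : ∀ j : ℕ, Odd j → (j : ZMod 2) = 1 := fun j hj => (ZMod.natCast_eq_one_iff_odd).2 hj
  -- The last step, from place n - 1 to place 0, is an odd one; the rank closes up because n and the
  -- number of labels 1 are both even.
  have hwrap : rank w ι 0 n = rank w ι 0 0 := by
    simp only [rank, sum_label_eq_zero he hM hMι, he.closed, hev n he.even]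
    simp
  have hAidx : ∀ u : D, ∀ j, Even j → idx u = j → idx (restrictTo a D u) = j + 1 := by
    intro u j hj hu
    have hlt : j + 1 < n := by
      have := h1 u
      have h4 := he.even
      rcases Nat.lt_or_ge (j + 1) n with h | h
      · exact h
      · have : n = j + 1 := by omega
        rw [this] at h4
        exact absurd hj (Nat.even_add_one.1 h4)
    refine h3 _ _ hlt ?_
    rw [he.step_even j hj, restrictTo_coe (haD u.2), ← hu, h2]
  have hA : Reverses (restrictTo a D) fun u => rank w ι 1 (idx u) := by
    have key : ∀ u : D, Even (idx u) →
        rank w ι 1 (idx (restrictTo a D u)) = rank w ι 1 (idx u) + 1 := by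
      intro u hu
      have := (hstep (idx u)).1
      rw [hAidx u _ hu rfl]
      rw [hev _ hu] at this
      grind
    intro u
    rcases Nat.even_or_odd (idx u) with hu | hu
    · exact key u hu
    · obtain ⟨j, hj⟩ := hu
      have hlt := h1 u
      set v : D := ⟨w (2 * j), he.mem (by omega)⟩
      have hv : idx v = 2 * j := h3 _ _ (by omega) rfl
      have hav : restrictTo a D v = u := by
        refine Subtype.ext ?_
        rw [← h2, hAidx v _ (by simp) hv, ← hj, h2]
      have := key v (by rw [hv]; simp)
      rw [hav] at this
      have h5 : restrictTo a D u = v := by rw [← hav, ha'.invol]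
      simp only [h5, this]
      grind
  have hBrank : ∀ u : D, Odd (idx u) →
      rank w ι 0 (idx (restrictTo b D u)) = rank w ι 0 (idx u + 1) := by
    intro u hu
    have hbu : w (idx u + 1) = restrictTo b D u := by
      rw [he.step_odd _ hu, restrictTo_coe (hbD u.2), h2]
    rcases Nat.lt_or_ge (idx u + 1) n with h | h
    · rw [h3 _ _ h hbu]
    · have hn : idx u + 1 = n := by have := h1 u; omega
      rw [hn, hwrap, h3 (restrictTo b D u) 0 he.pos]
      rw [← hbu, hn, he.closed]
  have hB : Reverses (restrictTo b D) fun u => rank w ι 0 (idx u) := by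
    have key : ∀ u : D, Odd (idx u) →
        rank w ι 0 (idx (restrictTo b D u)) = rank w ι 0 (idx u) + 1 := by
      intro u hu
      have := (hstep (idx u)).2
      rw [hBrank u hu]
      rw [hod _ hu] at this
      grind
    intro u
    rcases Nat.even_or_odd (idx u) with hu | hu
    · have hodd : Odd (idx (restrictTo b D u)) := by
        by_contra hc
        rw [Nat.not_odd_iff_even] at hc
        obtain ⟨i, hin, hi, hiu⟩ : ∃ i, i < n ∧ Odd i ∧ w (i + 1) = u := by
          rcases Nat.eq_zero_or_pos (idx u) with h0 | h0
          · have hn := he.pos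
            refine ⟨n - 1, by omega, ?_, ?_⟩
            · obtain ⟨k, hk⟩ := he.even
              exact ⟨k - 1, by omega⟩
            · rw [show n - 1 + 1 = n by omega, he.closed, ← h0, h2]
          · refine ⟨idx u - 1, by have := h1 u; omega, ?_, ?_⟩
            · obtain ⟨k, hk⟩ := hu
              exact ⟨k - 1, by omega⟩
            · rw [show idx u - 1 + 1 = idx u by omega, h2]
        rw [he.step_odd i hi] at hiu
        have h6 : w i = restrictTo b D u := by
          rw [restrictTo_coe (hbD u.2), ← hiu, hb.invol]
        rw [h3 _ _ hin h6] at hc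
        exact (Nat.not_even_iff_odd.2 hi) hc
      have := key _ hodd
      rw [hb'.invol] at this
      simp only [this]
      grind
    · exact key u hu
  -- The two sums share the number of orbits of `M` and `N`, and their right sides agree: each
  -- 2-coloring has half the points of `D` as zeros.
  have t1 := orbCount_triple ha' hM hN hA (hchord 1 M hM hMι) (hchord 1 N hN hNι)
  have t0 := orbCount_triple hb' hM hN hB (hchord 0 M hM hMι) (hchord 0 N hN hNι)
  have c1 := card_eq_two_mul_ncard ha' hA
  have c0 := card_eq_two_mul_ncard hb' hB
  have : {u : D | rank w ι 1 (idx u) = 0}.ncard = {u : D | rank w ι 0 (idx u) = 0}.ncard := by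
    omega
  rw [this, ← t0] at t1
  grind

end

end KempeParity

/-! ### The exchange theorem for plane cubic graphs. -/

namespace KempeParity

/-! ### Three matchings drawn in the plane -/

open Set Function

/-- A drawing of the cubic graph given by three matchings: `half c v` runs from the vertex `v` to
the middle of the edge of color `c` at `v`, and different edges meet only at common ends. -/
structure PlaneSystem {V : Type*} (ρ : Color → V → V) (half : Color → V → ℝ → ℂ) : Prop where
  matching : ∀ c, IsMatching (ρ c)
  cont : ∀ c v, Continuous (half c v)
  start : ∀ c c' v, half c v 0 = half c' v 0
  mid : ∀ c v, half c (ρ c v) 1 = half c v 1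
  disjoint : ∀ c c' v v', v ≠ v' → ¬ (c = c' ∧ v' = ρ c v) → ∀ s t, half c v s ≠ half c' v' t

section
variable {V : Type*} {ρ : Color → V → V} {half : Color → V → ℝ → ℂ}

/-- The chain consists of half edges at vertices of `T`. -/
def Over (half : Color → V → ℝ → ℂ) (A : List (ℝ → ℂ)) (T : Set V) : Prop :=
  ∀ γ ∈ A, ∃ c, ∃ v ∈ T, γ = half c v

/-- The chain consists of half edges of edges with both ends in `T`. -/
def Inside (ρ : Color → V → V) (half : Color → V → ℝ → ℂ) (A : List (ℝ → ℂ)) (T : Set V) : Prop :=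
  ∀ γ ∈ A, ∃ c, ∃ v ∈ T, ρ c v ∈ T ∧ γ = half c v

theorem Inside.over {A : List (ℝ → ℂ)} {T : Set V} (h : Inside ρ half A T) : Over half A T :=
  fun γ hγ => by
    obtain ⟨c, v, hv, -, e⟩ := h γ hγ
    exact ⟨c, v, hv, e⟩

theorem Inside.mono {A : List (ℝ → ℂ)} {T T' : Set V} (h : Inside ρ half A T) (hT : T ⊆ T') :
    Inside ρ half A T' :=
  fun γ hγ => by
    obtain ⟨c, v, hv, hv', e⟩ := h γ hγ
    exact ⟨c, v, hT hv, hT hv', e⟩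

theorem Inside.append {A B : List (ℝ → ℂ)} {T : Set V} (h : Inside ρ half A T)
    (h' : Inside ρ half B T) : Inside ρ half (A ++ B) T :=
  fun γ hγ => (List.mem_append.1 hγ).elim (h γ) (h' γ)

/-- Two half edges can meet only at a common vertex or when they belong to the same edge. To exclude
the second case, one of the two chains must have both ends of its edges in `T`; for the other chain
the starting vertices suffice. -/
theorem PlaneSystem.chainDisjoint (hP : PlaneSystem ρ half) {A B : List (ℝ → ℂ)} {T T' : Set V}
    (hA : Inside ρ half A T) (hB : Over half B T') (h : Disjoint T T') : ChainDisjoint A B := by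
  intro γ hγ δ hδ
  obtain ⟨c, v, hv, hv', rfl⟩ := hA γ hγ
  obtain ⟨c', v', hv'', rfl⟩ := hB δ hδ
  refine hP.disjoint c c' v v' (fun e => ?_) fun e => ?_
  · exact Set.disjoint_left.1 h hv (e ▸ hv'')
  · exact Set.disjoint_left.1 h hv' (e.2 ▸ hv'')

/-- The color of step `j` of an enumeration. -/
def stepColor (a b : Color) (j : ℕ) : Color := if Even j then a else b

/-- The half edges of the `m` steps after place `p`. -/
def arcChain (half : Color → V → ℝ → ℂ) (a b : Color) (w : ℕ → V) (p : ℕ) : ℕ → List (ℝ → ℂ)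
  | 0 => []
  | m + 1 => arcChain half a b w p m ++
      [half (stepColor a b (p + m)) (w (p + m)), half (stepColor a b (p + m)) (w (p + m + 1))]

variable {a b c : Color} {D : Set V} {w : ℕ → V} {n : ℕ}

theorem arcChain_add (p m k : ℕ) : arcChain half a b w p (m + k) =
    arcChain half a b w p m ++ arcChain half a b w (p + m) k := by
  induction k with
  | zero => simp [arcChain]
  | succ k ih => rw [← add_assoc, arcChain, ih, arcChain, ← add_assoc]; simp

theorem IsEnumeration.step (he : IsEnumeration (ρ a) (ρ b) D w n) (j : ℕ) :
    w (j + 1) = ρ (stepColor a b j) (w j) := by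
  unfold stepColor
  split_ifs with h
  · exact he.step_even j h
  · exact he.step_odd j (Nat.not_even_iff_odd.1 h)

theorem isChain_edge (hP : PlaneSystem ρ half) (c₀ : Color) (v : V) :
    IsChain [half c v, half c (ρ c v)] (half c₀ v 0) (half c₀ (ρ c v) 0) := by
  have h1 := IsChain.single (hP.cont c v)
  have h2 := (IsChain.single (hP.cont c (ρ c v))).symm
  rw [hP.mid] at h2
  rw [hP.start c₀ c v, hP.start c₀ c (ρ c v)]
  exact h1.append h2

theorem isChain_arcChain (hP : PlaneSystem ρ half) (he : IsEnumeration (ρ a) (ρ b) D w n)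
    (c₀ : Color) (p m : ℕ) :
    IsChain (arcChain half a b w p m) (half c₀ (w p) 0) (half c₀ (w (p + m)) 0) := by
  induction m with
  | zero => exact IsChain.nil _
  | succ m ih =>
    refine ih.append ?_
    rw [← add_assoc, he.step]
    exact isChain_edge hP c₀ _

theorem inside_arcChain (hP : PlaneSystem ρ half) (he : IsEnumeration (ρ a) (ρ b) D w n)
    (p m : ℕ) : Inside ρ half (arcChain half a b w p m) (w '' Icc p (p + m)) := by
  induction m with
  | zero => intro γ hγ; simp [arcChain] at hγ
  | succ m ih =>
    refine (ih.mono (image_mono (Icc_subset_Icc_right (by omega)))).append ?_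
    have h1 : w (p + m) ∈ w '' Icc p (p + (m + 1)) := ⟨p + m, ⟨by omega, by omega⟩, rfl⟩
    have h2 : w (p + m + 1) ∈ w '' Icc p (p + (m + 1)) := ⟨p + m + 1, ⟨by omega, by omega⟩, rfl⟩
    intro γ hγ
    simp only [List.mem_cons, List.not_mem_nil, or_false] at hγ
    rcases hγ with rfl | rfl
    · exact ⟨_, _, h1, by rw [← he.step]; exact h2, rfl⟩
    · exact ⟨_, _, h2, by rw [he.step, (hP.matching _).invol]; exact h1, rfl⟩

/-- The walk with its initial half edge at `x` cut off: it starts at the middle of the first edge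
and, after i double steps, has reached the middle of a later one. Only half edges at vertices off
`D` are used, so that the chain avoids the circuit. -/
theorem exists_middle_chain (hP : PlaneSystem ρ half) {s : Color} (hD : MapsTo (ρ s) D D) (x : V) :
    ∀ i ≤ returnTime (ρ s) (ρ c) D x, ∃ L, IsChain L (half c x 1)
        (half c ((ρ s ∘ ρ c)^[i] x) 1) ∧
      ∀ γ ∈ L, ∃ k, ∃ v ∈ returnPath (ρ s) (ρ c) D x, v ∉ D ∧
        ρ k v ∈ returnPath (ρ s) (ρ c) D x ∧ γ = half k v := by
  intro i
  induction i with
  | zero => exact fun _ => ⟨[], IsChain.nil _, by simp⟩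
  | succ i ih =>
    intro hi
    obtain ⟨L, hL, hL'⟩ := ih (by omega)
    set z := ρ c ((ρ s ∘ ρ c)^[i] x) with hz
    have hsz : (ρ s ∘ ρ c)^[i + 1] x = ρ s z := by rw [iterate_succ_apply', comp_apply]
    have hz1 : z ∈ returnPath (ρ s) (ρ c) D x := ⟨i, by omega, Or.inr rfl⟩
    have hz2 : ρ s z ∈ returnPath (ρ s) (ρ c) D x := ⟨i + 1, hi, Or.inl hsz.symm⟩
    have hzD : z ∉ D := iterate_notMem_of_lt hi
    have hzD' : ρ s z ∉ D := by rwa [involutive_mem_iff (hP.matching s).invol hD]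
    have hc := returnPath_mapsTo (s := ρ s) (D := D) (hP.matching c).invol x
    refine ⟨L ++ [half c z] ++ [half s z, half s (ρ s z)] ++ [half c (ρ s z)], ?_, ?_⟩
    · have e1 := (IsChain.single (hP.cont c z)).symm
      have e2 := IsChain.single (hP.cont c (ρ s z))
      rw [hz, hP.mid c, ← hz] at e1
      rw [hsz]
      exact ((hL.append e1).append (isChain_edge hP c z)).append e2
    · intro γ hγ
      simp only [List.mem_append, List.mem_cons, List.not_mem_nil, or_false] at hγ
      rcases hγ with ((hγ | rfl) | rfl | rfl) | rfl
      · exact hL' γ hγ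
      · exact ⟨c, z, hz1, hzD, hc hz1, rfl⟩
      · exact ⟨s, z, hz1, hzD, hz2, rfl⟩
      · exact ⟨s, ρ s z, hz2, hzD', by rwa [(hP.matching s).invol], rfl⟩
      · exact ⟨c, ρ s z, hz2, hzD', hc hz2, rfl⟩

theorem half_firstReturn_one (hP : PlaneSystem ρ half) (s : Color) (x : V) :
    half c (firstReturn (ρ s) (ρ c) D x) 1 =
      half c ((ρ s ∘ ρ c)^[returnTime (ρ s) (ρ c) D x] x) 1 := hP.mid c _

/-- Together with the half edge at `x`, `K` forms a complete chord of the circuit. It is split at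
the middle of its first edge because that is the point where `side` is measured. -/
theorem exists_return_chain (hP : PlaneSystem ρ half) {s : Color} (hD : MapsTo (ρ s) D D)
    (x : V) :
    ∃ K, IsChain K (half c x 1) (half c (firstReturn (ρ s) (ρ c) D x) 0) ∧
      Inside ρ half ([half c x] ++ K) (returnPath (ρ s) (ρ c) D x) ∧
      Over half K {v | v = firstReturn (ρ s) (ρ c) D x ∨ v ∉ D} := by
  obtain ⟨L, hL, hL'⟩ := exists_middle_chain (c := c) hP hD x _ le_rfl
  have e := (IsChain.single (hP.cont c (firstReturn (ρ s) (ρ c) D x))).symm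
  rw [half_firstReturn_one hP] at e
  have hc := returnPath_mapsTo (s := ρ s) (D := D) (hP.matching c).invol x
  refine ⟨_, hL.append e, ?_, ?_⟩
  · intro γ hγ
    simp only [List.mem_append, List.mem_cons, List.not_mem_nil, or_false] at hγ
    rcases hγ with rfl | hγ | rfl
    · exact ⟨c, x, self_mem_returnPath x, hc (self_mem_returnPath x), rfl⟩
    · obtain ⟨k, v, hv, -, hv', e⟩ := hL' γ hγ
      exact ⟨k, v, hv, hv', e⟩
    · exact ⟨c, _, firstReturn_mem_returnPath x, hc (firstReturn_mem_returnPath x), rfl⟩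
  · intro γ hγ
    simp only [List.mem_append, List.mem_cons, List.not_mem_nil, or_false] at hγ
    rcases hγ with hγ | rfl
    · obtain ⟨k, v, -, hv, -, e⟩ := hL' γ hγ
      exact ⟨k, v, Or.inr hv, e⟩
    · exact ⟨c, _, Or.inl rfl, rfl⟩

/-- The side of the circuit `D` on which the edge of color `c` at a vertex starts. -/
noncomputable def side (half : Color → V → ℝ → ℂ) (a b c : Color) (w : ℕ → V) (n : ℕ) (v : V) :
    ZMod 2 :=
  chainTurn (arcChain half a b w 0 n) (half c v 1)

/-- Along a chord the label is constant because the middle chain avoids the circuit; interlacing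
chords differ by `chainTurn_add_chainTurn_of_interlace`. As `side` does not involve `s`, the
matchings induced through the two colors of the circuit obtain one common labelling. -/
theorem isSideLabelling_side [Finite V] (hP : PlaneSystem ρ half)
    (he : IsEnumeration (ρ a) (ρ b) D w n) {s : Color} (hD : MapsTo (ρ s) D D) :
    IsSideLabelling (restrictTo (firstReturn (ρ s) (ρ c) D) D) w n (side half a b c w n) := by
  have hcoe : ∀ u : D, (restrictTo (firstReturn (ρ s) (ρ c) D) D u : V) =
      firstReturn (ρ s) (ρ c) D u := fun u => restrictTo_coe
    (firstReturn_mem (hP.matching s).invol (hP.matching c).invol hD u.2)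
  have hwD : w '' Icc 0 (0 + n) ⊆ D := by
    rintro _ ⟨i, hi, rfl⟩
    rcases Nat.lt_or_ge i n with h | h
    · exact he.mem h
    · have : i = n := by have := hi.2; omega
      rw [this, he.closed]
      exact he.mem he.pos
  constructor
  · intro u
    obtain ⟨L, hL, hL'⟩ := exists_middle_chain (c := c) hP hD (u : V) _ le_rfl
    have hZ := isChain_arcChain hP he c 0 n
    rw [zero_add, he.closed] at hZ
    have hdis : ChainDisjoint L (arcChain half a b w 0 n) := by
      refine (hP.chainDisjoint ((inside_arcChain hP he 0 n).mono hwD) (T' := Dᶜ) ?_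
        disjoint_compl_right).symm
      intro γ hγ
      obtain ⟨k, v, -, hv, -, e⟩ := hL' γ hγ
      exact ⟨k, v, hv, e⟩
    rw [side, side, hcoe, half_firstReturn_one hP]
    exact (chainTurn_eq_of_disjoint hZ hL hdis).symm
  · intro i₁ i₂ i₃ i₄ h12 h23 h34 h4n u v hu hv hMu hMv
    rw [hcoe] at hMu hMv
    obtain ⟨K, hK, hK1, hK2⟩ := exists_return_chain (c := c) hP hD (u : V)
    obtain ⟨K', hK', hK1', hK2'⟩ := exists_return_chain (c := c) hP hD (v : V)
    have hne : ∀ i j, i < n → j < n → i ≠ j → w i ≠ w j := fun i j hi hj hij h =>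
      hij (he.injOn hi hj h)
    have hmemD : ∀ i, i < n → w i ∈ D := fun i hi => he.mem hi
    have hdP : Disjoint (returnPath (ρ s) (ρ c) D u) (returnPath (ρ s) (ρ c) D v) := by
      refine returnPath_disjoint (hP.matching s).invol (hP.matching c).invol hD u.2 v.2 ?_ ?_
      · rw [hu, hv]; exact hne _ _ (by omega) (by omega) (by omega)
      · rw [hMu, hv]; exact hne _ _ (by omega) (by omega) (by omega)
    set α := arcChain half a b w i₁ (i₂ - i₁) with hα
    set β := arcChain half a b w i₂ (i₃ - i₂) with hβ
    set γ := arcChain half a b w i₃ (i₄ - i₃) with hγ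
    -- The fourth arc passes through the base point `w n = w 0` of the enumeration and so comes in
    -- two pieces.
    set δ := arcChain half a b w i₄ (n - i₄) ++ arcChain half a b w 0 i₁ with hδ
    have cα := isChain_arcChain hP he c i₁ (i₂ - i₁)
    have cβ := isChain_arcChain hP he c i₂ (i₃ - i₂)
    have cγ := isChain_arcChain hP he c i₃ (i₄ - i₃)
    have cδ := isChain_arcChain hP he c i₄ (n - i₄)
    have cδ' := isChain_arcChain hP he c 0 i₁
    rw [Nat.add_sub_cancel' (by omega)] at cα cβ cγ cδ
    rw [he.closed] at cδ
    rw [zero_add] at cδ'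
    have inα := inside_arcChain hP he i₁ (i₂ - i₁)
    have inβ := inside_arcChain hP he i₂ (i₃ - i₂)
    have inγ := inside_arcChain hP he i₃ (i₄ - i₃)
    have inδ₁ := inside_arcChain hP he i₄ (n - i₄)
    have inδ₂ := inside_arcChain hP he 0 i₁
    rw [Nat.add_sub_cancel' (by omega)] at inα inβ inγ inδ₁
    have inδ : Inside ρ half δ (w '' {j | j < n ∧ (i₄ ≤ j ∨ j ≤ i₁)}) := by
      refine (inδ₁.mono ?_).append (inδ₂.mono ?_)
      · rintro _ ⟨j, hj, rfl⟩
        rcases Nat.lt_or_ge j n with h | h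
        · exact ⟨j, ⟨h, Or.inl hj.1⟩, rfl⟩
        · have : j = n := by have := hj.2; omega
          exact ⟨0, ⟨he.pos, Or.inr (Nat.zero_le _)⟩, by rw [this, he.closed]⟩
      · rintro _ ⟨j, hj, rfl⟩
        have := hj.2
        exact ⟨j, ⟨by omega, Or.inr (by omega)⟩, rfl⟩
    have hsets : ∀ I J : Set ℕ, (∀ i ∈ I, i < n) → (∀ j ∈ J, j < n) → (∀ i ∈ I, i ∉ J) →
        Disjoint (w '' I) (w '' J) := by
      intro I J hI hJ hIJ
      refine Set.disjoint_left.2 ?_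
      rintro _ ⟨i, hi, rfl⟩ ⟨j, hj, h⟩
      have := he.injOn (hJ j hj) (hI i hi) h
      exact hIJ i hi (this ▸ hj)
    have hpt : ∀ (I : Set ℕ) (i : ℕ), (∀ j ∈ I, j < n) → i < n → i ∉ I →
        Disjoint (w '' I) {w i} := by
      intro I i hI hi hiI
      have := hsets I {i} hI (by simpa) (fun j hj h => hiI (by rwa [← mem_singleton_iff.1 h]))
      simpa using this
    have hend : ∀ (I : Set ℕ) (i : ℕ), (∀ j ∈ I, j < n) → i < n → i ∉ I →
        Disjoint (w '' I) {v | v = w i ∨ v ∉ D} := by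
      intro I i hI hi hiI
      refine Set.disjoint_left.2 ?_
      rintro _ ⟨j, hj, rfl⟩ (h | h)
      · exact Set.disjoint_left.1 (hpt I i hI hi hiI) ⟨j, hj, rfl⟩ h
      · exact h (hmemD j (hI j hj))
    have oP₁ : Over half [half c u] {w i₁} := by
      intro γ hγ; exact ⟨c, _, hu, List.mem_singleton.1 hγ⟩
    have oQ₁ : Over half [half c v] {w i₂} := by
      intro γ hγ; exact ⟨c, _, hv, List.mem_singleton.1 hγ⟩
    rw [hMu] at hK hK2
    rw [hMv] at hK' hK2'
    have cP := IsChain.single (hP.cont c (u : V))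
    have cQ := IsChain.single (hP.cont c (v : V))
    have start : ∀ i j, i < n → j < n → i ≠ j → half c (w i) 0 ≠ half c (w j) 0 := by
      intro i j hi hj hij h
      -- Two vertices may be joined by an edge of color `c`; comparing with a half edge of another
      -- color avoids this exception in `PlaneSystem.disjoint`.
      have hc : ∃ k, k ≠ c := by cases c <;> [exact ⟨.blue, nofun⟩; exact ⟨.red, nofun⟩;
        exact ⟨.red, nofun⟩]
      obtain ⟨k, hk⟩ := hc
      rw [hP.start c k (w j)] at h
      exact hP.disjoint c k (w i) (w j) (hne i j hi hj hij) (fun e => hk e.1.symm) 0 0 h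
    have hfull : ∀ z, chainTurn (arcChain half a b w 0 n) z = chainTurn (α ++ β ++ γ ++ δ) z := by
      intro z
      have : n = i₁ + ((i₂ - i₁) + ((i₃ - i₂) + ((i₄ - i₃) + (n - i₄)))) := by omega
      conv_lhs => rw [this]
      rw [arcChain_add, arcChain_add, arcChain_add, arcChain_add]
      rw [zero_add, show i₁ + (i₂ - i₁) = i₂ by omega, show i₂ + (i₃ - i₂) = i₃ by omega,
        show i₃ + (i₄ - i₃) = i₄ by omega]
      simp only [chainTurn_append, hα, hβ, hγ, hδ]
      ring
    rw [side, side, hfull, hfull]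
    have bα : ∀ j ∈ Icc i₁ i₂, j < n := fun j hj => by have := hj.2; omega
    have bβ : ∀ j ∈ Icc i₂ i₃, j < n := fun j hj => by have := hj.2; omega
    have bγ : ∀ j ∈ Icc i₃ i₄, j < n := fun j hj => by have := hj.2; omega
    have bδ : ∀ j ∈ {j | j < n ∧ (i₄ ≤ j ∨ j ≤ i₁)}, j < n := fun j hj => hj.1
    refine chainTurn_add_chainTurn_of_interlace (P₁ := [half c u]) (P₂ := K) (Q₁ := [half c v])
      (Q₂ := K') cα cβ cγ (cδ.append cδ') (by rwa [← hu]) hK (by rwa [← hv]) hK'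
      (start _ _ (by omega) (by omega) (by omega)) (start _ _ (by omega) (by omega) (by omega))
      (start _ _ (by omega) (by omega) (by omega))
      (hP.chainDisjoint inα inγ.over (hsets _ _ bα bγ ?_))
      (hP.chainDisjoint inβ inδ.over (hsets _ _ bβ bδ ?_))
      (hP.chainDisjoint hK1 hK1'.over hdP)
      (hP.chainDisjoint inβ oP₁ (hpt _ _ bβ (by omega) ?_)).symm
      (hP.chainDisjoint inγ oP₁ (hpt _ _ bγ (by omega) ?_)).symm
      (hP.chainDisjoint inα hK2 (hend _ _ bα (by omega) ?_)).symm
      (hP.chainDisjoint inδ hK2 (hend _ _ bδ (by omega) ?_)).symm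
      (hP.chainDisjoint inγ oQ₁ (hpt _ _ bγ (by omega) ?_)).symm
      (hP.chainDisjoint inδ oQ₁ (hpt _ _ bδ (by omega) ?_)).symm
      (hP.chainDisjoint inα hK2' (hend _ _ bα (by omega) ?_)).symm
      (hP.chainDisjoint inβ hK2' (hend _ _ bβ (by omega) ?_)).symm
    all_goals simp only [mem_Icc, mem_ofPred_eq]
    all_goals omega

end

/-! ### Exchanging two matchings along an orbit -/

section
variable {V : Type*} {ρ : Color → V → V} {D : Set V} {a b c : Color}

open Classical in
/-- Exchange the matchings `a` and `b` on `D`. -/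
noncomputable def exchange (ρ : Color → V → V) (a b : Color) (D : Set V) : Color → V → V :=
  fun c v => if v ∈ D then ρ (Equiv.swap a b c) v else ρ c v

theorem exchange_of_mem {v : V} (h : v ∈ D) :
    exchange ρ a b D c v = ρ (Equiv.swap a b c) v := if_pos h

theorem exchange_of_notMem {v : V} (h : v ∉ D) : exchange ρ a b D c v = ρ c v := if_neg h

/-- The number of two-colored circuits of the graph given by three matchings. -/
noncomputable def colorCount (ρ : Color → V → V) : ℕ :=
  orbCount (ρ .red) (ρ .blue) + orbCount (ρ .red) (ρ .purple) + orbCount (ρ .blue) (ρ .purple)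

theorem colorCount_eq (ρ : Color → V → V) (hab : a ≠ b) (hac : a ≠ c) (hbc : b ≠ c) :
    colorCount ρ = orbCount (ρ a) (ρ b) + (orbCount (ρ a) (ρ c) + orbCount (ρ b) (ρ c)) := by
  unfold colorCount
  have h1 := orbCount_comm (ρ .red) (ρ .blue)
  have h2 := orbCount_comm (ρ .red) (ρ .purple)
  have h3 := orbCount_comm (ρ .blue) (ρ .purple)
  cases a <;> cases b <;> cases c <;> first | contradiction | omega

theorem exists_third (a b : Color) : ∃ c, a ≠ c ∧ b ≠ c := by
  cases a <;> cases b <;>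
    first
    | exact ⟨.red, by decide, by decide⟩
    | exact ⟨.blue, by decide, by decide⟩
    | exact ⟨.purple, by decide, by decide⟩

/-- Before its return the walk applies `s` only at points off `D`. -/
theorem firstReturn_congr {s s' t : V → V} (h : ∀ v ∉ D, s v = s' v) {x : V}
    (hex : ∃ n, t ((s ∘ t)^[n] x) ∈ D) : firstReturn s' t D x = firstReturn s t D x := by
  have key : ∀ i ≤ returnTime s t D x, (s' ∘ t)^[i] x = (s ∘ t)^[i] x := by
    intro i
    induction i with
    | zero => simp
    | succ i ih =>
      intro hi
      rw [iterate_succ_apply', iterate_succ_apply', ih (by omega)]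
      exact (h _ (iterate_notMem_of_lt hi)).symm
  have hspec : t ((s ∘ t)^[returnTime s t D x] x) ∈ D := by
    classical
    unfold returnTime
    rw [dif_pos hex]
    exact Nat.find_spec hex
  have hr : returnTime s' t D x = returnTime s t D x := by
    refine returnTime_eq (by rwa [key _ le_rfl]) fun i hi => ?_
    rw [key i hi.le]
    exact iterate_notMem_of_lt hi
  rw [firstReturn, hr, key _ le_rfl, firstReturn]

/-- The exchange alters the matching of color `k` only inside `D`. Orbits that avoid `D` and the
first returns to `D` are unaffected, so only the restricted matching is replaced by its partner. -/
theorem orbCount_exchange [Finite V] (hρ : ∀ c, IsMatching (ρ c))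
    {k : Color} (hk : MapsTo (ρ k) D D) (hk' : MapsTo (ρ (Equiv.swap a b k)) D D) :
    orbCount (exchange ρ a b D k) (ρ c) = {S | IsOrb (ρ k) (ρ c) S ∧ Disjoint S D}.ncard +
      orbCount (restrictTo (ρ (Equiv.swap a b k)) D)
        (restrictTo (firstReturn (ρ k) (ρ c) D) D) := by
  have hD : MapsTo (exchange ρ a b D k) D D := fun x hx => by
    rw [exchange_of_mem hx]; exact hk' hx
  have hm : IsMatching (exchange ρ a b D k) := by
    have hout : ∀ x ∉ D, ρ k x ∉ D := fun x hx => involutive_mapsTo_compl (hρ k).invol hk hx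
    refine ⟨fun x => ?_, fun x => ?_⟩
    · by_cases hx : x ∈ D
      · have := hD hx
        rw [exchange_of_mem this, exchange_of_mem hx, (hρ _).invol]
      · rw [exchange_of_notMem hx, exchange_of_notMem (hout x hx), (hρ _).invol]
    · by_cases hx : x ∈ D
      · rw [exchange_of_mem hx]; exact (hρ _).ne x
      · rw [exchange_of_notMem hx]; exact (hρ _).ne x
  rw [orbCount_eq_add hm (hρ c) hD]
  have e1 : {S | IsOrb (exchange ρ a b D k) (ρ c) S ∧ Disjoint S D} =
      {S | IsOrb (ρ k) (ρ c) S ∧ Disjoint S D} := by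
    ext S
    refine and_congr_left fun hS => isOrb_congr (fun x hx => ?_) fun _ _ => rfl
    exact exchange_of_notMem (Set.disjoint_left.1 hS hx)
  have e2 : restrictTo (exchange ρ a b D k) D = restrictTo (ρ (Equiv.swap a b k)) D := by
    funext x
    refine Subtype.ext ?_
    rw [restrictTo_coe (hD x.2), restrictTo_coe (hk' x.2), exchange_of_mem x.2]
  have e3 : restrictTo (firstReturn (exchange ρ a b D k) (ρ c) D) D =
      restrictTo (firstReturn (ρ k) (ρ c) D) D := by
    funext x
    have hex := exists_return (hρ k).invol (hρ c).invol hk x.2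
    have e := firstReturn_congr (s' := exchange ρ a b D k)
      (fun v hv => (exchange_of_notMem (a := a) (b := b) hv).symm) hex
    have hx := firstReturn_mem (hρ k).invol (hρ c).invol hk x.2
    refine Subtype.ext ?_
    rw [restrictTo_coe (e ▸ hx), restrictTo_coe hx, e]
  rw [e1, e2, e3]

/-- Exchanging two colors along a two-colored circuit of a cubic graph drawn in the plane preserves
the parity of the number of two-colored circuits. -/
theorem colorCount_exchange [Finite V] {half : Color → V → ℝ → ℂ} (hP : PlaneSystem ρ half)
    (hab : a ≠ b) (hD : IsOrb (ρ a) (ρ b) D) :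
    (colorCount (exchange ρ a b D) : ZMod 2) = colorCount ρ := by
  obtain ⟨c, hac, hbc⟩ := exists_third a b
  have hρ := hP.matching
  obtain ⟨w, n, he⟩ := exists_enumeration (hρ a) (hρ b) hD
  have hc : exchange ρ a b D c = ρ c := by
    funext v
    by_cases hv : v ∈ D
    · rw [exchange_of_mem hv, Equiv.swap_apply_of_ne_of_ne hac.symm hbc.symm]
    · exact exchange_of_notMem hv
  -- On `D` the two maps merely trade places, so the pair preserves the same sets as before.
  have hAB : orbCount (exchange ρ a b D a) (exchange ρ a b D b) = orbCount (ρ a) (ρ b) := by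
    have key : ∀ T : Set V, (MapsTo (exchange ρ a b D a) T T ∧ MapsTo (exchange ρ a b D b) T T) ↔
        (MapsTo (ρ a) T T ∧ MapsTo (ρ b) T T) := by
      intro T
      constructor
      · rintro ⟨h1, h2⟩
        refine ⟨fun x hx => ?_, fun x hx => ?_⟩ <;> by_cases hxD : x ∈ D
        · have := h2 hx
          rwa [exchange_of_mem hxD, Equiv.swap_apply_right] at this
        · have := h1 hx
          rwa [exchange_of_notMem hxD] at this
        · have := h1 hx
          rwa [exchange_of_mem hxD, Equiv.swap_apply_left] at this
        · have := h2 hx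
          rwa [exchange_of_notMem hxD] at this
      · rintro ⟨h1, h2⟩
        refine ⟨fun x hx => ?_, fun x hx => ?_⟩ <;> by_cases hxD : x ∈ D
        · rw [exchange_of_mem hxD, Equiv.swap_apply_left]; exact h2 hx
        · rw [exchange_of_notMem hxD]; exact h1 hx
        · rw [exchange_of_mem hxD, Equiv.swap_apply_right]; exact h1 hx
        · rw [exchange_of_notMem hxD]; exact h2 hx
    unfold orbCount IsOrb
    congr 1
    ext S
    simp only [mem_ofPred_eq]
    have k2 := key S
    have k3 : (∀ T ⊆ S, T.Nonempty → MapsTo (exchange ρ a b D a) T T →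
        MapsTo (exchange ρ a b D b) T T → T = S) ↔
        ∀ T ⊆ S, T.Nonempty → MapsTo (ρ a) T T → MapsTo (ρ b) T T → T = S :=
      ⟨fun h T hT hn h1 h2 => h T hT hn ((key T).2 ⟨h1, h2⟩).1 ((key T).2 ⟨h1, h2⟩).2,
        fun h T hT hn h1 h2 => h T hT hn ((key T).1 ⟨h1, h2⟩).1 ((key T).1 ⟨h1, h2⟩).2⟩
    tauto
  have ha := hD.2.1
  have hb := hD.2.2.1
  have e1 := orbCount_exchange (a := a) (b := b) (k := a) (c := c) hρ ha
    (by rwa [Equiv.swap_apply_left])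
  have e2 := orbCount_exchange (a := a) (b := b) (k := b) (c := c) hρ hb
    (by rwa [Equiv.swap_apply_right])
  rw [Equiv.swap_apply_left] at e1
  rw [Equiv.swap_apply_right] at e2
  -- This equates a with M plus a with N to b with M plus b with N. Regrouped mod 2, it compares a
  -- with M plus b with N, before the exchange, to b with M plus a with N, after it.
  have key := orbCount_add_orbCount_eq (hρ a) (hρ b) ha hb he
    (isMatching_firstReturn (hρ a) (hρ c) ha) (isMatching_firstReturn (hρ b) (hρ c) hb)
    (isSideLabelling_side (c := c) hP he ha) (isSideLabelling_side (c := c) hP he hb)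
  rw [colorCount_eq _ hab hac hbc, colorCount_eq _ hab hac hbc, hAB, hc, e1, e2,
    orbCount_eq_add (hρ a) (hρ c) ha, orbCount_eq_add (hρ b) (hρ c) hb]
  push_cast
  grind

end

end KempeParity

/-! ### Colored cubic multigraphs: statements 1 and 3. -/

namespace KempeParity

/-! ### Colored cubic graphs as triples of matchings -/

open Set Function
open scoped Graph

/-- The graph `G` with coloring `C` is given by three matchings: `edge c v` is the edge of color `c`
at the vertex `pt v`, and `pt (ρ c v)` is its other end. -/
structure IsModel {V α β : Type*} (G : Graph α β) (C : β → Color) (pt : V → α)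
    (edge : Color → V → β) (ρ : Color → V → V) : Prop where
  inj : Injective pt
  range_eq : range pt = V(G)
  link : ∀ c v, G.IsLink (edge c v) (pt v) (pt (ρ c v))
  color : ∀ c v, C (edge c v) = c
  eq_edge : ∀ e v, G.Inc e (pt v) → e = edge (C e) v
  ne : ∀ c v, ρ c v ≠ v

section
variable {V α β : Type*} {G : Graph α β} {C : β → Color} {pt : V → α} {edge : Color → V → β}
  {ρ : Color → V → V}

theorem IsModel.edge_map (h : IsModel G C pt edge ρ) (c : Color) (v : V) :
    edge c (ρ c v) = edge c v := by
  have := h.eq_edge _ _ (h.link c v).inc_right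
  rw [h.color] at this
  exact this.symm

theorem IsModel.matching (h : IsModel G C pt edge ρ) (c : Color) : IsMatching (ρ c) where
  invol v := by
    have h1 := h.link c (ρ c v)
    rw [h.edge_map] at h1
    exact h.inj ((h.link c v).symm.right_unique h1).symm
  ne := h.ne c

theorem IsModel.eq_of_edge_eq (h : IsModel G C pt edge ρ) {c c' : Color} {v v' : V}
    (he : edge c v = edge c' v') : c = c' ∧ (v' = v ∨ v' = ρ c v) := by
  have hc : c = c' := by rw [← h.color c v, he, h.color]
  subst hc
  have h1 := h.link c v
  have h2 := h.link c v'
  rw [← he] at h2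
  refine ⟨rfl, (h2.left_eq_or_eq h1).imp (fun e => h.inj e) fun e => h.inj e⟩

theorem IsModel.exists_pt (h : IsModel G C pt edge ρ) {x : α} (hx : x ∈ V(G)) : ∃ v, pt v = x := by
  rwa [← h.range_eq] at hx

/-- The circuits of `G` with the colors `a` and `b`. -/
def circuitsWith (G : Graph α β) (C : β → Color) (a b : Color) : Set (Graph α β) :=
  {H | IsCircuit G H ∧ C '' E(H) = {a, b}}

variable {a b : Color}

/-- A model has no loops, so the two edges of the circuit at a vertex are distinct and thus of
different colors, which must be `a` and `b`. Following the circuit from any vertex then reaches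
every other by steps along `ρ a` and `ρ b`, whence minimality. -/
theorem IsModel.circuit_edges (h : IsModel G C pt edge ρ) {H : Graph α β}
    (hH : H ∈ circuitsWith G C a b) :
    (∀ x, pt x ∈ V(H) → edge a x ∈ E(H) ∧ edge b x ∈ E(H)) ∧
      IsOrb (ρ a) (ρ b) (pt ⁻¹' V(H)) := by
  obtain ⟨⟨hle, n, v, e, hn, hv, he, hV, hE, hl⟩, hC⟩ := hH
  have : NeZero n := ⟨hn.ne'⟩
  have hGl : ∀ i, G.IsLink (e i) (v i) (v (i + 1)) := fun i => (hl i).mono hle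
  have hcol : ∀ i, C (e i) = a ∨ C (e i) = b := fun i => by
    have : C (e i) ∈ C '' E(H) := mem_image_of_mem _ (by rw [hE]; exact mem_range_self i)
    rwa [hC] at this
  have hpt : ∀ i, ∃ x, pt x = v i := fun i => h.exists_pt (hGl i).left_mem
  have hloop : ∀ i, v (i + 1) ≠ v i := by
    intro i hi
    obtain ⟨x, hx⟩ := hpt i
    have h1 := hGl i
    rw [hi, ← hx] at h1
    have h2 := h.eq_edge _ _ h1.inc_left
    have h3 := h.link (C (e i)) x
    rw [← h2] at h3
    exact h.ne _ _ (h.inj (h1.right_unique h3)).symm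
  have hedges : ∀ x, pt x ∈ V(H) → edge a x ∈ E(H) ∧ edge b x ∈ E(H) := by
    intro x hx
    rw [hV] at hx
    obtain ⟨i, hi⟩ := hx
    have h1 := hGl i
    have h2 := hGl (i - 1)
    rw [sub_add_cancel] at h2
    rw [hi] at h1 h2
    have e1 := h.eq_edge _ _ h1.inc_left
    have e2 := h.eq_edge _ _ h2.inc_right
    have hne : e i ≠ e (i - 1) := fun hh => by
      have := he hh
      apply hloop (i - 1)
      rw [sub_add_cancel, ← this]
    have hcne : C (e i) ≠ C (e (i - 1)) := fun hh => hne (by rw [e1, e2, hh])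
    have m1 : e i ∈ E(H) := hE ▸ mem_range_self i
    have m2 : e (i - 1) ∈ E(H) := hE ▸ mem_range_self (i - 1)
    rw [e1] at m1
    rw [e2] at m2
    rcases hcol i with c1 | c1 <;> rcases hcol (i - 1) with c2 | c2 <;> rw [c1] at m1 <;>
      rw [c2] at m2
    · exact absurd (c1.trans c2.symm) hcne
    · exact ⟨m1, m2⟩
    · exact ⟨m2, m1⟩
    · exact absurd (c1.trans c2.symm) hcne
  refine ⟨hedges, ?_, ?_, ?_, ?_⟩
  · obtain ⟨x, hx⟩ := hpt 0
    exact ⟨x, by rw [mem_preimage, hx, hV]; exact mem_range_self 0⟩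
  · intro x hx
    exact (Graph.IsLink.of_compatible (.of_ge hle) (hedges x hx).1 (h.link a x)).right_mem
  · intro x hx
    exact (Graph.IsLink.of_compatible (.of_ge hle) (hedges x hx).2 (h.link b x)).right_mem
  · rintro T hT ⟨x, hx⟩ ha hb
    refine hT.antisymm fun y hy => ?_
    have hx' := hT hx
    rw [mem_preimage, hV] at hx' hy
    obtain ⟨i, hi⟩ := hx'
    obtain ⟨j, hj⟩ := hy
    have key : ∀ m : ℕ, ∃ z ∈ T, pt z = v (i + m) := by
      intro m
      induction m with
      | zero => exact ⟨x, hx, by simp [hi]⟩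
      | succ m ih =>
        obtain ⟨z, hz, hzv⟩ := ih
        have h1 := hGl (i + m)
        rw [← hzv] at h1
        have e1 := h.eq_edge _ _ h1.inc_left
        have h3 := h.link (C (e (i + m))) z
        rw [← e1] at h3
        refine ⟨ρ (C (e (i + m))) z, ?_, ?_⟩
        · rcases hcol (i + m) with c1 | c1 <;> rw [c1]
          · exact ha hz
          · exact hb hz
        · rw [h3.right_unique h1]
          push_cast
          rw [add_assoc]
    obtain ⟨z, hz, hzv⟩ := key (j - i).val
    rw [ZMod.natCast_zmod_val, add_sub_cancel, hj] at hzv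
    rwa [← h.inj hzv]

theorem IsModel.mem_edgeSet_iff (h : IsModel G C pt edge ρ) {H : Graph α β}
    (hH : H ∈ circuitsWith G C a b) (e : β) :
    e ∈ E(H) ↔ ∃ x, pt x ∈ V(H) ∧ (e = edge a x ∨ e = edge b x) := by
  constructor
  · intro he
    obtain ⟨x, y, hl⟩ := Graph.exists_isLink_of_mem_edgeSet he
    have hG := hl.mono hH.1.1
    obtain ⟨z, rfl⟩ := h.exists_pt hG.left_mem
    have h1 := h.eq_edge _ _ hG.inc_left
    have h2 : C e ∈ C '' E(H) := mem_image_of_mem _ he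
    rw [hH.2] at h2
    refine ⟨z, hl.left_mem, ?_⟩
    rcases h2 with c1 | c1
    · left; rw [h1, c1]
    · right; rw [h1, mem_singleton_iff.1 c1]
  · rintro ⟨x, hx, rfl | rfl⟩
    · exact ((h.circuit_edges hH).1 x hx).1
    · exact ((h.circuit_edges hH).1 x hx).2

theorem IsModel.injOn_preimage (h : IsModel G C pt edge ρ) :
    InjOn (fun H : Graph α β => pt ⁻¹' V(H)) (circuitsWith G C a b) := by
  intro H hH H' hH' hHH
  have hx : ∀ x, pt x ∈ V(H) ↔ pt x ∈ V(H') := fun x => by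
    have := congrArg (x ∈ ·) hHH
    simpa using this
  refine (Graph.Compatible.of_le_le hH.1.1 hH'.1.1).ext ?_ ?_
  · ext y
    constructor <;> intro hy
    · obtain ⟨x, rfl⟩ := h.exists_pt (hH.1.1.vertexSet_mono hy)
      exact (hx x).1 hy
    · obtain ⟨x, rfl⟩ := h.exists_pt (hH'.1.1.vertexSet_mono hy)
      exact (hx x).2 hy
  · ext e
    rw [h.mem_edgeSet_iff hH, h.mem_edgeSet_iff hH']
    simp only [hx]

/-- The two-colored circuit formed by an orbit. -/
def orbitGraph (G : Graph α β) (pt : V → α) (edge : Color → V → β) (a b : Color) (D : Set V)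
    (hl : ∀ e x y, G.IsLink e x y → (∃ v ∈ D, e = edge a v ∨ e = edge b v) → x ∈ pt '' D) :
    Graph α β where
  vertexSet := pt '' D
  IsLink e x y := G.IsLink e x y ∧ ∃ v ∈ D, e = edge a v ∨ e = edge b v
  isLink_symm _ _ := ⟨fun _ _ h => ⟨h.1.symm, h.2⟩⟩
  eq_or_eq_of_isLink_of_isLink _ _ _ _ _ h h' := h.1.left_eq_or_eq h'.1
  left_mem_of_isLink e x y h := hl e x y h.1 h.2

theorem IsModel.exists_circuit [Finite V] (h : IsModel G C pt edge ρ) (hab : a ≠ b)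
    {D : Set V} (hD : IsOrb (ρ a) (ρ b) D) : ∃ H ∈ circuitsWith G C a b, pt ⁻¹' V(H) = D := by
  obtain ⟨w, n, he⟩ := exists_enumeration (h.matching a) (h.matching b) hD
  have hends : ∀ k v x y, (k = a ∨ k = b) → v ∈ D → G.IsLink (edge k v) x y → x ∈ pt '' D := by
    intro k v x y hk hv hl
    have hkD : ρ k v ∈ D := by
      rcases hk with rfl | rfl
      · exact hD.2.1 hv
      · exact hD.2.2.1 hv
    rcases hl.left_eq_or_eq (h.link k v) with e | e
    · exact ⟨v, hv, e.symm⟩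
    · exact ⟨_, hkD, e.symm⟩
  have hl : ∀ e x y, G.IsLink e x y → (∃ v ∈ D, e = edge a v ∨ e = edge b v) → x ∈ pt '' D := by
    rintro e x y hxy ⟨v, hv, rfl | rfl⟩
    · exact hends a v x y (Or.inl rfl) hv hxy
    · exact hends b v x y (Or.inr rfl) hv hxy
  have hnz : NeZero n := ⟨he.pos.ne'⟩
  have hn2 : 2 ≤ n := by
    obtain ⟨k, hk⟩ := he.even
    have := he.pos
    omega
  have hsucc : ∀ i : ZMod n, (i + 1).val = if i.val + 1 < n then i.val + 1 else 0 := by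
    intro i
    have hi := ZMod.val_lt i
    rw [ZMod.val_add, ZMod.val_one'' (by omega)]
    split_ifs with h
    · exact Nat.mod_eq_of_lt h
    · rw [show i.val + 1 = n by omega, Nat.mod_self]
  have hwsucc : ∀ i : ZMod n, w (i + 1).val = w (i.val + 1) := by
    intro i
    have hi := ZMod.val_lt i
    rw [hsucc]
    split_ifs with h
    · rfl
    · rw [show i.val + 1 = n by omega, he.closed]
  have hE : E(orbitGraph G pt edge a b D hl) = {e | ∃ v ∈ D, e = edge a v ∨ e = edge b v} := by
    ext e
    rw [Graph.edgeSet_eq_setOfPred_exists_isLink]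
    constructor
    · rintro ⟨x, y, -, hv⟩
      exact hv
    · rintro ⟨v, hv, hev⟩
      refine ⟨pt v, ?_⟩
      rcases hev with rfl | rfl
      · exact ⟨_, h.link a v, v, hv, Or.inl rfl⟩
      · exact ⟨_, h.link b v, v, hv, Or.inr rfl⟩
  have hstep : ∀ j, stepColor a b j = a ∨ stepColor a b j = b := fun j => by
    unfold stepColor; split_ifs <;> simp
  refine ⟨orbitGraph G pt edge a b D hl, ⟨⟨?_, n, fun i => pt (w i.val),
    fun i => edge (stepColor a b i.val) (w i.val), he.pos, ?_, ?_, ?_, ?_, ?_⟩, ?_⟩, ?_⟩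
  · refine ⟨?_, fun e x y hxy => hxy.1⟩
    rintro _ ⟨v, -, rfl⟩
    rw [← h.range_eq]
    exact mem_range_self v
  · intro i j hij
    exact ZMod.val_injective n (he.injOn (ZMod.val_lt i) (ZMod.val_lt j) (h.inj hij))
  · intro i j hij
    obtain ⟨h1, h2⟩ := h.eq_of_edge_eq hij
    rcases h2 with h2 | h2
    · exact (ZMod.val_injective n (he.injOn (ZMod.val_lt j) (ZMod.val_lt i) h2)).symm
    -- Here j follows i cyclically. Consecutive steps have different colors, also across the closing
    -- point because n is even, whereas the two edges have the same color.
    · exfalso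
      rw [← he.step, ← hwsucc] at h2
      have h3 : j.val = (i + 1).val := he.injOn (ZMod.val_lt j) (ZMod.val_lt _) h2
      have hpar : Even j.val ↔ ¬ Even i.val := by
        rw [h3, hsucc]
        split_ifs with hlt
        · exact Nat.even_add_one
        · have h5 : i.val + 1 = n := by have := ZMod.val_lt i; omega
          have h6 := he.even
          rw [← h5, Nat.even_add_one] at h6
          simp [h6]
      unfold stepColor at h1
      by_cases hi : Even i.val
      · rw [if_pos hi, if_neg (fun hj => hpar.1 hj hi)] at h1
        exact hab h1
      · rw [if_neg hi, if_pos (hpar.2 hi)] at h1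
        exact hab h1.symm
  · ext x
    constructor
    · rintro ⟨v, hv, rfl⟩
      rw [← he.image_eq] at hv
      obtain ⟨i, hi, rfl⟩ := hv
      exact ⟨(i : ZMod n), by simp only [ZMod.val_cast_of_lt hi]⟩
    · rintro ⟨i, rfl⟩
      exact ⟨_, he.mem (ZMod.val_lt i), rfl⟩
  · rw [hE]
    have hsurj : ∀ j < n, edge (stepColor a b j) (w j) ∈
        range fun i : ZMod n => edge (stepColor a b i.val) (w i.val) := fun j hj =>
      ⟨(j : ZMod n), by simp only [ZMod.val_cast_of_lt hj]⟩
    have hprev : ∀ j < n, edge (stepColor a b j) (w (j + 1)) ∈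
        range fun i : ZMod n => edge (stepColor a b i.val) (w i.val) := fun j hj => by
      rw [he.step, h.edge_map]
      exact hsurj j hj
    ext e
    constructor
    · rintro ⟨v, hv, hev⟩
      rw [← he.image_eq] at hv
      obtain ⟨i, hi, rfl⟩ := hv
      simp only [mem_Iio] at hi
      rcases Nat.even_or_odd i with hpar | hpar
      · rcases hev with rfl | rfl
        · have := hsurj i hi
          rwa [stepColor, if_pos hpar] at this
        · obtain ⟨j, hj, hjo, hjw⟩ : ∃ j < n, Odd j ∧ w (j + 1) = w i := by
            rcases Nat.eq_zero_or_pos i with rfl | h0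
            · obtain ⟨k, hk⟩ := he.even
              exact ⟨n - 1, by omega, ⟨k - 1, by omega⟩,
                by rw [show n - 1 + 1 = n by omega, he.closed]⟩
            · obtain ⟨k, hk⟩ := hpar
              exact ⟨i - 1, by omega, ⟨k - 1, by omega⟩, by rw [show i - 1 + 1 = i by omega]⟩
          have := hprev j hj
          rwa [stepColor, if_neg (Nat.not_even_iff_odd.2 hjo), hjw] at this
      · rcases hev with rfl | rfl
        · obtain ⟨k, hk⟩ := hpar
          have := hprev (2 * k) (by omega)
          rwa [stepColor, if_pos (by simp), ← hk] at this
        · have := hsurj i hi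
          rwa [stepColor, if_neg (Nat.not_even_iff_odd.2 hpar)] at this
    · rintro ⟨i, rfl⟩
      refine ⟨_, he.mem (ZMod.val_lt i), ?_⟩
      rcases hstep i.val with e | e
      · left; simp only [e]
      · right; simp only [e]
  · intro i
    refine ⟨?_, _, he.mem (ZMod.val_lt i), ?_⟩
    · simp only [hwsucc, he.step]
      exact h.link _ _
    · rcases hstep i.val with e | e
      · left; simp only [e]
      · right; simp only [e]
  · rw [hE]
    ext k
    constructor
    · rintro ⟨e, ⟨v, hv, rfl | rfl⟩, rfl⟩
      · left; exact h.color a v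
      · right; exact h.color b v
    · obtain ⟨v, hv⟩ := hD.1
      rintro (rfl | hk)
      · exact ⟨_, ⟨v, hv, Or.inl rfl⟩, h.color _ v⟩
      · rw [mem_singleton_iff.1 hk]
        exact ⟨_, ⟨v, hv, Or.inr rfl⟩, h.color _ v⟩
  · ext x
    constructor
    · rintro ⟨v, hv, hvx⟩
      rwa [← h.inj hvx]
    · intro hx
      exact ⟨x, hx, rfl⟩

theorem IsModel.ncard_circuitsWith [Finite V] (h : IsModel G C pt edge ρ) (hab : a ≠ b) :
    (circuitsWith G C a b).Finite ∧ (circuitsWith G C a b).ncard = orbCount (ρ a) (ρ b) := by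
  have him : (fun H : Graph α β => pt ⁻¹' V(H)) '' circuitsWith G C a b =
      {S | IsOrb (ρ a) (ρ b) S} := by
    ext S
    constructor
    · rintro ⟨H, hH, rfl⟩
      exact (h.circuit_edges hH).2
    · intro hS
      obtain ⟨H, hH, e⟩ := h.exists_circuit hab hS
      exact ⟨H, hH, e⟩
  exact ⟨Set.Finite.of_finite_image (Set.toFinite _) h.injOn_preimage,
    by rw [← h.injOn_preimage.ncard_image, him, orbCount]⟩

theorem twoColorCircuits_eq (G : Graph α β) (C : β → Color) : twoColorCircuits G C =
    circuitsWith G C .red .blue ∪ circuitsWith G C .red .purple ∪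
      circuitsWith G C .blue .purple := by
  ext H
  simp only [twoColorCircuits, circuitsWith, mem_ofPred_eq, mem_union]
  rw [Set.ncard_eq_two]
  constructor
  · rintro ⟨h1, x, y, hxy, e⟩
    have e' := e.trans (Set.pair_comm x y)
    cases x <;> cases y <;> first | exact absurd rfl hxy | tauto
  · rintro ((⟨h1, e⟩ | ⟨h1, e⟩) | ⟨h1, e⟩)
    · exact ⟨h1, _, _, by decide, e⟩
    · exact ⟨h1, _, _, by decide, e⟩
    · exact ⟨h1, _, _, by decide, e⟩

theorem IsModel.circuitCount_eq [Finite V] (h : IsModel G C pt edge ρ) :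
    circuitCount G C = colorCount ρ := by
  obtain ⟨f1, n1⟩ := h.ncard_circuitsWith (a := .red) (b := .blue) (by decide)
  obtain ⟨f2, n2⟩ := h.ncard_circuitsWith (a := .red) (b := .purple) (by decide)
  obtain ⟨f3, n3⟩ := h.ncard_circuitsWith (a := .blue) (b := .purple) (by decide)
  rw [circuitCount, twoColorCircuits_eq, colorCount, ← n1, ← n2, ← n3]
  rw [Set.ncard_union_eq _ (f1.union f2) f3, Set.ncard_union_eq _ f1 f2]
  · refine Set.disjoint_left.2 fun H h1 h2 => ?_
    have e := h1.2.symm.trans h2.2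
    have : Color.blue ∈ ({.red, .purple} : Set Color) := e ▸ (by simp)
    simp at this
  · refine Set.disjoint_left.2 fun H h1 h2 => ?_
    rcases h1 with h1 | h1
    · have e := h1.2.symm.trans h2.2
      have : Color.red ∈ ({.blue, .purple} : Set Color) := e ▸ (by simp)
      simp at this
    · have e := h1.2.symm.trans h2.2
      have : Color.red ∈ ({.blue, .purple} : Set Color) := e ▸ (by simp)
      simp at this

open Classical in
/-- A simple operation exchanges two of the matchings along an orbit. -/
theorem IsModel.exchange (h : IsModel G C pt edge ρ) {H : Graph α β}
    (hH : H ∈ circuitsWith G C a b) {C' : β → Color}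
    (h1 : ∀ e ∈ E(H), C' e = Equiv.swap a b (C e)) (h2 : ∀ e ∈ E(G) \ E(H), C' e = C e) :
    IsModel G C' pt
      (fun c v => if v ∈ pt ⁻¹' V(H) then edge (Equiv.swap a b c) v else edge c v)
      (exchange ρ a b (pt ⁻¹' V(H))) := by
  set D := pt ⁻¹' V(H) with hD
  have hmem := h.mem_edgeSet_iff hH
  have horb := (h.circuit_edges hH).2
  have hG : ∀ c v, edge c v ∈ E(G) := fun c v => (h.link c v).edge_mem
  have hin : ∀ c, ∀ v ∈ D, (c = a ∨ c = b) → edge c v ∈ E(H) := by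
    rintro c v hv (rfl | rfl)
    · exact ((h.circuit_edges hH).1 v hv).1
    · exact ((h.circuit_edges hH).1 v hv).2
  have hout : ∀ c v, edge c v ∈ E(H) → (c = a ∨ c = b) ∧ v ∈ D := by
    intro c v hv
    obtain ⟨x, hx, e | e⟩ := (hmem _).1 hv
    · obtain ⟨rfl, hvx⟩ := h.eq_of_edge_eq e
      refine ⟨Or.inl rfl, ?_⟩
      rcases hvx with rfl | rfl
      · exact hx
      · exact (involutive_mem_iff (h.matching c).invol horb.2.1 v).1 hx
    · obtain ⟨rfl, hvx⟩ := h.eq_of_edge_eq e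
      refine ⟨Or.inr rfl, ?_⟩
      rcases hvx with rfl | rfl
      · exact hx
      · exact (involutive_mem_iff (h.matching c).invol horb.2.2.1 v).1 hx
  have hswap : ∀ c, (Equiv.swap a b c = a ∨ Equiv.swap a b c = b) ∨
      (Equiv.swap a b c = c ∧ c ≠ a ∧ c ≠ b) := by
    intro c
    by_cases ha : c = a
    · left; right; rw [ha, Equiv.swap_apply_left]
    by_cases hb : c = b
    · left; left; rw [hb, Equiv.swap_apply_right]
    · exact Or.inr ⟨Equiv.swap_apply_of_ne_of_ne ha hb, ha, hb⟩
  have hcolor : ∀ c v, C' (if v ∈ D then edge (Equiv.swap a b c) v else edge c v) = c := by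
    intro c v
    split_ifs with hv
    · rcases hswap c with hc | ⟨hc, ha, hb⟩
      · rw [h1 _ (hin _ v hv hc), h.color, Equiv.swap_apply_self]
      · rw [hc, h2 _ ⟨hG c v, fun he => (hout c v he).1.elim ha hb⟩, h.color]
    · rw [h2 _ ⟨hG c v, fun he => hv (hout c v he).2⟩, h.color]
  refine ⟨h.inj, h.range_eq, fun c v => ?_, hcolor, fun e v hev => ?_, fun c v => ?_⟩
  · by_cases hv : v ∈ D
    · simp only [hv, if_true, exchange_of_mem]; exact h.link _ v
    · simp only [hv, if_false, exchange_of_notMem, not_false_eq_true]; exact h.link _ v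
  · have he := h.eq_edge e v hev
    by_cases hv : v ∈ D
    · have := hcolor (Equiv.swap a b (C e)) v
      simp only [hv, if_true, Equiv.swap_apply_self] at this
      rw [← he] at this
      simp only [hv, if_true]
      rw [this, Equiv.swap_apply_self]
      exact he
    · have := hcolor (C e) v
      simp only [hv, if_false] at this
      rw [← he] at this
      simp only [hv, if_false]
      rw [this]
      exact he
  · by_cases hv : v ∈ D
    · rw [exchange_of_mem hv]; exact h.ne _ v
    · rw [exchange_of_notMem hv]; exact h.ne _ v

end

end KempeParity

namespace KempeParity

/-! ### Colored plane cubic graphs -/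

open Set Function
open scoped Graph

instance : Fintype Color := ⟨{.red, .blue, .purple}, fun x => by cases x <;> decide⟩

theorem ncard_univ_color : (univ : Set Color).ncard = 3 := by
  rw [Set.ncard_univ, Nat.card_eq_fintype_card]; rfl

/-- A vertex with a loop has only two edges and cannot show three colors, so a colored cubic graph
has none. At every vertex there are then three edges with three colors, and the color determines the
edge. -/
theorem exists_model {α β : Type*} {G : Graph α β} (hG : IsCubic G) {C : β → Color}
    (hC : IsColoring G C) :
    ∃ (edge : Color → V(G) → β) (ρ : Color → V(G) → V(G)),
      IsModel G C (Subtype.val : V(G) → α) edge ρ := by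
  have himage : ∀ v ∈ V(G), C '' G.incidenceSet v = univ := fun v hv =>
    eq_univ_of_forall fun c => by
      obtain ⟨e, he, hc⟩ := hC v hv c
      exact ⟨e, he, hc⟩
  have hdeg : ∀ v ∈ V(G), (G.incidenceSet v).ncard = 3 ∧ G.loopSet v = ∅ := by
    intro v hv
    rcases hG v hv with h | h
    · exact h
    · have hfin : (G.incidenceSet v).Finite := Set.finite_of_ncard_ne_zero (by omega)
      have := Set.ncard_image_le (f := C) hfin
      rw [himage v hv, ncard_univ_color] at this
      omega
  have hinj : ∀ v ∈ V(G), InjOn C (G.incidenceSet v) := by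
    intro v hv
    refine Set.injOn_of_ncard_image_eq ?_ (Set.finite_of_ncard_ne_zero (by rw [(hdeg v hv).1]; simp))
    rw [himage v hv, ncard_univ_color, (hdeg v hv).1]
  have hex : ∀ (c : Color) (v : V(G)), ∃ (e : β) (u : V(G)), G.IsLink e v u ∧ C e = c := by
    intro c v
    obtain ⟨e, ⟨y, hy⟩, hc⟩ := hC v v.2 c
    exact ⟨e, ⟨y, hy.right_mem⟩, hy, hc⟩
  choose edge ρ hl hc using hex
  refine ⟨edge, ρ, Subtype.val_injective, Subtype.range_coe, hl, hc, ?_, ?_⟩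
  · intro e v he
    exact hinj v v.2 he (hl (C e) v).inc_left (hc _ _).symm
  · intro c v hv
    have h1 := hl c v
    rw [hv] at h1
    have h2 : edge c v ∈ G.loopSet v := h1
    rw [(hdeg v v.2).2] at h2
    exact h2

open Classical in
/-- Half of the arc of an edge, from the given end to the middle. -/
noncomputable def halfArc (γ : unitInterval → ℂ) (p : ℂ) (t : ℝ) : ℂ :=
  if γ 0 = p then γ (projIcc 0 1 zero_le_one ((projIcc 0 1 zero_le_one t : ℝ) / 2))
  else γ (projIcc 0 1 zero_le_one (1 - (projIcc 0 1 zero_le_one t : ℝ) / 2))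

theorem continuous_halfArc {γ : unitInterval → ℂ} (hγ : Continuous γ) (p : ℂ) :
    Continuous (halfArc γ p) := by
  unfold halfArc
  have h : Continuous (projIcc (0 : ℝ) 1 zero_le_one) := continuous_projIcc
  split_ifs
  · exact hγ.comp (h.comp ((continuous_subtype_val.comp h).div_const 2))
  · exact hγ.comp (h.comp (continuous_const.sub ((continuous_subtype_val.comp h).div_const 2)))

theorem halfArc_zero {γ : unitInterval → ℂ} {p : ℂ} (h : γ 0 = p ∨ γ 1 = p) :
    halfArc γ p 0 = p := by
  unfold halfArc
  split_ifs with h0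
  · simpa using h0
  · simpa using h.resolve_left h0

theorem halfArc_one (γ : unitInterval → ℂ) (p : ℂ) :
    halfArc γ p 1 = γ (projIcc 0 1 zero_le_one (1 / 2)) := by
  unfold halfArc
  split_ifs with h0
  · simp
  · simp; norm_num

theorem halfArc_cases {γ : unitInterval → ℂ} {p : ℂ} (h : γ 0 = p ∨ γ 1 = p) (t : ℝ) :
    halfArc γ p t = p ∨ ∃ s ∈ Ioo (0 : unitInterval) 1, halfArc γ p t = γ s := by
  have ht := (projIcc (0 : ℝ) 1 zero_le_one t).2
  set τ : ℝ := (projIcc (0 : ℝ) 1 zero_le_one t : ℝ) with hτ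
  have hdef : halfArc γ p t = if γ 0 = p then γ (projIcc 0 1 zero_le_one (τ / 2))
    else γ (projIcc 0 1 zero_le_one (1 - τ / 2)) := rfl
  rcases ht.1.eq_or_lt with h0 | h0
  · left
    rw [hdef, ← h0]
    split_ifs with h1
    · simpa using h1
    · simpa using h.resolve_left h1
  · right
    have hI : ∀ x : ℝ, 0 < x → x < 1 → projIcc 0 1 zero_le_one x ∈ Ioo (0 : unitInterval) 1 := by
      intro x hx hx'
      rw [projIcc_of_mem zero_le_one ⟨hx.le, hx'.le⟩]
      exact ⟨Subtype.mk_lt_mk.2 hx, Subtype.mk_lt_mk.2 hx'⟩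
    have h1 := ht.2
    rw [hdef]
    split_ifs with h1
    · exact ⟨_, hI _ (by linarith) (by linarith), rfl⟩
    · exact ⟨_, hI _ (by linarith) (by linarith), rfl⟩

/-- Cutting each arc at parameter 1/2 serves both ends alike. A point of a half arc is either its
starting vertex or an interior point of its edge, so the axioms of the drawing separate half arcs of
different edges at different vertices. -/
theorem IsModel.planeSystem {V α β : Type*} {G : Graph α β} {C : β → Color} {pt : V → α}
    {edge : Color → V → β} {ρ : Color → V → V} (h : IsModel G C pt edge ρ)
    (F : PlaneEmbedding G) :
    PlaneSystem ρ fun c v => halfArc (F.arc (edge c v)) (F.point (pt v)) := by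
  have hE : ∀ c v, edge c v ∈ E(G) := fun c v => (h.link c v).edge_mem
  have hV : ∀ v, pt v ∈ V(G) := fun v => h.range_eq ▸ mem_range_self v
  have hends : ∀ c v, F.arc (edge c v) 0 = F.point (pt v) ∨ F.arc (edge c v) 1 = F.point (pt v) := by
    intro c v
    obtain ⟨x, y, hl, h0, h1⟩ := F.arc_ends _ (hE c v)
    rw [h0, h1]
    rcases (h.link c v).left_eq_or_eq hl with e | e
    · left; rw [e]
    · right; rw [e]
  refine ⟨h.matching, fun c v => continuous_halfArc (F.arc_continuous _ (hE c v)) _, ?_, ?_, ?_⟩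
  · intro c c' v
    rw [halfArc_zero (hends c v), halfArc_zero (hends c' v)]
  · intro c v
    rw [halfArc_one, halfArc_one, h.edge_map]
  · intro c c' v v' hv hcv s t
    have hne : edge c v ≠ edge c' v' := fun e => by
      obtain ⟨h1, h2⟩ := h.eq_of_edge_eq e
      rcases h2 with h2 | h2
      · exact hv h2.symm
      · exact hcv ⟨h1, h2⟩
    rcases halfArc_cases (hends c v) s with e | ⟨x, hx, e⟩ <;>
      rcases halfArc_cases (hends c' v') t with e' | ⟨y, hy, e'⟩ <;> rw [e, e']
    · exact fun hh => hv (h.inj (F.point_injOn (hV v) (hV v') hh))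
    · exact (F.arc_ne_point _ (hE c' v') y hy _ (hV v)).symm
    · exact F.arc_ne_point _ (hE c v) x hx _ (hV v')
    · exact F.arc_disjoint _ (hE c v) _ (hE c' v') hne x hx y hy

theorem IsModel.parity_eq {V α β : Type*} [Finite V] {G : Graph α β} {C C' : β → Color}
    {pt : V → α} {edge : Color → V → β} {ρ : Color → V → V} (h : IsModel G C pt edge ρ)
    (hG : IsPlanar G) (hop : IsSimpleOperation G C C') : parity G C' = parity G C := by
  obtain ⟨F⟩ := hG
  obtain ⟨H, hH, a, b, hab, h1, h2⟩ := hop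
  have hne : a ≠ b := by
    rintro rfl
    have := hH.2
    rw [hab] at this
    simp at this
  have hH' : H ∈ circuitsWith G C a b := ⟨hH.1, hab⟩
  rw [parity, parity, (h.exchange hH' h1 h2).circuitCount_eq, h.circuitCount_eq]
  exact colorCount_exchange (h.planeSystem F) hne (h.circuit_edges hH').2

theorem parity_eq_of_isPlanar {α β : Type*} {G : Graph α β} (hfin : V(G).Finite) (hG : IsCubic G)
    (hP : IsPlanar G) {C C' : β → Color} (hC : IsColoring G C) (hop : IsSimpleOperation G C C') :
    parity G C' = parity G C := by
  have : Finite V(G) := hfin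
  obtain ⟨edge, ρ, h⟩ := exists_model hG hC
  exact h.parity_eq hP hop

end KempeParity

namespace KempeParity

/-! ### The Petersen graph with one edge removed -/

open Set Function
open scoped Graph

section
variable {V α β : Type*} {G : Graph α β} {C : β → Color} {pt : V → α} {edge : Color → V → β}
  {ρ : Color → V → V}

theorem IsModel.isColoring (h : IsModel G C pt edge ρ) : IsColoring G C := by
  intro x hx c
  obtain ⟨v, rfl⟩ := h.exists_pt hx
  exact ⟨edge c v, (h.link c v).inc_left, h.color c v⟩

theorem IsModel.isCubic (h : IsModel G C pt edge ρ) : IsCubic G := by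
  intro x hx
  obtain ⟨v, rfl⟩ := h.exists_pt hx
  refine Or.inl ⟨?_, ?_⟩
  · have : G.incidenceSet (pt v) = (fun c => edge c v) '' univ := by
      ext e
      constructor
      · intro he
        exact ⟨C e, mem_univ _, (h.eq_edge e v he).symm⟩
      · rintro ⟨c, -, rfl⟩
        exact (h.link c v).inc_left
    rw [this, Set.InjOn.ncard_image, ncard_univ_color]
    intro c _ c' _ e
    exact (h.eq_of_edge_eq e).1
  · refine Set.eq_empty_of_forall_notMem fun e he => ?_
    have hl : G.IsLink e (pt v) (pt v) := he
    have h1 := h.eq_edge e v hl.inc_left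
    have h2 := h.link (C e) v
    rw [← h1] at h2
    exact h.ne _ _ (h.inj (h2.right_unique hl))

/-- A certificate for computing orbits: ℓ names the orbit of each point, and the bound `N` on the
length of the connecting walks makes the hypothesis decidable. -/
theorem isOrb_fiber {s t : V → V} {m N : ℕ} (ℓ : V → Fin m) (hs : ∀ x, ℓ (s x) = ℓ x)
    (ht : ∀ x, ℓ (t x) = ℓ x)
    (hc : ∀ x y, ℓ x = ℓ y → ∃ n : Fin N, y = (s ∘ t)^[n] x ∨ y = t ((s ∘ t)^[n] x)) (x : V) :
    IsOrb s t (ℓ ⁻¹' {ℓ x}) := by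
  refine ⟨⟨x, rfl⟩, fun y hy => (hs y).trans hy, fun y hy => (ht y).trans hy, ?_⟩
  rintro T hT ⟨z, hz⟩ h1 h2
  refine hT.antisymm fun y hy => ?_
  have hzx : ℓ z = ℓ x := hT hz
  have hyx : ℓ y = ℓ x := hy
  have hi : ∀ n : ℕ, (s ∘ t)^[n] z ∈ T := by
    intro n
    induction n with
    | zero => exact hz
    | succ n ih => rw [iterate_succ_apply']; exact h1 (h2 ih)
  obtain ⟨n, rfl | rfl⟩ := hc z y (hzx.trans hyx.symm)
  · exact hi n
  · exact h2 (hi n)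

theorem orbCount_eq_of_fibers {s t : V → V} {m N : ℕ} (ℓ : V → Fin m) (hℓ : Surjective ℓ)
    (hs : ∀ x, ℓ (s x) = ℓ x) (ht : ∀ x, ℓ (t x) = ℓ x)
    (hc : ∀ x y, ℓ x = ℓ y → ∃ n : Fin N, y = (s ∘ t)^[n] x ∨ y = t ((s ∘ t)^[n] x)) :
    orbCount s t = m := by
  have : {S | IsOrb s t S} = (fun i : Fin m => ℓ ⁻¹' {i}) '' univ := by
    ext S
    constructor
    · intro hS
      obtain ⟨x, hx⟩ := hS.1
      exact ⟨ℓ x, mem_univ _, (isOrb_fiber ℓ hs ht hc x).eq_of_mem hS (x := x) rfl hx⟩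
    · rintro ⟨i, -, rfl⟩
      obtain ⟨x, rfl⟩ := hℓ i
      exact isOrb_fiber ℓ hs ht hc x
  rw [orbCount, this, Set.InjOn.ncard_image, Set.ncard_univ, Nat.card_eq_fintype_card,
    Fintype.card_fin]
  intro i _ j _ h
  obtain ⟨x, rfl⟩ := hℓ i
  have : x ∈ ℓ ⁻¹' {j} := by
    rw [← show ℓ ⁻¹' {ℓ x} = ℓ ⁻¹' {j} from h]; rfl
  exact this

end

/-- A coloring with five circuits. -/
def petersenColoring : Fin 12 → Color :=
  ![.red, .blue, .red, .blue, .red, .blue, .red, .blue, .purple, .purple, .purple, .purple]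

/-- The result of a simple operation along the outer circuit. -/
def petersenColoring' : Fin 12 → Color :=
  ![.blue, .red, .blue, .red, .red, .blue, .red, .blue, .purple, .purple, .purple, .purple]

/-- The edges at the vertices, by color. -/
def petersenEdge : Color → Fin 8 → Fin 12
  | .red => ![0, 0, 2, 2, 4, 6, 4, 6]
  | .blue => ![3, 1, 1, 3, 7, 5, 5, 7]
  | .purple => ![8, 9, 10, 11, 8, 9, 10, 11]

/-- The neighbors of the vertices, by color. -/
def petersenMatching : Color → Fin 8 → Fin 8
  | .red => ![1, 0, 3, 2, 6, 7, 4, 5]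
  | .blue => ![3, 2, 1, 0, 7, 6, 5, 4]
  | .purple => ![4, 5, 6, 7, 0, 1, 2, 3]

/-- The edges at the vertices after the operation, by color. -/
def petersenEdge' : Color → Fin 8 → Fin 12
  | .red => ![3, 1, 1, 3, 4, 6, 4, 6]
  | .blue => ![0, 0, 2, 2, 7, 5, 5, 7]
  | .purple => ![8, 9, 10, 11, 8, 9, 10, 11]

/-- The neighbors of the vertices after the operation, by color. -/
def petersenMatching' : Color → Fin 8 → Fin 8
  | .red => ![3, 2, 1, 0, 6, 7, 4, 5]
  | .blue => ![1, 0, 3, 2, 7, 6, 5, 4]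
  | .purple => ![4, 5, 6, 7, 0, 1, 2, 3]

theorem isModel_oneDeletedPetersen : IsModel oneDeletedPetersen petersenColoring (id : Fin 8 → Fin 8)
    petersenEdge petersenMatching where
  inj := injective_id
  range_eq := by rw [range_id]; rfl
  link c v := by
    change oneDeletedPetersenEnds _ = _ ∨ oneDeletedPetersenEnds _ = _
    revert c v; decide
  color := by decide
  eq_edge e v := by
    rintro ⟨y, h⟩
    change oneDeletedPetersenEnds _ = _ ∨ oneDeletedPetersenEnds _ = _ at h
    revert e v y; decide
  ne := by decide

theorem isModel_oneDeletedPetersen' : IsModel oneDeletedPetersen petersenColoring'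
    (id : Fin 8 → Fin 8) petersenEdge' petersenMatching' where
  inj := injective_id
  range_eq := by rw [range_id]; rfl
  link c v := by
    change oneDeletedPetersenEnds _ = _ ∨ oneDeletedPetersenEnds _ = _
    revert c v; decide
  color := by decide
  eq_edge e v := by
    rintro ⟨y, h⟩
    change oneDeletedPetersenEnds _ = _ ∨ oneDeletedPetersenEnds _ = _ at h
    revert e v y; decide
  ne := by decide

theorem circuitCount_petersenColoring : circuitCount oneDeletedPetersen petersenColoring = 5 := by
  rw [isModel_oneDeletedPetersen.circuitCount_eq, colorCount,
    orbCount_eq_of_fibers (m := 2) (N := 4) ![0, 0, 0, 0, 1, 1, 1, 1] (by decide) (by decide)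
      (by decide) (by decide),
    orbCount_eq_of_fibers (m := 1) (N := 4) ![0, 0, 0, 0, 0, 0, 0, 0] (by decide) (by decide)
      (by decide) (by decide),
    orbCount_eq_of_fibers (m := 2) (N := 4) ![0, 1, 1, 0, 0, 1, 1, 0] (by decide) (by decide)
      (by decide) (by decide)]

theorem circuitCount_petersenColoring' :
    circuitCount oneDeletedPetersen petersenColoring' = 4 := by
  rw [isModel_oneDeletedPetersen'.circuitCount_eq, colorCount,
    orbCount_eq_of_fibers (m := 2) (N := 4) ![0, 0, 0, 0, 1, 1, 1, 1] (by decide) (by decide)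
      (by decide) (by decide),
    orbCount_eq_of_fibers (m := 1) (N := 4) ![0, 0, 0, 0, 0, 0, 0, 0] (by decide) (by decide)
      (by decide) (by decide),
    orbCount_eq_of_fibers (m := 1) (N := 4) ![0, 0, 0, 0, 0, 0, 0, 0] (by decide) (by decide)
      (by decide) (by decide)]

theorem isSimpleOperation_petersen :
    IsSimpleOperation oneDeletedPetersen petersenColoring petersenColoring' := by
  have h := isModel_oneDeletedPetersen
  have hD : IsOrb (petersenMatching .red) (petersenMatching .blue) (_ ⁻¹' {_}) :=
    isOrb_fiber (m := 2) (N := 4) ![0, 0, 0, 0, 1, 1, 1, 1] (by decide) (by decide) (by decide) 0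
  obtain ⟨H, hH, hHD⟩ := h.exists_circuit (by decide) hD
  have hmem : ∀ x : Fin 8, x ∈ V(H) ↔ (![0, 0, 0, 0, 1, 1, 1, 1] : Fin 8 → Fin 2) x = 0 := fun x => by
    rw [preimage_id] at hHD
    rw [hHD]; rfl
  refine ⟨H, ⟨hH.1, ?_⟩, .red, .blue, hH.2, ?_, ?_⟩
  · rw [hH.2, Set.ncard_pair (by decide)]
  · intro e he
    obtain ⟨x, hx, hex⟩ := (h.mem_edgeSet_iff hH e).1 he
    have hx' := (hmem x).1 hx
    clear he hx
    revert e x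
    decide
  · rintro e ⟨-, he⟩
    have : ¬ ∃ x : Fin 8, (![0, 0, 0, 0, 1, 1, 1, 1] : Fin 8 → Fin 2) x = 0 ∧
        (e = petersenEdge .red x ∨ e = petersenEdge .blue x) := fun ⟨x, hx, hex⟩ =>
      he ((h.mem_edgeSet_iff hH e).2 ⟨x, (hmem x).2 hx, hex⟩)
    clear he
    revert e
    decide

/-- The first statement is its own obstruction: on a planar graph the operation could not change the
count from 5 to 4. -/
theorem not_isPlanar_oneDeletedPetersen : ¬ IsPlanar oneDeletedPetersen := fun hP => by
  have := isModel_oneDeletedPetersen.parity_eq hP isSimpleOperation_petersen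
  rw [parity, parity, circuitCount_petersenColoring, circuitCount_petersenColoring'] at this
  exact absurd this (by decide)

end KempeParity

/-! ### Plane formations as plane cubic graphs: statement 2. -/

namespace KempeParity

/-! ### Arcs and Jordan curves -/

open Set Function

/-- `s` is a simple arc from `p` to `q`. -/
def IsArc (p q : ℂ) (s : Set ℂ) : Prop :=
  ∃ f : ℝ → ℂ, Continuous f ∧ InjOn f (Icc 0 1) ∧ f 0 = p ∧ f 1 = q ∧ f '' Icc 0 1 = s

theorem isArc_image {f : ℝ → ℂ} {x y : ℝ} (hf : Continuous f) (hxy : x < y)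
    (hi : InjOn f (Icc x y)) : IsArc (f x) (f y) (f '' Icc x y) := by
  have hd : 0 < y - x := sub_pos.2 hxy
  have hm : ∀ t ∈ Icc (0 : ℝ) 1, (y - x) * t + x ∈ Icc x y := fun t ht =>
    ⟨by nlinarith [ht.1], by nlinarith [ht.2]⟩
  refine ⟨fun t => f ((y - x) * t + x), by fun_prop, fun s hs t ht hst => ?_, by simp, by simp, ?_⟩
  · have := hi (hm s hs) (hm t ht) hst
    exact mul_left_cancel₀ hd.ne' (by linarith)
  · rw [show (fun t => f ((y - x) * t + x)) = f ∘ fun t => (y - x) * t + x from rfl, image_comp,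
      image_affine_Icc' hd]
    simp

theorem IsArc.symm {p q : ℂ} {s : Set ℂ} (h : IsArc p q s) : IsArc q p s := by
  obtain ⟨f, hf, hi, h0, h1, rfl⟩ := h
  have hm : ∀ t ∈ Icc (0 : ℝ) 1, 1 - t ∈ Icc (0 : ℝ) 1 := fun t ht =>
    ⟨by linarith [ht.2], by linarith [ht.1]⟩
  refine ⟨fun t => f (1 - t), by fun_prop, fun s hs t ht hst => ?_, by simpa, by simpa, ?_⟩
  · linarith [hi (hm s hs) (hm t ht) hst]
  · ext z
    constructor
    · rintro ⟨t, ht, rfl⟩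
      exact ⟨_, hm t ht, rfl⟩
    · rintro ⟨t, ht, rfl⟩
      exact ⟨_, hm t ht, by simp⟩

theorem IsSegment.exists_isArc {s : Set ℂ} (h : IsSegment s) : ∃ p q, IsArc p q s := by
  obtain ⟨f, hf, hi, rfl⟩ := h
  refine ⟨_, _, fun t => f (projIcc 0 1 zero_le_one t), hf.comp continuous_projIcc,
    fun s hs t ht hst => ?_, rfl, rfl, ?_⟩
  · have := hi hst
    rwa [projIcc_of_mem _ hs, projIcc_of_mem _ ht, Subtype.mk.injEq] at this
  · ext z
    constructor
    · rintro ⟨t, ht, rfl⟩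
      exact ⟨_, rfl⟩
    · rintro ⟨t, rfl⟩
      exact ⟨t, t.2, by simp⟩

section
variable {p q r : ℂ} {s t : Set ℂ}

theorem IsArc.isCompact (h : IsArc p q s) : IsCompact s := by
  obtain ⟨f, hf, -, -, -, rfl⟩ := h
  exact isCompact_Icc.image hf

theorem IsArc.isConnected (h : IsArc p q s) : IsConnected s := by
  obtain ⟨f, hf, -, -, -, rfl⟩ := h
  exact (isConnected_Icc zero_le_one).image _ hf.continuousOn

theorem IsArc.left_mem (h : IsArc p q s) : p ∈ s := by
  obtain ⟨f, -, -, rfl, -, rfl⟩ := h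
  exact ⟨0, by simp, rfl⟩

theorem IsArc.right_mem (h : IsArc p q s) : q ∈ s := h.symm.left_mem

theorem IsArc.ne (h : IsArc p q s) : p ≠ q := by
  obtain ⟨f, -, hi, rfl, rfl, -⟩ := h
  exact fun h => zero_ne_one (hi (by simp) (by simp) h)

theorem IsArc.subset_closure (h : IsArc p q s) : s ⊆ closure (s \ {p, q}) := by
  obtain ⟨f, hf, hi, rfl, rfl, rfl⟩ := h
  have h1 : f '' Icc 0 1 ⊆ closure (f '' Ioo 0 1) := by
    rw [← closure_Ioo (zero_ne_one (α := ℝ))]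
    exact image_closure_subset_closure_image hf
  refine h1.trans (closure_mono ?_)
  rintro _ ⟨t, ht, rfl⟩
  refine ⟨⟨t, Ioo_subset_Icc_self ht, rfl⟩, ?_⟩
  rintro (h | h)
  · exact ht.1.ne' (hi (Ioo_subset_Icc_self ht) (by simp) h)
  · exact ht.2.ne (hi (Ioo_subset_Icc_self ht) (by simp) h)

/-- Two parametrizations, run through one after the other. -/
theorem exists_glue {f g : ℝ → ℂ} (hf : Continuous f) (hg : Continuous g) (h : f 1 = g 0) :
    ∃ F : ℝ → ℂ, Continuous F ∧ (∀ t ≤ 1 / 2, F t = f (2 * t)) ∧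
      ∀ t, 1 / 2 ≤ t → F t = g (2 * t - 1) := by
  refine ⟨fun t => if t ≤ 1 / 2 then f (2 * t) else g (2 * t - 1), ?_, fun t ht => if_pos ht,
    fun t ht => ?_⟩
  · refine Continuous.if_le (by fun_prop) (by fun_prop) continuous_id continuous_const ?_
    rintro x rfl
    norm_num [h]
  · rcases ht.lt_or_eq with ht | rfl
    · exact if_neg ht.not_ge
    · norm_num [h]

theorem glue_image {f g F : ℝ → ℂ} (h1 : ∀ t ≤ 1 / 2, F t = f (2 * t))
    (h2 : ∀ t, 1 / 2 ≤ t → F t = g (2 * t - 1)) :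
    F '' Icc 0 1 = f '' Icc 0 1 ∪ g '' Icc 0 1 := by
  ext z
  constructor
  · rintro ⟨t, ht, rfl⟩
    rcases le_total t (1 / 2) with h | h
    · exact .inl ⟨2 * t, ⟨by linarith [ht.1], by linarith⟩, (h1 t h).symm⟩
    · exact .inr ⟨2 * t - 1, ⟨by linarith, by linarith [ht.2]⟩, (h2 t h).symm⟩
  · rintro (⟨t, ht, rfl⟩ | ⟨t, ht, rfl⟩)
    · refine ⟨t / 2, ⟨by linarith [ht.1], by linarith [ht.2]⟩, ?_⟩
      rw [h1 _ (by linarith [ht.2])]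
      congr 1
      ring
    · refine ⟨(t + 1) / 2, ⟨by linarith [ht.1], by linarith [ht.2]⟩, ?_⟩
      rw [h2 _ (by linarith [ht.1])]
      congr 1
      ring

theorem IsArc.concat (hs : IsArc p q s) (ht : IsArc q r t) (h : s ∩ t ⊆ {q}) :
    IsArc p r (s ∪ t) := by
  obtain ⟨f, hf, fi, rfl, fq, rfl⟩ := hs
  obtain ⟨g, hg, gi, gq, rfl, rfl⟩ := ht
  obtain ⟨F, hF, h1, h2⟩ := exists_glue hf hg (fq.trans gq.symm)
  have key : ∀ x ∈ Icc (0 : ℝ) 1, ∀ y ∈ Icc (0 : ℝ) 1, x ≤ 1 / 2 → 1 / 2 ≤ y → F x = F y →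
      x = y := by
    intro x hx y hy hx' hy' hxy
    rw [h1 x hx', h2 y hy'] at hxy
    have mx : 2 * x ∈ Icc (0 : ℝ) 1 := ⟨by linarith [hx.1], by linarith⟩
    have my : 2 * y - 1 ∈ Icc (0 : ℝ) 1 := ⟨by linarith, by linarith [hy.2]⟩
    have hq : f (2 * x) = q := h ⟨⟨_, mx, rfl⟩, ⟨_, my, hxy.symm⟩⟩
    have e1 := fi mx (by simp) (hq.trans fq.symm)
    have e2 := gi my (by simp) ((hxy.symm.trans hq).trans gq.symm)
    linarith
  refine ⟨F, hF, fun x hx y hy hxy => ?_, ?_, ?_, glue_image h1 h2⟩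
  · rcases le_total x (1 / 2) with h | h <;> rcases le_total y (1 / 2) with h' | h'
    · rw [h1 x h, h1 y h'] at hxy
      linarith [fi ⟨by linarith [hx.1], by linarith⟩ ⟨by linarith [hy.1], by linarith⟩ hxy]
    · exact key x hx y hy h h' hxy
    · exact (key y hy x hx h' h hxy.symm).symm
    · rw [h2 x h, h2 y h'] at hxy
      linarith [gi ⟨by linarith, by linarith [hx.2]⟩ ⟨by linarith, by linarith [hy.2]⟩ hxy]
  · rw [h1 0 (by norm_num), mul_zero]
  · rw [h2 1 (by norm_num)]
    norm_num

theorem isJordanCurve_image {F : ℝ → ℂ} (hF : Continuous F) (h : F 0 = F 1)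
    (hi : InjOn F (Ico 0 1)) : IsJordanCurve (F '' Icc 0 1) := by
  let e := AddCircle.homeomorphCircle (one_ne_zero (α := ℝ))
  let g : AddCircle (1 : ℝ) → ℂ := AddCircle.liftIco 1 0 F
  have hg : ∀ x ∈ Ico (0 : ℝ) 1, g x = F x := fun x hx => AddCircle.liftIco_zero_coe_apply hx
  have hs : ∀ z : AddCircle (1 : ℝ), ∃ x ∈ Ico (0 : ℝ) 1, (x : AddCircle (1 : ℝ)) = z := by
    intro z
    have := (AddCircle.equivIco 1 0 z).2
    refine ⟨AddCircle.equivIco 1 0 z, by simpa using this, ?_⟩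
    exact (AddCircle.equivIco 1 0).symm_apply_apply z
  refine ⟨g ∘ e.symm, (AddCircle.liftIco_zero_continuous h hF.continuousOn).comp
    e.symm.continuous, ?_, ?_⟩
  · refine Injective.comp (fun z z' hz => ?_) e.symm.injective
    obtain ⟨x, hx, rfl⟩ := hs z
    obtain ⟨y, hy, rfl⟩ := hs z'
    rw [hg x hx, hg y hy] at hz
    rw [hi hx hy hz]
  · rw [e.symm.surjective.range_comp]
    ext w
    constructor
    · rintro ⟨z, rfl⟩
      obtain ⟨x, hx, rfl⟩ := hs z
      exact ⟨x, Ico_subset_Icc_self hx, (hg x hx).symm⟩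
    · rintro ⟨x, hx, rfl⟩
      rcases hx.2.lt_or_eq with h' | rfl
      · exact ⟨x, hg x ⟨hx.1, h'⟩⟩
      · exact ⟨(0 : ℝ), (hg 0 (by simp)).trans h⟩

theorem IsArc.isJordanCurve_union (hs : IsArc p q s) (ht : IsArc q p t) (h : s ∩ t ⊆ {p, q}) :
    IsJordanCurve (s ∪ t) := by
  obtain ⟨f, hf, fi, rfl, fq, rfl⟩ := hs
  obtain ⟨g, hg, gi, gq, gp, rfl⟩ := ht
  obtain ⟨F, hF, h1, h2⟩ := exists_glue hf hg (fq.trans gq.symm)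
  have key : ∀ x ∈ Ico (0 : ℝ) 1, ∀ y ∈ Ico (0 : ℝ) 1, x ≤ 1 / 2 → 1 / 2 ≤ y → F x = F y →
      x = y := by
    intro x hx y hy hx' hy' hxy
    rw [h1 x hx', h2 y hy'] at hxy
    have mx : 2 * x ∈ Icc (0 : ℝ) 1 := ⟨by linarith [hx.1], by linarith⟩
    have my : 2 * y - 1 ∈ Icc (0 : ℝ) 1 := ⟨by linarith, by linarith [hy.2]⟩
    rcases h ⟨⟨_, mx, rfl⟩, ⟨_, my, hxy.symm⟩⟩ with hq | hq
    · linarith [gi my (by simp) ((hxy.symm.trans hq).trans gp.symm), hy.2]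
    · have e1 := fi mx (by simp) (Eq.trans hq fq.symm)
      have e2 := gi my (by simp) ((hxy.symm.trans hq).trans gq.symm)
      linarith
  rw [← glue_image h1 h2]
  refine isJordanCurve_image hF ?_ fun x hx y hy hxy => ?_
  · rw [h1 0 (by norm_num), mul_zero, h2 1 (by norm_num), ← gp]
    norm_num
  · rcases le_total x (1 / 2) with h | h <;> rcases le_total y (1 / 2) with h' | h'
    · rw [h1 x h, h1 y h'] at hxy
      linarith [fi ⟨by linarith [hx.1], by linarith⟩ ⟨by linarith [hy.1], by linarith⟩ hxy]
    · exact key x hx y hy h h' hxy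
    · exact (key y hy x hx h' h hxy.symm).symm
    · rw [h2 x h, h2 y h'] at hxy
      linarith [gi ⟨by linarith, by linarith [hx.2]⟩ ⟨by linarith, by linarith [hy.2]⟩ hxy]

theorem IsJordanCurve.exists_param {J : Set ℂ} (hJ : IsJordanCurve J) {z : ℂ} (hz : z ∈ J) :
    ∃ F : ℝ → ℂ, Continuous F ∧ F 0 = z ∧ F 1 = z ∧ InjOn F (Ico 0 1) ∧ F '' Icc 0 1 = J := by
  obtain ⟨f, hf, fi, rfl⟩ := hJ
  obtain ⟨u, rfl⟩ := hz
  let e := AddCircle.homeomorphCircle (one_ne_zero (α := ℝ))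
  have e0 : e ((0 : ℝ) : AddCircle (1 : ℝ)) = 1 := by
    rw [AddCircle.homeomorphCircle_apply]
    simp
  have e1 : ((1 : ℝ) : AddCircle (1 : ℝ)) = (0 : ℝ) := by simp
  refine ⟨fun t => f (u * e (t : AddCircle (1 : ℝ))), ?_, ?_, ?_, fun x hx y hy hxy => ?_, ?_⟩
  · have : Continuous fun t : ℝ => (t : AddCircle (1 : ℝ)) := AddCircle.continuous_mk' 1
    exact hf.comp (continuous_const.mul (e.continuous.comp this))
  · simp only [e0, mul_one]
  · simp only [e1, e0, mul_one]
  · have := e.injective (mul_left_cancel (fi hxy))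
    exact (AddCircle.coe_eq_coe_iff_of_mem_Ico (a := 0) (by simpa using hx) (by simpa using hy)).1
      this
  · ext w
    constructor
    · rintro ⟨t, -, rfl⟩
      exact ⟨_, rfl⟩
    · rintro ⟨v, rfl⟩
      have := (AddCircle.equivIco 1 0 (e.symm (u⁻¹ * v))).2
      refine ⟨AddCircle.equivIco 1 0 (e.symm (u⁻¹ * v)),
        Ico_subset_Icc_self (by simpa using this), ?_⟩
      have h2 : (((AddCircle.equivIco 1 0 (e.symm (u⁻¹ * v)) : ℝ)) : AddCircle (1 : ℝ)) =
          e.symm (u⁻¹ * v) := (AddCircle.equivIco 1 0).symm_apply_apply _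
      simp only [h2, e.apply_symm_apply, mul_inv_cancel_left]

theorem IsJordanCurve.isCompact {J : Set ℂ} (hJ : IsJordanCurve J) : IsCompact J := by
  obtain ⟨f, hf, -, rfl⟩ := hJ
  exact isCompact_range hf

theorem IsJordanCurve.nonempty {J : Set ℂ} (hJ : IsJordanCurve J) : J.Nonempty := by
  obtain ⟨f, -, -, rfl⟩ := hJ
  exact ⟨f 1, 1, rfl⟩

theorem IsJordanCurve.isConnected {J : Set ℂ} (hJ : IsJordanCurve J) : IsConnected J := by
  obtain ⟨z, hz⟩ := hJ.nonempty
  obtain ⟨F, hF, -, -, -, rfl⟩ := hJ.exists_param hz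
  exact (isConnected_Icc zero_le_one).image _ hF.continuousOn

/-- A map into an arc lifts to the parameter interval. -/
theorem exists_lift {f g : ℝ → ℂ} {α β : ℝ} (hf : Continuous f) (hi : InjOn f (Icc α β))
    (hg : Continuous g) (h : g '' Icc 0 1 ⊆ f '' Icc α β) :
    ∃ k : ℝ → ℝ, ContinuousOn k (Icc 0 1) ∧ ∀ t ∈ Icc (0 : ℝ) 1, k t ∈ Icc α β ∧ f (k t) = g t := by
  have hemb : Topology.IsClosedEmbedding (fun x : Icc α β => f x) :=
    (hf.comp continuous_subtype_val).isClosedEmbedding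
      fun x y hxy => Subtype.ext (hi x.2 y.2 hxy)
  have hex : ∀ t : Icc (0 : ℝ) 1, ∃ x : Icc α β, f x = g t := fun t => by
    obtain ⟨x, hx, hx'⟩ := h ⟨t, t.2, rfl⟩
    exact ⟨⟨x, hx⟩, hx'⟩
  choose k hk using hex
  have hkc : Continuous k := by
    rw [hemb.isEmbedding.continuous_iff]
    refine (hg.comp continuous_subtype_val).congr fun t => (hk t).symm
  refine ⟨fun t => k (projIcc 0 1 zero_le_one t), (continuous_subtype_val.comp
    (hkc.comp continuous_projIcc)).continuousOn, fun t ht => ⟨(k _).2, ?_⟩⟩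
  simp only [hk, projIcc_of_mem _ ht]

/-- The mean of the values at 0 and 1/2 is attained on both halves of the interval, by the
intermediate value theorem. -/
theorem not_injOn_Ico {G : ℝ → ℝ} (hG : ContinuousOn G (Icc 0 1)) (h : G 0 = G 1) :
    ¬ InjOn G (Ico 0 1) := by
  intro hi
  have hne : G 0 ≠ G (1 / 2) := fun h => by
    have := hi (by norm_num) (by norm_num) h
    norm_num at this
  have m1 : (G 0 + G (1 / 2)) / 2 ∈ uIcc (G 0) (G (1 / 2)) := by
    rcases le_total (G 0) (G (1 / 2)) with h | h
    · rw [uIcc_of_le h]; constructor <;> linarith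
    · rw [uIcc_of_ge h]; constructor <;> linarith
  have m2 : (G 0 + G (1 / 2)) / 2 ∈ uIcc (G (1 / 2)) (G 1) := by rwa [uIcc_comm, ← h]
  have hle : (0 : ℝ) ≤ 1 / 2 := by norm_num
  have hle' : (1 / 2 : ℝ) ≤ 1 := by norm_num
  obtain ⟨x, hx, ex⟩ := intermediate_value_uIcc (by
    rw [uIcc_of_le hle]; exact hG.mono (Icc_subset_Icc_right hle')) m1
  obtain ⟨y, hy, ey⟩ := intermediate_value_uIcc (by
    rw [uIcc_of_le hle']; exact hG.mono (Icc_subset_Icc_left hle)) m2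
  rw [uIcc_of_le hle] at hx
  rw [uIcc_of_le hle'] at hy
  have hy1 : y ≠ 1 := by
    rintro rfl
    exact hne (by linarith)
  have := hi ⟨hx.1, by linarith [hx.2]⟩ ⟨by linarith [hy.1], lt_of_le_of_ne hy.2 hy1⟩
    (ex.trans ey.symm)
  have hx2 : x = 1 / 2 := le_antisymm hx.2 (this ▸ hy.1)
  rw [hx2] at ex
  exact hne (by linarith)

/-- Lifting the parametrization of the curve to the parameter interval of the arc would give a
closed injective path in ℝ. -/
theorem IsJordanCurve.not_subset_image {J : Set ℂ} (hJ : IsJordanCurve J) {f : ℝ → ℂ} {α β : ℝ}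
    (hf : Continuous f) (hi : InjOn f (Icc α β)) : ¬ J ⊆ f '' Icc α β := by
  intro h
  obtain ⟨z, hz⟩ := hJ.nonempty
  obtain ⟨F, hF, F0, F1, Fi, rfl⟩ := hJ.exists_param hz
  obtain ⟨k, hk, hk'⟩ := exists_lift hf hi hF h
  refine not_injOn_Ico hk ?_ fun x hx y hy hxy => Fi hx hy ?_
  · refine hi (hk' 0 (by simp)).1 (hk' 1 (by simp)).1 ?_
    rw [(hk' 0 (by simp)).2, (hk' 1 (by simp)).2, F0, F1]
  · rw [← (hk' x (Ico_subset_Icc_self hx)).2, ← (hk' y (Ico_subset_Icc_self hy)).2, hxy]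

theorem IsJordanCurve.not_subset_isArc {J : Set ℂ} (hJ : IsJordanCurve J) (hs : IsArc p q s) :
    ¬ J ⊆ s := by
  obtain ⟨f, hf, hi, -, -, rfl⟩ := hs
  exact hJ.not_subset_image hf hi

/-- A compact subset of a Jordan curve that misses a point lies in an arc of the curve. -/
theorem exists_Icc_of_subset {F : ℝ → ℂ} (hF : Continuous F) (h : F 0 = F 1) {s : Set ℂ}
    (hs : IsCompact s) (hsub : s ⊆ F '' Icc 0 1) (h0 : F 0 ∉ s) :
    ∃ α β : ℝ, 0 < α ∧ β < 1 ∧ s ⊆ F '' Icc α β := by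
  have hK : IsCompact (Icc (0 : ℝ) 1 ∩ F ⁻¹' s) := isCompact_Icc.inter_right
    (hs.isClosed.preimage hF)
  rcases (Icc (0 : ℝ) 1 ∩ F ⁻¹' s).eq_empty_or_nonempty with he | hne
  · refine ⟨1 / 2, 1 / 2, by norm_num, by norm_num, fun z hz => ?_⟩
    obtain ⟨t, ht, rfl⟩ := hsub hz
    exact absurd (show t ∈ Icc (0 : ℝ) 1 ∩ F ⁻¹' s from ⟨ht, hz⟩) (by simp [he])
  · obtain ⟨α, hα, hα'⟩ := hK.exists_isLeast hne
    obtain ⟨β, hβ, hβ'⟩ := hK.exists_isGreatest hne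
    refine ⟨α, β, lt_of_le_of_ne hα.1.1 ?_, lt_of_le_of_ne hβ.1.2 ?_, fun z hz => ?_⟩
    · rintro rfl
      exact h0 hα.2
    · rintro rfl
      exact h0 (h ▸ hβ.2)
    · obtain ⟨t, ht, rfl⟩ := hsub hz
      exact ⟨t, ⟨hα' ⟨ht, hz⟩, hβ' ⟨ht, hz⟩⟩, rfl⟩

/-- If `J` missed a point of `K`, then by compactness it would lie in an arc of `K`, which contains
no Jordan curve. -/
theorem IsJordanCurve.eq_of_subset {J K : Set ℂ} (hJ : IsJordanCurve J) (hK : IsJordanCurve K)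
    (h : J ⊆ K) : J = K := by
  refine h.antisymm fun z hz => ?_
  by_contra hzJ
  obtain ⟨F, hF, F0, F1, Fi, rfl⟩ := hK.exists_param hz
  obtain ⟨α, β, hα, hβ, hJ'⟩ := exists_Icc_of_subset hF (F0.trans F1.symm) hJ.isCompact h
    (by rwa [F0])
  have hsub : Icc α β ⊆ Ico 0 1 := fun x hx => ⟨hα.le.trans hx.1, hx.2.trans_lt hβ⟩
  exact hJ.not_subset_image hF (Fi.mono hsub) hJ'

/-- An arc inside an arc is given by a parameter interval. -/
theorem IsArc.exists_subinterval {f : ℝ → ℂ} {α β : ℝ} (hf : Continuous f)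
    (hi : InjOn f (Icc α β)) (hs : IsArc p q s) (h : s ⊆ f '' Icc α β) :
    ∃ x y, α ≤ x ∧ x < y ∧ y ≤ β ∧ f '' Icc x y = s ∧ ({f x, f y} : Set ℂ) = {p, q} := by
  obtain ⟨g, hg, gi, rfl, rfl, rfl⟩ := hs
  obtain ⟨k, hk, hk'⟩ := exists_lift hf hi hg h
  have h0 : (0 : ℝ) ∈ Icc (0 : ℝ) 1 := by simp
  have h1 : (1 : ℝ) ∈ Icc (0 : ℝ) 1 := by simp
  have ki : InjOn k (Icc 0 1) := fun x hx y hy hxy => gi hx hy (by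
    rw [← (hk' x hx).2, ← (hk' y hy).2, hxy])
  have him : g '' Icc 0 1 = f '' (k '' Icc 0 1) := by
    rw [image_image]
    exact image_congr fun t ht => ((hk' t ht).2).symm
  rcases hk.strictMonoOn_of_injOn_Icc' zero_le_one ki with hm | hm
  · refine ⟨k 0, k 1, (hk' 0 h0).1.1, hm h0 h1 one_pos, (hk' 1 h1).1.2, ?_, ?_⟩
    · rw [him]
      congr 1
      refine (intermediate_value_Icc zero_le_one hk).antisymm ?_
      rintro _ ⟨t, ht, rfl⟩
      exact ⟨hm.monotoneOn h0 ht ht.1, hm.monotoneOn ht h1 ht.2⟩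
    · rw [(hk' 0 h0).2, (hk' 1 h1).2]
  · refine ⟨k 1, k 0, (hk' 1 h1).1.1, hm h0 h1 one_pos, (hk' 0 h0).1.2, ?_, ?_⟩
    · rw [him]
      congr 1
      refine (intermediate_value_Icc' zero_le_one hk).antisymm ?_
      rintro _ ⟨t, ht, rfl⟩
      exact ⟨hm.antitoneOn ht h1 ht.2, hm.antitoneOn h0 ht ht.1⟩
    · rw [(hk' 0 h0).2, (hk' 1 h1).2, pair_comm]

end

/-! ### Finite families of disjoint connected sets -/

theorem exists_subset_of_isPreconnected {X : Type*} [TopologicalSpace X] {𝓕 : Set (Set X)}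
    (hfin : 𝓕.Finite) (hc : ∀ A ∈ 𝓕, IsClosed A) (hd : 𝓕.PairwiseDisjoint id) {s : Set X}
    (hs : IsConnected s) (h : s ⊆ ⋃₀ 𝓕) : ∃ A ∈ 𝓕, s ⊆ A := by
  obtain ⟨z, hz⟩ := hs.nonempty
  obtain ⟨A, hA, hzA⟩ := h hz
  refine ⟨A, hA, ?_⟩
  have hc' : IsClosed (⋃₀ (𝓕 \ {A})) := by
    rw [sUnion_eq_biUnion]
    exact (hfin.subset sdiff_subset).isClosed_biUnion fun B hB => hc B hB.1
  have hdisj : A ∩ ⋃₀ (𝓕 \ {A}) = ∅ := by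
    rw [← disjoint_iff_inter_eq_empty, disjoint_sUnion_right]
    exact fun B hB => hd hA hB.1 (Ne.symm hB.2)
  refine (isPreconnected_iff_subset_of_disjoint_closed.1 hs.isPreconnected A _ (hc A hA) hc' ?_
    (by simp [hdisj])).resolve_right fun h' => ?_
  · intro w hw
    obtain ⟨B, hB, hwB⟩ := h hw
    by_cases hBA : B = A
    · exact .inl (hBA ▸ hwB)
    · exact .inr ⟨B, ⟨hB, hBA⟩, hwB⟩
  · have : z ∈ A ∩ ⋃₀ (𝓕 \ {A}) := ⟨hzA, h' hz⟩
    simp [hdisj] at this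

/-- The members of such a family are the connected components of its union. This is what lets a
formation be recovered from the sets that its red and its blue curves fill. -/
theorem family_subset_of_sUnion_eq {X : Type*} [TopologicalSpace X] {𝓕 𝓖 : Set (Set X)}
    (hf : 𝓕.Finite) (hg : 𝓖.Finite) (fc : ∀ A ∈ 𝓕, IsClosed A) (gc : ∀ A ∈ 𝓖, IsClosed A)
    (fd : 𝓕.PairwiseDisjoint id) (gd : 𝓖.PairwiseDisjoint id) (fn : ∀ A ∈ 𝓕, IsConnected A)
    (gn : ∀ A ∈ 𝓖, IsConnected A) (h : ⋃₀ 𝓕 = ⋃₀ 𝓖) : 𝓕 ⊆ 𝓖 := by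
  intro A hA
  obtain ⟨B, hB, hAB⟩ := exists_subset_of_isPreconnected hg gc gd (fn A hA)
    (h ▸ subset_sUnion_of_mem hA)
  obtain ⟨A', hA', hBA⟩ := exists_subset_of_isPreconnected hf fc fd (gn B hB)
    (h ▸ subset_sUnion_of_mem hB)
  obtain ⟨z, hz⟩ := (fn A hA).nonempty
  have : A = A' := fd.elim hA hA' (not_disjoint_iff.2 ⟨z, hz, hBA (hAB hz)⟩)
  rw [hAB.antisymm (this ▸ hBA)]
  exact hB

theorem family_eq_of_sUnion_eq {X : Type*} [TopologicalSpace X] {𝓕 𝓖 : Set (Set X)}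
    (hf : 𝓕.Finite) (hg : 𝓖.Finite) (fc : ∀ A ∈ 𝓕, IsClosed A) (gc : ∀ A ∈ 𝓖, IsClosed A)
    (fd : 𝓕.PairwiseDisjoint id) (gd : 𝓖.PairwiseDisjoint id) (fn : ∀ A ∈ 𝓕, IsConnected A)
    (gn : ∀ A ∈ 𝓖, IsConnected A) (h : ⋃₀ 𝓕 = ⋃₀ 𝓖) : 𝓕 = 𝓖 :=
  (family_subset_of_sUnion_eq hf hg fc gc fd gd fn gn h).antisymm
    (family_subset_of_sUnion_eq hg hf gc fc gd fd gn fn h.symm)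

end KempeParity

namespace KempeParity

/-! ### Cubic graphs whose edges are arcs in the plane -/

open Set Function

/-- The vertices `pt v` and the edges `S c v` (the edge of color `c` at `v`) form a plane drawing of
the cubic graph given by the three matchings `ρ c`. -/
structure IsNet {V : Type*} (ρ : Color → V → V) (pt : V → ℂ) (S : Color → V → Set ℂ) : Prop where
  matching : ∀ c, IsMatching (ρ c)
  inj : Injective pt
  arc : ∀ c v, IsArc (pt v) (pt (ρ c v)) (S c v)
  symm : ∀ c v, S c (ρ c v) = S c v
  inter : ∀ c c' v v', ¬ (c = c' ∧ (v' = v ∨ v' = ρ c v)) → S c v ∩ S c' v' ⊆ range pt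
  mem : ∀ c u v, pt u ∈ S c v → u = v ∨ u = ρ c v

/-- The union of the edges of color `c` at the vertices of `P`. -/
def cells {V : Type*} (S : Color → V → Set ℂ) (c : Color) (P : Set V) : Set ℂ := ⋃ v ∈ P, S c v

section
variable {V : Type*} {ρ : Color → V → V} {pt : V → ℂ} {S : Color → V → Set ℂ} {a b c : Color}

theorem mem_cells {P : Set V} {z : ℂ} : z ∈ cells S c P ↔ ∃ v ∈ P, z ∈ S c v := by
  simp [cells]

theorem IsNet.exists_eq_pt (hN : IsNet ρ pt S) {c c' : Color} {v v' : V}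
    (h : ¬ (c = c' ∧ (v' = v ∨ v' = ρ c v))) {z : ℂ} (hz : z ∈ S c v) (hz' : z ∈ S c' v') :
    ∃ u, pt u = z ∧ (u = v ∨ u = ρ c v) ∧ (u = v' ∨ u = ρ c' v') := by
  obtain ⟨u, rfl⟩ := hN.inter c c' v v' h ⟨hz, hz'⟩
  exact ⟨u, rfl, hN.mem c u v hz, hN.mem c' u v' hz'⟩

theorem IsNet.subset_closure (hN : IsNet ρ pt S) (c : Color) (v : V) :
    S c v ⊆ closure (S c v \ range pt) := by
  refine (hN.arc c v).subset_closure.trans (closure_mono ?_)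
  rintro z ⟨hz, hz'⟩
  refine ⟨hz, ?_⟩
  rintro ⟨u, rfl⟩
  rcases hN.mem c u v hz with rfl | rfl
  · exact hz' (.inl rfl)
  · exact hz' (.inr rfl)

theorem IsNet.sdiff_nonempty (hN : IsNet ρ pt S) (c : Color) (v : V) :
    (S c v \ range pt).Nonempty :=
  closure_nonempty_iff.1 ⟨_, hN.subset_closure c v (hN.arc c v).left_mem⟩

theorem IsNet.exists_half (hN : IsNet ρ pt S) (c : Color) (v : V) {m : ℂ}
    (hm : m ∈ S c v \ range pt) : ∃ γ : ℝ → ℂ, Continuous γ ∧ γ 0 = pt v ∧ γ 1 = m ∧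
      ∀ t, γ t ∈ S c v ∧ γ t ≠ pt (ρ c v) := by
  obtain ⟨f, hf, fi, f0, f1, hS⟩ := hN.arc c v
  obtain ⟨⟨x, hx, rfl⟩, hne⟩ : m ∈ f '' Icc 0 1 \ range pt := hS ▸ hm
  have hx1 : x < 1 := lt_of_le_of_ne hx.2 fun h => hne ⟨ρ c v, by rw [h, f1]⟩
  have key : ∀ t : ℝ, x * projIcc (0 : ℝ) 1 zero_le_one t ∈ Ico (0 : ℝ) 1 := fun t => by
    have := (projIcc (0 : ℝ) 1 zero_le_one t).2
    exact ⟨mul_nonneg hx.1 this.1, by nlinarith [this.1, this.2, hx.1]⟩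
  refine ⟨fun t => f (x * projIcc (0 : ℝ) 1 zero_le_one t),
    hf.comp (continuous_const.mul (continuous_subtype_val.comp continuous_projIcc)),
    by simp [f0], by simp, fun t => ⟨hS ▸ ⟨_, Ico_subset_Icc_self (key t), rfl⟩, fun h => ?_⟩⟩
  exact (key t).2.ne (fi (Ico_subset_Icc_self (key t)) (by simp) (h.trans f1.symm))

theorem IsNet.exists_planeSystem (hN : IsNet ρ pt S) : ∃ half, PlaneSystem ρ half := by
  classical
  -- The middle of an edge is chosen from its point set alone, so that both ends of the edge select
  -- the same point.
  let m : Set ℂ → ℂ := fun X => if h : (X \ range pt).Nonempty then h.some else 0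
  have hm : ∀ c v, m (S c v) ∈ S c v \ range pt := fun c v => by
    simp only [m, dif_pos (hN.sdiff_nonempty c v)]
    exact (hN.sdiff_nonempty c v).some_mem
  choose half h1 h2 h3 h4 using fun c v => hN.exists_half c v (hm c v)
  refine ⟨half, hN.matching, h1, fun c c' v => (h2 c v).trans (h2 c' v).symm, fun c v => ?_,
    fun c c' v v' hne hcc s t hst => ?_⟩
  · rw [h3, h3, hN.symm]
  · obtain ⟨u, hu, hv, hv'⟩ := hN.exists_eq_pt (c := c) (c' := c') (v := v) (v' := v')
      (fun ⟨hc, h⟩ => h.elim (fun h => hne h.symm) fun h => hcc ⟨hc, h⟩) (h4 c v s).1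
      (hst ▸ (h4 c' v' t).1)
    have e : u = v := hv.resolve_right fun h => (h4 c v s).2 (by rw [← hu, h])
    have e' : u = v' := hv'.resolve_right fun h => (h4 c' v' t).2 (by rw [← hst, ← hu, h])
    exact hne (e.symm.trans e')

theorem IsNet.isCompact_cells [Finite V] (hN : IsNet ρ pt S) (c : Color) (P : Set V) :
    IsCompact (cells S c P) :=
  (toFinite P).isCompact_biUnion fun v _ => (hN.arc c v).isCompact

theorem IsNet.cells_subset_closure (hN : IsNet ρ pt S) (c : Color) (P : Set V) :
    cells S c P ⊆ closure (cells S c P \ range pt) := by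
  intro z hz
  obtain ⟨v, hv, hz⟩ := mem_cells.1 hz
  exact closure_mono (sdiff_subset_sdiff_left (subset_biUnion_of_mem (u := S c) hv))
    (hN.subset_closure c v hz)

theorem IsNet.cells_inter (hN : IsNet ρ pt S) {c c' : Color} {P P' : Set V}
    (h : c = c' → Disjoint P P' ∧ MapsTo (ρ c) P P) : cells S c P ∩ cells S c' P' ⊆ range pt := by
  rintro z ⟨hz, hz'⟩
  obtain ⟨v, hv, hz⟩ := mem_cells.1 hz
  obtain ⟨v', hv', hz'⟩ := mem_cells.1 hz'
  refine hN.inter c c' v v' ?_ ⟨hz, hz'⟩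
  rintro ⟨hc, rfl | rfl⟩
  · exact disjoint_left.1 (h hc).1 hv hv'
  · exact disjoint_left.1 (h hc).1 ((h hc).2 hv) hv'

/-! ### The circuits of a net -/

/-- The union of the edges of colors `a` and `b` at the vertices of `O`. -/
def circuit (S : Color → V → Set ℂ) (a b : Color) (O : Set V) : Set ℂ :=
  cells S a O ∪ cells S b O

theorem mem_circuit {O : Set V} {z : ℂ} :
    z ∈ circuit S a b O ↔ ∃ c, (c = a ∨ c = b) ∧ ∃ v ∈ O, z ∈ S c v := by
  simp only [circuit, mem_union, mem_cells]
  constructor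
  · rintro (h | h)
    exacts [⟨a, .inl rfl, h⟩, ⟨b, .inr rfl, h⟩]
  · rintro ⟨c, rfl | rfl, h⟩
    exacts [.inl h, .inr h]

theorem circuit_comm (S : Color → V → Set ℂ) (a b : Color) (O : Set V) :
    circuit S a b O = circuit S b a O := union_comm _ _

theorem IsNet.circuit_disjoint (hN : IsNet ρ pt S) {O O' : Set V} (hO : IsOrb (ρ a) (ρ b) O)
    (hO' : IsOrb (ρ a) (ρ b) O') (hne : O ≠ O') :
    Disjoint (circuit S a b O) (circuit S a b O') := by
  have hm : ∀ {O}, IsOrb (ρ a) (ρ b) O → ∀ c, (c = a ∨ c = b) → MapsTo (ρ c) O O := by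
    rintro O hO c (rfl | rfl)
    exacts [hO.2.1, hO.2.2.1]
  have hd := disjoint_left.1 (hO.disjoint hO' hne)
  refine disjoint_left.2 fun z hz hz' => ?_
  obtain ⟨c, hc, v, hv, hz⟩ := mem_circuit.1 hz
  obtain ⟨c', hc', v', hv', hz'⟩ := mem_circuit.1 hz'
  obtain ⟨u, -, hu, hu'⟩ := hN.exists_eq_pt (c := c) (c' := c') (v := v) (v' := v') (by
    rintro ⟨-, rfl | rfl⟩
    exacts [hd hv hv', hd (hm hO c hc hv) hv']) hz hz'
  have h1 : u ∈ O := by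
    rcases hu with rfl | rfl
    exacts [hv, hm hO c hc hv]
  have h2 : u ∈ O' := by
    rcases hu' with rfl | rfl
    exacts [hv', hm hO' c' hc' hv']
  exact hd h1 h2

/-- Along an enumeration of the orbit all edges but the last concatenate to an arc, and the last
edge closes it. Edges at different places meet only in common ends. -/
theorem IsNet.isJordanCurve_circuit [Finite V] (hN : IsNet ρ pt S) (hab : a ≠ b) {O : Set V}
    (hO : IsOrb (ρ a) (ρ b) O) : IsJordanCurve (circuit S a b O) := by
  obtain ⟨w, n, he⟩ := exists_enumeration (hN.matching a) (hN.matching b) hO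
  let E : ℕ → Set ℂ := fun j => S (stepColor a b j) (w j)
  have hE : ∀ j, IsArc (pt (w j)) (pt (w (j + 1))) (E j) := fun j => by
    rw [he.step j]
    exact hN.arc _ _
  have hE' : ∀ j, E j = S (stepColor a b j) (w (j + 1)) := fun j => by
    rw [he.step j, hN.symm]
  have hcol : ∀ j, stepColor a b (j + 1) ≠ stepColor a b j := fun j => by
    rcases Nat.even_or_odd j with h | h
    · simp [stepColor, h, Nat.even_add_one, hab.symm]
    · simp [stepColor, Nat.even_add_one, Nat.not_even_iff_odd.2 h, hab]
  have hint : ∀ i j, i < j → j < n → E i ∩ E j ⊆ {pt (w j), pt (w (j + 1))} ∩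
      {pt (w i), pt (w (i + 1))} := by
    rintro i j hij hj z ⟨hz, hz'⟩
    obtain ⟨u, rfl, hu, hu'⟩ := hN.exists_eq_pt (c := stepColor a b i) (c' := stepColor a b j)
      (v := w i) (v' := w j) (by
        rintro ⟨hc, h | h⟩
        · exact hij.ne' (he.injOn hj (hij.trans hj) h)
        · rw [← he.step i] at h
          obtain rfl : j = i + 1 := he.injOn hj (mem_Iio.2 (by omega)) h
          exact hcol i hc.symm) hz hz'
    rw [← he.step] at hu hu'
    constructor
    · rcases hu' with rfl | rfl <;> simp
    · rcases hu with rfl | rfl <;> simp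
  have hsucc : ∀ j, (⋃ i ∈ Iio (j + 1), E i) = (⋃ i ∈ Iio j, E i) ∪ E j := fun j => by
    have : Iio (j + 1) = insert j (Iio j) := by
      ext i
      simp only [mem_Iio, mem_insert_iff]
      omega
    rw [this, biUnion_insert, union_comm]
  have hchain : ∀ j, 0 < j → j < n → IsArc (pt (w 0)) (pt (w j)) (⋃ i ∈ Iio j, E i) := by
    intro j hj hjn
    induction j, hj using Nat.le_induction with
    | base => simpa using hE 0
    | succ j hj ih =>
      rw [hsucc]
      refine (ih (by omega)).concat (hE j) ?_
      rintro z ⟨hz, hz'⟩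
      simp only [mem_Iio, mem_iUnion] at hz
      obtain ⟨i, hi, hz⟩ := hz
      obtain ⟨h2, h3⟩ := hint i j hi (by omega) ⟨hz, hz'⟩
      rcases h2 with h2 | h2
      · exact h2
      · exfalso
        rw [mem_singleton_iff] at h2
        subst h2
        have hi' : i < j := hi
        rcases h3 with h3 | h3
        · have := he.injOn hjn (show i < n by omega) (hN.inj h3)
          omega
        · have := he.injOn hjn (show i + 1 < n by omega) (hN.inj h3)
          omega
  obtain ⟨m, rfl⟩ : ∃ m, n = m + 2 := by
    obtain ⟨k, hk⟩ := he.even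
    have := he.pos
    exact ⟨n - 2, by omega⟩
  have hlast := hE (m + 1)
  rw [show m + 1 + 1 = m + 2 from rfl, he.closed] at hlast
  have hJ := (hchain (m + 1) (by omega) (by omega)).isJordanCurve_union hlast (by
    rintro z ⟨hz, hz'⟩
    simp only [mem_Iio, mem_iUnion] at hz
    obtain ⟨i, hi, hz⟩ := hz
    have := (hint i (m + 1) hi (by omega) ⟨hz, hz'⟩).1
    rwa [show m + 1 + 1 = m + 2 from rfl, he.closed, pair_comm] at this)
  convert hJ using 1
  rw [← hsucc]
  ext z
  rw [mem_circuit]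
  simp only [mem_Iio, mem_iUnion]
  constructor
  · rintro ⟨c, hc, v, hv, hz⟩
    rw [← he.image_eq] at hv
    obtain ⟨i, hi, rfl⟩ := hv
    by_cases hci : stepColor a b i = c
    · exact ⟨i, hi, by simpa only [E, hci] using hz⟩
    · rcases Nat.eq_zero_or_pos i with rfl | hpos
      · refine ⟨m + 1, Nat.lt_succ_self _, ?_⟩
        have hodd : ¬ Even (m + 1) := by simpa [Nat.even_add_one] using he.even
        have hcb : stepColor a b (m + 1) = c := by
          simp only [stepColor, hodd, if_false, Even.zero, if_true] at hci ⊢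
          exact (hc.resolve_left (Ne.symm hci)).symm
        rw [hE', hcb, show m + 1 + 1 = m + 2 from rfl, he.closed]
        exact hz
      · obtain ⟨j, rfl⟩ : ∃ j, i = j + 1 := ⟨i - 1, by omega⟩
        refine ⟨j, (Nat.lt_succ_self j).trans hi, ?_⟩
        have hcj : stepColor a b j = c := by
          have := hcol j
          unfold stepColor at this hci ⊢
          split_ifs at * <;> tauto
        rw [hE', hcj]
        exact hz
  · rintro ⟨i, hi, hz⟩
    refine ⟨stepColor a b i, ?_, w i, he.image_eq ▸ ⟨i, hi, rfl⟩, hz⟩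
    unfold stepColor
    split_ifs <;> simp

/-! ### Exchanging two colors along a circuit -/

open Classical in
/-- Exchange the colors `a` and `b` of the edges at the vertices of `O`. -/
noncomputable def exchangeCells (S : Color → V → Set ℂ) (a b : Color) (O : Set V) :
    Color → V → Set ℂ :=
  fun c v => if v ∈ O then S (Equiv.swap a b c) v else S c v

theorem exchangeCells_of_mem {O : Set V} {v : V} (h : v ∈ O) :
    exchangeCells S a b O c v = S (Equiv.swap a b c) v := if_pos h

theorem exchangeCells_of_notMem {O : Set V} {v : V} (h : v ∉ O) :
    exchangeCells S a b O c v = S c v := if_neg h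

theorem IsNet.exchange (hN : IsNet ρ pt S) {O : Set V} (ha : MapsTo (ρ a) O O)
    (hb : MapsTo (ρ b) O O) : IsNet (exchange ρ a b O) pt (exchangeCells S a b O) := by
  classical
  let τ : V → Color → Color := fun v c => if v ∈ O then Equiv.swap a b c else c
  have hτ : ∀ v c, τ v (τ v c) = c := fun v c => by
    by_cases h : v ∈ O <;> simp [τ, h]
  have hρ : ∀ c v, KempeParity.exchange ρ a b O c v = ρ (τ v c) v := fun c v => by
    by_cases h : v ∈ O <;> simp [τ, h, KempeParity.exchange]
  have hS : ∀ c v, exchangeCells S a b O c v = S (τ v c) v := fun c v => by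
    by_cases h : v ∈ O <;> simp [τ, h, exchangeCells]
  -- The relabelling at the two ends of an edge is the same: edges of colors `a` and `b` do not
  -- leave `O`, and other colors are fixed. Thus the new matchings use each old edge under one new
  -- color.
  have key : ∀ k v, τ (ρ k v) k = τ v k := by
    intro k v
    by_cases hk : k = a ∨ k = b
    · have : ρ k v ∈ O ↔ v ∈ O := by
        rcases hk with rfl | rfl
        exacts [involutive_mem_iff (hN.matching _).invol ha v,
          involutive_mem_iff (hN.matching _).invol hb v]
      simp only [τ, this]
    · push Not at hk
      simp only [τ, Equiv.swap_apply_of_ne_of_ne hk.1 hk.2, ite_self]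
  have key' : ∀ c v, τ (ρ (τ v c) v) c = τ v c := fun c v => by
    have := congrArg (τ (ρ (τ v c) v)) (key (τ v c) v)
    rwa [hτ, hτ, eq_comm] at this
  refine ⟨fun c => ⟨fun v => ?_, fun v => ?_⟩, hN.inj, fun c v => ?_, fun c v => ?_,
    fun c c' v v' h => ?_, fun c u v h => ?_⟩
  · rw [hρ c v, hρ, key', (hN.matching _).invol]
  · rw [hρ]
    exact (hN.matching _).ne v
  · rw [hρ, hS]
    exact hN.arc _ v
  · rw [hρ, hS, hS, key', hN.symm]
  · rw [hS, hS]
    refine hN.inter _ _ v v' ?_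
    rintro ⟨hk, hv⟩
    rw [hρ] at h
    refine h ⟨?_, hv⟩
    rcases hv with rfl | rfl
    · rw [← hτ v' c, hk, hτ]
    · rw [← hτ (ρ (τ v c) v) c', ← hk, key, hτ]
  · rw [hS] at h
    rw [hρ]
    exact hN.mem _ u v h

theorem cells_exchangeCells_right (O : Set V) :
    cells (exchangeCells S a b O) b univ = cells S a O ∪ cells S b Oᶜ := by
  ext z
  simp only [mem_cells, mem_union, mem_univ, true_and]
  constructor
  · rintro ⟨v, hz⟩
    by_cases hv : v ∈ O
    · rw [exchangeCells_of_mem hv, Equiv.swap_apply_right] at hz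
      exact .inl ⟨v, hv, hz⟩
    · rw [exchangeCells_of_notMem hv] at hz
      exact .inr ⟨v, hv, hz⟩
  · rintro (⟨v, hv, hz⟩ | ⟨v, hv, hz⟩)
    · exact ⟨v, by rwa [exchangeCells_of_mem hv, Equiv.swap_apply_right]⟩
    · exact ⟨v, by rwa [exchangeCells_of_notMem hv]⟩

theorem exchangeCells_comm (S : Color → V → Set ℂ) (a b : Color) (O : Set V) :
    exchangeCells S a b O = exchangeCells S b a O := by
  unfold exchangeCells
  rw [Equiv.swap_comm]

theorem cells_exchangeCells_left (O : Set V) :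
    cells (exchangeCells S a b O) a univ = cells S b O ∪ cells S a Oᶜ := by
  rw [exchangeCells_comm, cells_exchangeCells_right]

theorem cells_exchangeCells_of_ne (hac : a ≠ c) (hbc : b ≠ c) (O : Set V) :
    cells (exchangeCells S a b O) c univ = cells S c univ := by
  have : ∀ v, exchangeCells S a b O c v = S c v := fun v => by
    unfold exchangeCells
    rw [Equiv.swap_apply_of_ne_of_ne hac.symm hbc.symm, ite_self]
  simp only [cells, this]

theorem cells_union_compl (S : Color → V → Set ℂ) (c : Color) (O : Set V) :
    cells S c univ = cells S c O ∪ cells S c Oᶜ := by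
  unfold cells
  rw [← biUnion_union, union_compl_self]

end

end KempeParity

namespace KempeParity

/-! ### Counting the curves of a formation -/

open Set Function

/-- `P` is the common part that cancels. The symmetric difference can go wrong only on `W`, the
vertices in the applications, and the closure restores these because `A` and `B` accumulate there
from outside `W`. -/
theorem closure_symmDiff_union {X : Type*} [TopologicalSpace X] {P A B W : Set X}
    (hA : IsClosed A) (hB : IsClosed B) (hPA : P ∩ A ⊆ W) (hPB : P ∩ B ⊆ W) (hAB : A ∩ B ⊆ W)
    (hAW : A ⊆ closure (A \ W)) (hBW : B ⊆ closure (B \ W)) :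
    closure (symmDiff (P ∪ A) (P ∪ B)) = A ∪ B := by
  refine (closure_minimal ?_ (hA.union hB)).antisymm (union_subset ?_ ?_)
  · rintro z (⟨h | h, h'⟩ | ⟨h | h, h'⟩)
    · exact absurd (.inl h) h'
    · exact .inl h
    · exact absurd (.inl h) h'
    · exact .inr h
  · refine hAW.trans (closure_mono fun z hz => .inl ⟨.inr hz.1, ?_⟩)
    rintro (h | h)
    exacts [hz.2 (hPA ⟨h, hz.1⟩), hz.2 (hAB ⟨hz.1, h⟩)]
  · refine hBW.trans (closure_mono fun z hz => .inr ⟨.inr hz.1, ?_⟩)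
    rintro (h | h)
    exacts [hz.2 (hPB ⟨h, hz.1⟩), hz.2 (hAB ⟨h, hz.1⟩)]

/-- A net together with Jordan curves `free c` that are disjoint from it and from one another. -/
structure IsCurveNet {V : Type*} (ρ : Color → V → V) (pt : V → ℂ) (S : Color → V → Set ℂ)
    (free : Color → Set (Set ℂ)) : Prop extends IsNet ρ pt S where
  free_finite : ∀ c, (free c).Finite
  free_jordan : ∀ c, ∀ A ∈ free c, IsJordanCurve A
  free_disjoint : ∀ c c', ∀ A ∈ free c, ∀ A' ∈ free c', (c = c' → A ≠ A') → Disjoint A A'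
  free_cell : ∀ c, ∀ A ∈ free c, ∀ c' v, Disjoint A (S c' v)

/-- All points of color `c`. -/
def fullCells {V : Type*} (S : Color → V → Set ℂ) (free : Color → Set (Set ℂ)) (c : Color) :
    Set ℂ :=
  ⋃₀ free c ∪ cells S c univ

/-- The curves of colors `a` and `b`. -/
def curves {V : Type*} (ρ : Color → V → V) (S : Color → V → Set ℂ) (free : Color → Set (Set ℂ))
    (a b : Color) : Set (Set ℂ) :=
  free a ∪ free b ∪ circuit S a b '' {O | IsOrb (ρ a) (ρ b) O}

section
variable {V : Type*} {ρ : Color → V → V} {pt : V → ℂ} {S : Color → V → Set ℂ}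
  {free : Color → Set (Set ℂ)} {a b c : Color}

theorem IsCurveNet.free_circuit (hN : IsCurveNet ρ pt S free) {A : Set ℂ} (hA : A ∈ free c)
    (O : Set V) : Disjoint A (circuit S a b O) := by
  refine disjoint_left.2 fun z hz hz' => ?_
  obtain ⟨c', -, v, -, hz'⟩ := mem_circuit.1 hz'
  exact disjoint_left.1 (hN.free_cell c A hA c' v) hz hz'

theorem IsCurveNet.isJordanCurve_of_mem [Finite V] (hN : IsCurveNet ρ pt S free) (hab : a ≠ b)
    {A : Set ℂ} (hA : A ∈ curves ρ S free a b) : IsJordanCurve A := by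
  rcases hA with (hA | hA) | ⟨O, hO, rfl⟩
  · exact hN.free_jordan a A hA
  · exact hN.free_jordan b A hA
  · exact hN.isJordanCurve_circuit hab hO

theorem IsCurveNet.finite_curves [Finite V] (hN : IsCurveNet ρ pt S free) :
    (curves ρ S free a b).Finite :=
  ((hN.free_finite a).union (hN.free_finite b)).union ((toFinite _).image _)

theorem IsCurveNet.pairwiseDisjoint_curves (hN : IsCurveNet ρ pt S free) (hab : a ≠ b) :
    (curves ρ S free a b).PairwiseDisjoint id := by
  rintro A ((hA | hA) | ⟨O, hO, rfl⟩) B ((hB | hB) | ⟨O', hO', rfl⟩) hne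
  · exact hN.free_disjoint _ _ A hA B hB fun _ => hne
  · exact hN.free_disjoint _ _ A hA B hB fun h => absurd h hab
  · exact hN.free_circuit hA O'
  · exact hN.free_disjoint _ _ A hA B hB fun h => absurd h hab.symm
  · exact hN.free_disjoint _ _ A hA B hB fun _ => hne
  · exact hN.free_circuit hA O'
  · exact (hN.free_circuit hB O).symm
  · exact (hN.free_circuit hB O).symm
  · exact hN.circuit_disjoint hO hO' fun h => hne (by rw [h])

theorem IsCurveNet.sUnion_curves (hN : IsCurveNet ρ pt S free) :
    ⋃₀ curves ρ S free a b = fullCells S free a ∪ fullCells S free b := by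
  ext z
  simp only [curves, sUnion_union, sUnion_image, fullCells, mem_union, mem_iUnion, mem_cells,
    mem_circuit, mem_univ, true_and]
  constructor
  · rintro ((h | h) | ⟨O, hO, c, rfl | rfl, v, -, hz⟩)
    exacts [.inl (.inl h), .inr (.inl h), .inl (.inr ⟨v, hz⟩), .inr (.inr ⟨v, hz⟩)]
  · have key : ∀ v, ∃ O, ∃ _ : O ∈ {O | IsOrb (ρ a) (ρ b) O}, v ∈ O := fun v =>
      ⟨_, isOrb_orb (hN.matching a).invol (hN.matching b).invol v, mem_orb_self v⟩
    rintro ((h | ⟨v, hz⟩) | (h | ⟨v, hz⟩))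
    · exact .inl (.inl h)
    · obtain ⟨O, hO, hv⟩ := key v
      exact .inr ⟨O, hO, a, .inl rfl, v, hv, hz⟩
    · exact .inl (.inr h)
    · obtain ⟨O, hO, hv⟩ := key v
      exact .inr ⟨O, hO, b, .inr rfl, v, hv, hz⟩

theorem IsCurveNet.injOn_circuit [Finite V] (hN : IsCurveNet ρ pt S free) (hab : a ≠ b) :
    InjOn (circuit S a b) {O | IsOrb (ρ a) (ρ b) O} := by
  intro O hO O' hO' h
  by_contra hne
  have := hN.circuit_disjoint hO hO' hne
  rw [h, disjoint_self] at this
  exact (hN.isJordanCurve_circuit hab hO').nonempty.ne_empty this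

theorem IsCurveNet.ncard_circuits [Finite V] (hN : IsCurveNet ρ pt S free) (hab : a ≠ b) :
    (circuit S a b '' {O | IsOrb (ρ a) (ρ b) O}).ncard = orbCount (ρ a) (ρ b) :=
  (hN.injOn_circuit hab).ncard_image

theorem IsCurveNet.ncard_curves [Finite V] (hN : IsCurveNet ρ pt S free) (hab : a ≠ b) :
    (curves ρ S free a b).ncard =
      (free a).ncard + (free b).ncard + orbCount (ρ a) (ρ b) := by
  have hself : ∀ c, ∀ A ∈ free c, ∀ B, Disjoint A B → A ≠ B := by
    rintro c A hA _ h rfl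
    exact (hN.free_jordan c A hA).nonempty.ne_empty (disjoint_self.1 h)
  have h1 : Disjoint (free a) (free b) := disjoint_left.2 fun A hA hB =>
    hself a A hA A (hN.free_disjoint _ _ A hA A hB fun h => absurd h hab) rfl
  have h2 : Disjoint (free a ∪ free b) (circuit S a b '' {O | IsOrb (ρ a) (ρ b) O}) := by
    refine disjoint_left.2 ?_
    rintro A (hA | hA) ⟨O, hO, rfl⟩
    · exact hself a _ hA _ (hN.free_circuit hA O) rfl
    · exact hself b _ hA _ (hN.free_circuit hA O) rfl
  unfold curves
  rw [ncard_union_eq h2 ((hN.free_finite a).union (hN.free_finite b)) ((toFinite _).image _),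
    ncard_union_eq h1 (hN.free_finite a) (hN.free_finite b), hN.ncard_circuits hab]

theorem IsCurveNet.eq_curves [Finite V] (hN : IsCurveNet ρ pt S free) (hab : a ≠ b)
    {𝓕 : Set (Set ℂ)} (hf : 𝓕.Finite) (hJ : ∀ A ∈ 𝓕, IsJordanCurve A)
    (hd : 𝓕.PairwiseDisjoint id) (h : ⋃₀ 𝓕 = fullCells S free a ∪ fullCells S free b) :
    𝓕 = curves ρ S free a b :=
  family_eq_of_sUnion_eq hf hN.finite_curves (fun A hA => (hJ A hA).isCompact.isClosed)
    (fun _ hA => (hN.isJordanCurve_of_mem hab hA).isCompact.isClosed) hd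
    (hN.pairwiseDisjoint_curves hab) (fun A hA => (hJ A hA).isConnected)
    (fun _ hA => (hN.isJordanCurve_of_mem hab hA).isConnected) (h.trans hN.sUnion_curves.symm)

theorem IsCurveNet.isClosed_free (hN : IsCurveNet ρ pt S free) (c : Color) :
    IsClosed (⋃₀ free c) := by
  rw [sUnion_eq_biUnion]
  exact (hN.free_finite c).isClosed_biUnion fun A hA => (hN.free_jordan c A hA).isCompact.isClosed

theorem IsCurveNet.free_inter_cells (hN : IsCurveNet ρ pt S free) (c c' : Color) (P : Set V) :
    Disjoint (⋃₀ free c) (cells S c' P) := by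
  refine disjoint_left.2 fun z hz hz' => ?_
  obtain ⟨A, hA, hz⟩ := hz
  obtain ⟨v, -, hz'⟩ := mem_cells.1 hz'
  exact disjoint_left.1 (hN.free_cell c A hA c' v) hz hz'

theorem IsCurveNet.free_inter_free (hN : IsCurveNet ρ pt S free) {c c' : Color} (h : c ≠ c') :
    Disjoint (⋃₀ free c) (⋃₀ free c') :=
  disjoint_sUnion_left.2 fun A hA => disjoint_sUnion_right.2 fun B hB =>
    hN.free_disjoint c c' A hA B hB fun h' => absurd h' h

theorem IsCurveNet.union_inter_union (hN : IsCurveNet ρ pt S free) {c c' : Color} (h : c ≠ c')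
    (P P' : Set V) :
    (⋃₀ free c ∪ cells S c P) ∩ (⋃₀ free c' ∪ cells S c' P') ⊆ range pt := by
  rintro z ⟨hz | hz, hz' | hz'⟩
  · exact absurd hz' (disjoint_left.1 (hN.free_inter_free h) hz)
  · exact absurd hz' (disjoint_left.1 (hN.free_inter_cells c c' P') hz)
  · exact absurd hz (disjoint_left.1 (hN.free_inter_cells c' c P) hz')
  · exact hN.cells_inter (fun h' => absurd h' h) ⟨hz, hz'⟩

theorem IsCurveNet.union_subset_closure (hN : IsCurveNet ρ pt S free) (c : Color) (P : Set V) :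
    ⋃₀ free c ∪ cells S c P ⊆ closure ((⋃₀ free c ∪ cells S c P) \ range pt) := by
  refine union_subset (fun z hz => subset_closure ⟨.inl hz, ?_⟩)
    ((hN.cells_subset_closure c P).trans (closure_mono (sdiff_subset_sdiff_left subset_union_right)))
  rintro ⟨v, rfl⟩
  exact disjoint_left.1 (hN.free_inter_cells c c {v}) hz
    (mem_cells.2 ⟨v, rfl, (hN.arc c v).left_mem⟩)

theorem IsCurveNet.isClosed_union [Finite V] (hN : IsCurveNet ρ pt S free) (c : Color)
    (P : Set V) : IsClosed (⋃₀ free c ∪ cells S c P) :=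
  (hN.isClosed_free c).union (hN.isCompact_cells c P).isClosed

theorem IsCurveNet.closure_symmDiff [Finite V] (hN : IsCurveNet ρ pt S free) (hab : a ≠ b)
    (hac : a ≠ c) (hbc : b ≠ c) :
    closure (symmDiff (fullCells S free a ∪ fullCells S free c)
      (fullCells S free b ∪ fullCells S free c)) = fullCells S free a ∪ fullCells S free b := by
  rw [union_comm _ (fullCells S free c), union_comm _ (fullCells S free c)]
  exact closure_symmDiff_union (hN.isClosed_union a univ) (hN.isClosed_union b univ)
    (hN.union_inter_union hac.symm _ _) (hN.union_inter_union hbc.symm _ _)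
    (hN.union_inter_union hab _ _) (hN.union_subset_closure a _) (hN.union_subset_closure b _)

/-- Superimposing the circuit on the curves of colors `a` and `c` cancels its `a`-edges and adds its
`b`-edges, which is what exchanging `a` and `b` along it does. -/
theorem IsCurveNet.idempose_circuit [Finite V] (hN : IsCurveNet ρ pt S free) (hab : a ≠ b)
    (hac : a ≠ c) (hbc : b ≠ c) {O : Set V} (hO : IsOrb (ρ a) (ρ b) O) :
    idempose (fullCells S free a ∪ fullCells S free c) (circuit S a b O) =
      fullCells (exchangeCells S a b O) free a ∪ fullCells (exchangeCells S a b O) free c := by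
  have e1 : fullCells S free a ∪ fullCells S free c =
      cells S a O ∪ ((⋃₀ free a ∪ cells S a Oᶜ) ∪ (⋃₀ free c ∪ cells S c univ)) := by
    simp only [fullCells, cells_union_compl S a O]
    ac_rfl
  have e2 : fullCells (exchangeCells S a b O) free a ∪ fullCells (exchangeCells S a b O) free c =
      ((⋃₀ free a ∪ cells S a Oᶜ) ∪ (⋃₀ free c ∪ cells S c univ)) ∪ cells S b O := by
    simp only [fullCells, cells_exchangeCells_left, cells_exchangeCells_of_ne hac hbc]
    ac_rfl
  have hsub : ∀ c, cells S c O ⊆ ⋃₀ free c ∪ cells S c O := fun c => subset_union_right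
  rw [e1, e2]
  refine closure_symmDiff_union ((hN.isClosed_union a _).union (hN.isClosed_union c _))
    (hN.isCompact_cells b O).isClosed ?_ (hN.cells_inter fun h => absurd h hab) ?_ ?_
    (hN.cells_subset_closure b O)
  · rw [inter_union_distrib_left, inter_union_distrib_left]
    refine union_subset (union_subset ?_ ?_) ?_
    · rw [(hN.free_inter_cells a a O).symm.inter_eq]
      exact empty_subset _
    · exact hN.cells_inter fun _ => ⟨disjoint_compl_right, hO.2.1⟩
    · exact (inter_subset_inter_left _ (hsub a)).trans (hN.union_inter_union hac _ _)
  · rw [union_inter_distrib_right]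
    exact union_subset
      ((inter_subset_inter_right _ (hsub b)).trans (hN.union_inter_union hab _ _))
      ((inter_subset_inter_right _ (hsub b)).trans (hN.union_inter_union hbc.symm _ _))
  · exact union_subset ((hN.union_subset_closure a _).trans
      (closure_mono (sdiff_subset_sdiff_left subset_union_left)))
      ((hN.union_subset_closure c _).trans
      (closure_mono (sdiff_subset_sdiff_left subset_union_right)))

theorem fullCells_union_exchangeCells (O : Set V) :
    fullCells (exchangeCells S a b O) free a ∪ fullCells (exchangeCells S a b O) free b =
      fullCells S free a ∪ fullCells S free b := by
  simp only [fullCells, cells_exchangeCells_left, cells_exchangeCells_right,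
    cells_union_compl S a O, cells_union_compl S b O]
  ac_rfl

theorem IsCurveNet.exchange (hN : IsCurveNet ρ pt S free) {O : Set V}
    (hO : IsOrb (ρ a) (ρ b) O) :
    IsCurveNet (exchange ρ a b O) pt (exchangeCells S a b O) free where
  toIsNet := hN.toIsNet.exchange hO.2.1 hO.2.2.1
  free_finite := hN.free_finite
  free_jordan := hN.free_jordan
  free_disjoint := hN.free_disjoint
  free_cell c A hA c' v := by
    by_cases hv : v ∈ O
    · rw [exchangeCells_of_mem hv]
      exact hN.free_cell c A hA _ v
    · rw [exchangeCells_of_notMem hv]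
      exact hN.free_cell c A hA _ v

/-- The formation `F` consists of the curves of the net. -/
structure Carries (F : PlaneFormation) (S : Color → V → Set ℂ) (free : Color → Set (Set ℂ)) :
    Prop where
  red : ⋃₀ F.red = fullCells S free .red ∪ fullCells S free .purple
  blue : ⋃₀ F.blue = fullCells S free .blue ∪ fullCells S free .purple

variable {F F' : PlaneFormation}

theorem Carries.red_eq [Finite V] (hF : Carries F S free) (hN : IsCurveNet ρ pt S free) :
    F.red = curves ρ S free .red .purple :=
  hN.eq_curves (by decide) F.red_finite F.red_jordan F.red_disjoint hF.red

theorem Carries.blue_eq [Finite V] (hF : Carries F S free) (hN : IsCurveNet ρ pt S free) :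
    F.blue = curves ρ S free .blue .purple :=
  hN.eq_curves (by decide) F.blue_finite F.blue_jordan F.blue_disjoint hF.blue

theorem IsCurveNet.circuit_not_subset (hN : IsCurveNet ρ pt S free) (hab : a ≠ b) (hac : a ≠ c)
    {O : Set V} (hO : O.Nonempty) :
    ¬ circuit S a b O ⊆ fullCells S free b ∪ fullCells S free c := by
  intro h
  obtain ⟨v, hv⟩ := hO
  obtain ⟨z, hz, hz'⟩ := hN.sdiff_nonempty a v
  have hza : z ∈ ⋃₀ free a ∪ cells S a univ := .inr (mem_cells.2 ⟨v, mem_univ v, hz⟩)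
  rcases h (mem_circuit.2 ⟨a, .inl rfl, v, hv, hz⟩) with h | h
  · exact hz' (hN.union_inter_union hab _ _ ⟨hza, h⟩)
  · exact hz' (hN.union_inter_union hac _ _ ⟨hza, h⟩)

/-- The purple edges cancel, so the closure of the symmetric difference is the disjoint union of the
free curves and the red-blue circuits. A Jordan curve in it is one of these; the free ones have a
single color, and a circuit has points of both colors off the vertices. -/
theorem Carries.alternating_eq [Finite V] (hF : Carries F S free) (hN : IsCurveNet ρ pt S free) :
    F.alternating = circuit S .red .blue '' {O | IsOrb (ρ .red) (ρ .blue) O} := by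
  have hcl : closure (symmDiff (⋃₀ F.red) (⋃₀ F.blue)) = ⋃₀ curves ρ S free .red .blue := by
    rw [hF.red, hF.blue, hN.closure_symmDiff (by decide) (by decide) (by decide),
      hN.sUnion_curves]
  ext J
  constructor
  · rintro ⟨hJ, hsub, hr, hb⟩
    rw [hcl] at hsub
    obtain ⟨A, hA, hJA⟩ := exists_subset_of_isPreconnected hN.finite_curves
      (fun _ hA => (hN.isJordanCurve_of_mem (by decide) hA).isCompact.isClosed)
      (hN.pairwiseDisjoint_curves (by decide)) hJ.isConnected hsub
    obtain rfl := hJ.eq_of_subset (hN.isJordanCurve_of_mem (by decide) hA) hJA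
    rcases hA with (hA | hA) | hA
    · exact absurd (hF.red ▸ (subset_sUnion_of_mem hA).trans
        (subset_union_left.trans subset_union_left)) hr
    · exact absurd (hF.blue ▸ (subset_sUnion_of_mem hA).trans
        (subset_union_left.trans subset_union_left)) hb
    · exact hA
  · rintro ⟨O, hO, rfl⟩
    refine ⟨hN.isJordanCurve_circuit (by decide) hO, ?_, ?_, ?_⟩
    · rw [hcl]
      exact subset_sUnion_of_mem (.inr ⟨O, hO, rfl⟩)
    · rw [hF.red, circuit_comm]
      exact hN.circuit_not_subset (by decide) (by decide) hO.1
    · rw [hF.blue]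
      exact hN.circuit_not_subset (by decide) (by decide) hO.1

/-- Red curves, blue curves and alternating circuits correspond to the three pairs of colors, so
together they give `colorCount`. The free curves contribute a term that no exchange affects. -/
theorem Carries.curveCount_eq [Finite V] (hF : Carries F S free) (hN : IsCurveNet ρ pt S free) :
    F.curveCount = (free .red).ncard + (free .blue).ncard + 2 * (free .purple).ncard +
      colorCount ρ := by
  unfold PlaneFormation.curveCount colorCount
  rw [hF.red_eq hN, hF.blue_eq hN, hF.alternating_eq hN, hN.ncard_curves (by decide),
    hN.ncard_curves (by decide), hN.ncard_circuits (by decide)]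
  ring

theorem Carries.parity_eq [Finite V] (hF : Carries F S free) (hN : IsCurveNet ρ pt S free)
    (hab : a ≠ b) {O : Set V} (hO : IsOrb (ρ a) (ρ b) O)
    (hF' : Carries F' (exchangeCells S a b O) free) : F'.parity = F.parity := by
  obtain ⟨half, hP⟩ := hN.exists_planeSystem
  unfold PlaneFormation.parity
  rw [hF.curveCount_eq hN, hF'.curveCount_eq (hN.exchange hO)]
  push_cast
  rw [colorCount_exchange hP hab hO]

/-- A common curve would be a finite disjoint union of segments, hence by connectedness lie in one
of them, and an arc contains no Jordan curve. -/
theorem PlaneFormation.red_disjoint_blue (F : PlaneFormation) : Disjoint F.red F.blue := by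
  refine disjoint_left.2 fun d hr hb => ?_
  obtain ⟨𝓢, hfin, hseg, hd, he⟩ := F.meet d hr d hb
  rw [inter_self] at he
  have hJ := F.red_jordan d hr
  obtain ⟨s, hs, hds⟩ := exists_subset_of_isPreconnected hfin (fun s hs => by
    obtain ⟨p, q, h⟩ := (hseg s hs).exists_isArc
    exact h.isCompact.isClosed) hd hJ.isConnected he.le
  obtain ⟨p, q, h⟩ := (hseg s hs).exists_isArc
  exact hJ.not_subset_isArc h hds

/-- With nothing to cancel, idemposition only adds `d`, so `d` is a component of the new union. -/
theorem mem_of_sUnion_eq {𝓕 𝓖 : Set (Set ℂ)} (hf : 𝓕.Finite) (hg : 𝓖.Finite)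
    (fJ : ∀ A ∈ 𝓕, IsJordanCurve A) (gJ : ∀ A ∈ 𝓖, IsJordanCurve A)
    (fd : 𝓕.PairwiseDisjoint id) (gd : 𝓖.PairwiseDisjoint id) {d : Set ℂ} (hd : IsJordanCurve d)
    (hdf : Disjoint d (⋃₀ 𝓕)) (h : ⋃₀ 𝓖 = idempose (⋃₀ 𝓕) d) : d ∈ 𝓖 := by
  have hcf : IsClosed (⋃₀ 𝓕) := by
    rw [sUnion_eq_biUnion]
    exact hf.isClosed_biUnion fun A hA => (fJ A hA).isCompact.isClosed
  have hJ : ∀ A ∈ insert d 𝓕, IsJordanCurve A := fun A hA => by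
    rcases hA with rfl | hA
    exacts [hd, fJ A hA]
  refine family_subset_of_sUnion_eq (hf.insert d) hg (fun A hA => (hJ A hA).isCompact.isClosed)
    (fun A hA => (gJ A hA).isCompact.isClosed)
    (fd.insert fun A hA _ => hdf.mono_right (subset_sUnion_of_mem hA)) gd
    (fun A hA => (hJ A hA).isConnected) (fun A hA => (gJ A hA).isConnected) ?_ (mem_insert d 𝓕)
  rw [h, idempose, hdf.symm.symmDiff_eq_sup, sUnion_insert, union_comm]
  exact (IsClosed.closure_eq (hcf.union hd.isCompact.isClosed)).symm

theorem jordan_family_eq_of_sUnion_eq {𝓕 𝓖 : Set (Set ℂ)} (hf : 𝓕.Finite) (hg : 𝓖.Finite)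
    (fJ : ∀ A ∈ 𝓕, IsJordanCurve A) (gJ : ∀ A ∈ 𝓖, IsJordanCurve A)
    (fd : 𝓕.PairwiseDisjoint id) (gd : 𝓖.PairwiseDisjoint id) (h : ⋃₀ 𝓕 = ⋃₀ 𝓖) : 𝓕 = 𝓖 :=
  family_eq_of_sUnion_eq hf hg (fun A hA => (fJ A hA).isCompact.isClosed)
    (fun A hA => (gJ A hA).isCompact.isClosed) fd gd (fun A hA => (fJ A hA).isConnected)
    (fun A hA => (gJ A hA).isConnected) h

theorem IsCurveNet.free_disjoint_fullCells (hN : IsCurveNet ρ pt S free) {A : Set ℂ}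
    (hA : A ∈ free a) (h : a ≠ c) : Disjoint A (fullCells S free c) :=
  ((hN.free_inter_free h).mono_left (subset_sUnion_of_mem hA)).union_right
    ((hN.free_inter_cells a c univ).mono_left (subset_sUnion_of_mem hA))

theorem Carries.parity_eq_of_isSimpleOperation [Finite V] (hF : Carries F S free)
    (hN : IsCurveNet ρ pt S free) (hp : free .purple = ∅) (h : F.IsSimpleOperation F') :
    F'.parity = F.parity := by
  obtain ⟨d, ⟨hd, h1, h2⟩ | ⟨hd, h1, h2⟩ | ⟨hd, h1, h2⟩⟩ := h
  · rw [hF.red_eq hN] at hd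
    rcases hd with (hd | hd) | ⟨O, hO, rfl⟩
    -- A red curve without overlaps would become blue as well in `F'`, which `red_disjoint_blue`
    -- forbids. Operations along free curves therefore do not occur.
    · refine absurd ?_ (disjoint_left.1 F'.red_disjoint_blue (show d ∈ _ from ?_))
      · refine mem_of_sUnion_eq F.blue_finite F'.blue_finite F.blue_jordan F'.blue_jordan
          F.blue_disjoint F'.blue_disjoint (hN.free_jordan _ d hd) ?_ h2
        rw [hF.blue]
        exact (hN.free_disjoint_fullCells hd (by decide)).union_right
          (hN.free_disjoint_fullCells hd (by decide))
      · rw [jordan_family_eq_of_sUnion_eq F'.red_finite F.red_finite F'.red_jordan F.red_jordan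
          F'.red_disjoint F.red_disjoint h1, hF.red_eq hN]
        exact .inl (.inl hd)
    · simp [hp] at hd
    · refine hF.parity_eq hN (by decide) hO ⟨?_, ?_⟩
      · rw [h1, hF.red, fullCells_union_exchangeCells]
      · rw [h2, hF.blue, circuit_comm, union_comm, hN.idempose_circuit (by decide) (by decide)
          (by decide) hO.swap, exchangeCells_comm, union_comm]
  · rw [hF.blue_eq hN] at hd
    rcases hd with (hd | hd) | ⟨O, hO, rfl⟩
    · refine absurd ?_ (disjoint_right.1 F'.red_disjoint_blue (show d ∈ _ from ?_))
      · refine mem_of_sUnion_eq F.red_finite F'.red_finite F.red_jordan F'.red_jordan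
          F.red_disjoint F'.red_disjoint (hN.free_jordan _ d hd) ?_ h1
        rw [hF.red]
        exact (hN.free_disjoint_fullCells hd (by decide)).union_right
          (hN.free_disjoint_fullCells hd (by decide))
      · rw [jordan_family_eq_of_sUnion_eq F'.blue_finite F.blue_finite F'.blue_jordan
          F.blue_jordan F'.blue_disjoint F.blue_disjoint h2, hF.blue_eq hN]
        exact .inl (.inl hd)
    · simp [hp] at hd
    · refine hF.parity_eq hN (by decide) hO ⟨?_, ?_⟩
      · rw [h1, hF.red, circuit_comm, union_comm, hN.idempose_circuit (by decide) (by decide)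
          (by decide) hO.swap, exchangeCells_comm, union_comm]
      · rw [h2, hF.blue, fullCells_union_exchangeCells]
  · rw [hF.alternating_eq hN] at hd
    obtain ⟨O, hO, rfl⟩ := hd
    refine hF.parity_eq hN (by decide) hO ⟨?_, ?_⟩
    · rw [h1, hF.red, hN.idempose_circuit (by decide) (by decide) (by decide) hO]
    · rw [h2, hF.blue, circuit_comm, hN.idempose_circuit (by decide) (by decide)
        (by decide) hO.swap, exchangeCells_comm]

end

end KempeParity

namespace KempeParity

/-! ### The net of a plane formation -/

open Set Function

theorem IsArc.exists_complement {p q : ℂ} {s A : Set ℂ} (hs : IsArc p q s)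
    (hA : IsJordanCurve A) (h : s ⊆ A) :
    ∃ t, IsArc p q t ∧ t ∩ s = {p, q} ∧ s ∪ t = A := by
  -- Starting the parametrization at a point off `s` keeps `s` within one parameter interval [x, y];
  -- the complementary arc then runs from y to 1 and on from 0 to x.
  obtain ⟨z, hz, hzs⟩ := not_subset.1 (hA.not_subset_isArc hs)
  obtain ⟨F, hF, F0, F1, Fi, rfl⟩ := hA.exists_param hz
  obtain ⟨α, β, hα, hβ, hsub⟩ := exists_Icc_of_subset hF (F0.trans F1.symm) hs.isCompact h
    (by rwa [F0])
  have hαβ : Icc α β ⊆ Ico 0 1 := fun x hx => ⟨hα.le.trans hx.1, hx.2.trans_lt hβ⟩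
  obtain ⟨x, y, hx, hxy, hy, rfl, he⟩ := hs.exists_subinterval hF (Fi.mono hαβ) hsub
  have hx0 : 0 < x := hα.trans_le hx
  have hy1 : y < 1 := hy.trans_lt hβ
  have Fi' : InjOn F (Ioc 0 1) := by
    intro u hu v hv huv
    rcases hu.2.lt_or_eq with h1 | rfl <;> rcases hv.2.lt_or_eq with h2 | rfl
    · exact Fi ⟨hu.1.le, h1⟩ ⟨hv.1.le, h2⟩ huv
    · exact absurd (Fi ⟨hu.1.le, h1⟩ (by simp) (huv.trans (F1.trans F0.symm))) hu.1.ne'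
    · exact absurd (Fi ⟨hv.1.le, h2⟩ (by simp) (huv.symm.trans (F1.trans F0.symm))) hv.1.ne'
    · rfl
  have m1 : Icc 0 x ⊆ Ico 0 1 := fun u hu => ⟨hu.1, by linarith [hu.2]⟩
  have m2 : Icc y 1 ⊆ Ioc 0 1 := fun u hu => ⟨by linarith [hu.1], hu.2⟩
  have a1 : IsArc (F 0) (F x) (F '' Icc 0 x) := isArc_image hF hx0
    (Fi.mono m1)
  have a2 : IsArc (F y) (F 1) (F '' Icc y 1) := isArc_image hF hy1
    (Fi'.mono m2)
  rw [F1, ← F0] at a2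
  have a3 : IsArc (F y) (F x) (F '' Icc y 1 ∪ F '' Icc 0 x) := by
    refine a2.concat a1 ?_
    rintro _ ⟨⟨u, hu, rfl⟩, ⟨v, hv, hvu⟩⟩
    rcases hu.2.lt_or_eq with h1 | rfl
    · have := Fi ⟨hv.1, by linarith [hv.2]⟩ ⟨by linarith [hu.1], h1⟩ hvu
      linarith [hu.1, hv.2]
    · rw [F1, F0]
      rfl
  refine ⟨F '' Icc y 1 ∪ F '' Icc 0 x, ?_, ?_, ?_⟩
  · have h1 : p = F x ∨ p = F y := by
      have : p ∈ ({p, q} : Set ℂ) := by simp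
      rwa [← he] at this
    have h2 : q = F x ∨ q = F y := by
      have : q ∈ ({p, q} : Set ℂ) := by simp
      rwa [← he] at this
    have hne := hs.ne
    rcases h1 with rfl | rfl <;> rcases h2 with rfl | rfl
    exacts [absurd rfl hne, a3.symm, a3, absurd rfl hne]
  · rw [← he]
    ext w
    constructor
    · rintro ⟨⟨u, hu, rfl⟩ | ⟨u, hu, rfl⟩, v, hv, hvu⟩
      · have := Fi' ⟨by linarith [hv.1], by linarith [hv.2]⟩ ⟨by linarith [hu.1], hu.2⟩ hvu
        right
        rw [mem_singleton_iff, show u = y by linarith [hu.1, hv.2]]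
      · have := Fi ⟨by linarith [hv.1], by linarith [hv.2]⟩ ⟨hu.1, by linarith [hu.2]⟩ hvu
        left
        rw [show u = x by linarith [hu.2, hv.1]]
    · rintro (rfl | rfl)
      · exact ⟨.inr ⟨x, ⟨hx0.le, le_rfl⟩, rfl⟩, x, ⟨le_rfl, hxy.le⟩, rfl⟩
      · exact ⟨.inl ⟨y, ⟨le_rfl, hy1.le⟩, rfl⟩, y, ⟨hxy.le, le_rfl⟩, rfl⟩
  · rw [← image_union, ← image_union]
    congr 1
    ext u
    simp only [mem_union, mem_Icc]
    constructor
    · rintro (h | h | h) <;> constructor <;> linarith [h.1, h.2]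
    · intro h
      rcases le_total u x with h1 | h1
      · exact .inr (.inr ⟨h.1, h1⟩)
      · rcases le_total u y with h2 | h2
        · exact .inl ⟨h1, h2⟩
        · exact .inr (.inl ⟨h2, h.2⟩)

theorem IsArc.exists_split {p q p' q' : ℂ} {s t : Set ℂ} (hs : IsArc p' q' s) (ht : IsArc p q t)
    (h : s ⊆ t) (hp : p ∉ s) (hq : q ∉ s) :
    ∃ t₁ t₂ x y, IsArc p x t₁ ∧ IsArc y q t₂ ∧ ({x, y} : Set ℂ) = {p', q'} ∧ Disjoint t₁ t₂ ∧
      t₁ ∩ s = {x} ∧ t₂ ∩ s = {y} ∧ s ∪ (t₁ ∪ t₂) = t := by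
  obtain ⟨f, hf, fi, rfl, rfl, rfl⟩ := ht
  obtain ⟨x, y, hx, hxy, hy, rfl, he⟩ := hs.exists_subinterval hf fi h
  have hx0 : 0 < x := lt_of_le_of_ne hx fun h0 => hp ⟨x, ⟨le_rfl, hxy.le⟩, by rw [h0]⟩
  have hy1 : y < 1 := lt_of_le_of_ne hy fun h1 => hq ⟨y, ⟨hxy.le, le_rfl⟩, by rw [h1]⟩
  have m1 : Icc 0 x ⊆ Icc 0 1 := Icc_subset_Icc le_rfl (by linarith)
  have m2 : Icc y 1 ⊆ Icc 0 1 := Icc_subset_Icc (by linarith) le_rfl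
  have m3 : Icc x y ⊆ Icc 0 1 := Icc_subset_Icc hx hy
  refine ⟨f '' Icc 0 x, f '' Icc y 1, f x, f y, isArc_image hf hx0 (fi.mono m1),
    isArc_image hf hy1 (fi.mono m2), he, ?_, ?_, ?_, ?_⟩
  · rw [disjoint_iff_inter_eq_empty, ← fi.image_inter m1 m2, image_eq_empty,
      ← disjoint_iff_inter_eq_empty]
    exact disjoint_left.2 fun u hu hv => by linarith [hu.2, hv.1]
  · rw [← fi.image_inter m1 m3, Icc_inter_Icc_eq_singleton hx0.le hxy.le, image_singleton]
  · rw [inter_comm, ← fi.image_inter m3 m2, Icc_inter_Icc_eq_singleton hxy.le hy1.le,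
      image_singleton]
  · rw [← image_union, ← image_union]
    congr 1
    ext u
    simp only [mem_union, mem_Icc]
    constructor
    · rintro (h | h | h) <;> constructor <;> linarith [h.1, h.2]
    · intro h
      rcases le_total u x with h1 | h1
      · exact .inr (.inl ⟨h.1, h1⟩)
      · rcases le_total u y with h2 | h2
        · exact .inl ⟨h1, h2⟩
        · exact .inr (.inr ⟨h2, h.2⟩)

/-- The arcs `𝓣` and the curves `𝓐₀` are what the arcs `𝓢`, with ends `e s b`, leave of the Jordan
curves `𝓐`. -/
structure IsRemainder (e : Set ℂ → Bool → ℂ) (𝓐 𝓢 𝓐₀ 𝓣 : Set (Set ℂ)) : Prop where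
  subset : 𝓐₀ ⊆ 𝓐
  disjoint : (𝓐₀ ∪ 𝓣).PairwiseDisjoint id
  disjoint_free : ∀ A ∈ 𝓐₀, Disjoint A (⋃₀ 𝓢)
  finite : 𝓣.Finite
  arc : ∀ t ∈ 𝓣, ∃ s ∈ 𝓢, ∃ b, ∃ s' ∈ 𝓢, ∃ b', IsArc (e s b) (e s' b') t ∧
    t ∩ ⋃₀ 𝓢 = {e s b, e s' b'}
  union : ⋃₀ 𝓢 ∪ ⋃₀ (𝓐₀ ∪ 𝓣) = ⋃₀ 𝓐
  ends : ∀ s ∈ 𝓢, ∀ b, e s b ∈ ⋃₀ 𝓣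

/-- The bookkeeping when one more segment is cut out: the piece `X` that contains `s` is replaced by
the pieces `𝓝` left of it, and all other pieces stay off `s`. -/
theorem IsRemainder.insert {e : Set ℂ → Bool → ℂ} {𝓐 𝓢 𝓐₀ 𝓣 : Set (Set ℂ)} {s X : Set ℂ}
    (h : IsRemainder e 𝓐 𝓢 𝓐₀ 𝓣) (hsd : Disjoint s (⋃₀ 𝓢)) (hX : X ∈ 𝓐₀ ∪ 𝓣) {𝓝 : Set (Set ℂ)}
    (hfin : 𝓝.Finite) (hd : 𝓝.PairwiseDisjoint id) (hu : s ∪ ⋃₀ 𝓝 = X)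
    (hn : ∀ t ∈ 𝓝, ∃ r ∈ insert s 𝓢, ∃ b, ∃ r' ∈ insert s 𝓢, ∃ b', IsArc (e r b) (e r' b') t ∧
      t ∩ (s ∪ ⋃₀ 𝓢) = {e r b, e r' b'}) (he : ∀ b, e s b ∈ ⋃₀ 𝓝) (hes : ∀ r ∈ 𝓢, ∀ b, e r b ∈ r) :
    IsRemainder e 𝓐 (insert s 𝓢) (𝓐₀ \ {X}) (𝓣 \ {X} ∪ 𝓝) := by
  have hsX : s ⊆ X := hu ▸ subset_union_left
  have hoff : ∀ Y ∈ 𝓐₀ ∪ 𝓣, Y ≠ X → Disjoint Y X := fun Y hY hne => h.disjoint hY hX hne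
  have hall : 𝓐₀ \ {X} ∪ (𝓣 \ {X} ∪ 𝓝) = (𝓐₀ ∪ 𝓣) \ {X} ∪ 𝓝 := by
    rw [← union_assoc, union_sdiff_distrib]
  refine ⟨sdiff_subset.trans h.subset, ?_, ?_, (h.finite.subset sdiff_subset).union hfin, ?_, ?_,
    ?_⟩
  · rw [hall, pairwiseDisjoint_union]
    refine ⟨h.disjoint.subset sdiff_subset, hd, fun Y hY t ht _ => ?_⟩
    exact (hoff Y hY.1 hY.2).mono_right (hu ▸ (subset_sUnion_of_mem ht).trans subset_union_right)
  · intro A hA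
    rw [sUnion_insert]
    exact ((hoff A (.inl hA.1) hA.2).mono_right hsX).union_right (h.disjoint_free A hA.1)
  · rintro t (ht | ht)
    · obtain ⟨r, hr, b, r', hr', b', h1, h2⟩ := h.arc t ht.1
      refine ⟨r, .inr hr, b, r', .inr hr', b', h1, ?_⟩
      rw [sUnion_insert, inter_union_distrib_left,
        ((hoff t (.inr ht.1) ht.2).mono_right hsX).inter_eq, empty_union, h2]
    · rw [sUnion_insert]
      exact hn t ht
  · have hE : ⋃₀ (𝓐₀ ∪ 𝓣) = s ∪ ⋃₀ 𝓝 ∪ ⋃₀ ((𝓐₀ ∪ 𝓣) \ {X}) := by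
      rw [hu, ← sUnion_insert, insert_sdiff_singleton, insert_eq_of_mem hX]
    rw [hall, ← h.union, hE, sUnion_insert, sUnion_union _ 𝓝]
    ac_rfl
  · rintro r (rfl | hr) b
    · obtain ⟨t, ht, hz⟩ := he b
      exact ⟨t, .inr ht, hz⟩
    · obtain ⟨t, ht, hz⟩ := h.ends r hr b
      by_cases htX : t = X
      · rw [htX, ← hu] at hz
        rcases hz with hz | ⟨t', ht', hz⟩
        · exact absurd ⟨r, hr, hes r hr b⟩ (disjoint_left.1 hsd hz)
        · exact ⟨t', .inr ht', hz⟩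
      · exact ⟨t, .inl ⟨ht, htX⟩, hz⟩

/-- Induction on the segments. A new segment is connected, so it lies in a single remaining piece.
Cut out of a whole curve it leaves one arc; cut out of an arc it leaves two, since it avoids the
ends of that arc, which belong to earlier segments. -/
theorem exists_isRemainder {e : Set ℂ → Bool → ℂ} {𝓐 𝓢 : Set (Set ℂ)} (hfin : 𝓐.Finite)
    (hJ : ∀ A ∈ 𝓐, IsJordanCurve A) (hd : 𝓐.PairwiseDisjoint id) (hS : 𝓢.Finite)
    (harc : ∀ s ∈ 𝓢, IsArc (e s false) (e s true) s) (hsd : 𝓢.PairwiseDisjoint id)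
    (hsub : ⋃₀ 𝓢 ⊆ ⋃₀ 𝓐) : ∃ 𝓐₀ 𝓣, IsRemainder e 𝓐 𝓢 𝓐₀ 𝓣 := by
  induction 𝓢, hS using Set.Finite.induction_on with
  | empty => exact ⟨𝓐, ∅, subset_rfl, by simpa, by simp, by simp, by simp, by simp, by simp⟩
  | @insert s 𝓢 hs hS ih =>
    obtain ⟨𝓐₀, 𝓣, h⟩ := ih (fun r hr => harc r (.inr hr)) (hsd.subset (subset_insert _ _))
      ((sUnion_mono (subset_insert _ _)).trans hsub)
    have hs1 := harc s (.inl rfl)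
    have hsS : Disjoint s (⋃₀ 𝓢) := disjoint_sUnion_right.2 fun r hr =>
      hsd (.inl rfl) (.inr hr) fun h => hs (h ▸ hr)
    have hes : ∀ r ∈ 𝓢, ∀ b, e r b ∈ r := fun r hr b => by
      have := harc r (.inr hr)
      cases b
      exacts [this.left_mem, this.right_mem]
    have hsX : s ⊆ ⋃₀ (𝓐₀ ∪ 𝓣) := fun z hz => by
      have : z ∈ ⋃₀ 𝓐 := hsub ⟨s, .inl rfl, hz⟩
      rw [← h.union] at this
      exact this.resolve_left (disjoint_left.1 hsS hz)
    have hcl : ∀ A ∈ 𝓐₀ ∪ 𝓣, IsClosed A := by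
      rintro A (hA | hA)
      · exact (hJ A (h.subset hA)).isCompact.isClosed
      · obtain ⟨_, _, _, _, _, _, h1, -⟩ := h.arc A hA
        exact h1.isCompact.isClosed
    obtain ⟨X, hX, hsX⟩ := exists_subset_of_isPreconnected
      ((hfin.subset h.subset).union h.finite) hcl h.disjoint hs1.isConnected hsX
    suffices h𝓝 : ∃ 𝓝 : Set (Set ℂ), 𝓝.Finite ∧ 𝓝.PairwiseDisjoint id ∧ s ∪ ⋃₀ 𝓝 = X ∧
        (∀ t ∈ 𝓝, ∃ r ∈ insert s 𝓢, ∃ b, ∃ r' ∈ insert s 𝓢, ∃ b', IsArc (e r b) (e r' b') t ∧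
          t ∩ (s ∪ ⋃₀ 𝓢) = {e r b, e r' b'}) ∧ ∀ b, e s b ∈ ⋃₀ 𝓝 by
      obtain ⟨𝓝, h1, h2, h3, h4, h5⟩ := h𝓝
      exact ⟨_, _, h.insert hsS hX h1 h2 h3 h4 h5 hes⟩
    rcases hX with hX | hX
    · obtain ⟨t, ht, hts, hu⟩ := hs1.exists_complement (hJ X (h.subset hX)) hsX
      refine ⟨{t}, finite_singleton t, pairwiseDisjoint_singleton _ _, by simpa, ?_, ?_⟩
      · intro t' ht'
        rw [mem_singleton_iff.1 ht']
        refine ⟨s, .inl rfl, false, s, .inl rfl, true, ht, ?_⟩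
        have : Disjoint t (⋃₀ 𝓢) := (h.disjoint_free X hX).mono_left (hu ▸ subset_union_right)
        rw [inter_union_distrib_left, this.inter_eq, union_empty, hts]
      · rintro (_ | _)
        exacts [⟨t, rfl, ht.left_mem⟩, ⟨t, rfl, ht.right_mem⟩]
    · obtain ⟨r, hr, b, r', hr', b', ht, hint⟩ := h.arc X hX
      have hp : e r b ∉ s := fun hz => disjoint_left.1 hsS hz ⟨r, hr, hes r hr b⟩
      have hq : e r' b' ∉ s := fun hz => disjoint_left.1 hsS hz ⟨r', hr', hes r' hr' b'⟩
      obtain ⟨t₁, t₂, x, y, h1, h2, he, hd12, hx, hy, hu⟩ := hs1.exists_split ht hsX hp hq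
      have hexy : ∀ z ∈ ({x, y} : Set ℂ), ∃ b, e s b = z := by
        intro z hz
        rw [he] at hz
        rcases hz with rfl | rfl
        exacts [⟨_, rfl⟩, ⟨_, rfl⟩]
      obtain ⟨bx, rfl⟩ := hexy x (by simp)
      obtain ⟨bY, rfl⟩ := hexy y (by simp)
      have key : ∀ t' ⊆ X, t' ∩ ⋃₀ 𝓢 = t' ∩ {e r b, e r' b'} := fun t' ht' => by
        rw [← hint, ← inter_assoc, inter_eq_left.2 ht']
      refine ⟨{t₁, t₂}, by simp, ?_, by simpa using hu, ?_, ?_⟩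
      · exact (pairwiseDisjoint_singleton t₂ id).insert fun A hA _ => mem_singleton_iff.1 hA ▸ hd12
      · have hl := disjoint_right.1 hd12 h2.right_mem
        have hr0 := disjoint_left.1 hd12 h1.left_mem
        intro t ht
        rcases ht with ht | ht
        · rw [ht]
          refine ⟨r, .inr hr, b, s, .inl rfl, bx, h1, ?_⟩
          rw [inter_union_distrib_left, hx, key _ (hu ▸ subset_union_left.trans subset_union_right),
            inter_insert_of_mem h1.left_mem, inter_singleton_eq_empty.2 hl, insert_empty_eq,
            union_comm, singleton_union]
        · rw [mem_singleton_iff.1 ht]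
          refine ⟨s, .inl rfl, bY, r', .inr hr', b', h2, ?_⟩
          rw [inter_union_distrib_left, hy,
            key _ (hu ▸ subset_union_right.trans subset_union_right), inter_insert_of_notMem hr0,
            inter_singleton_of_mem h2.right_mem, singleton_union]
      · intro b''
        have : e s b'' ∈ ({e s bx, e s bY} : Set ℂ) := by
          rw [he]
          cases b'' <;> simp
        rcases this with h' | h'
        · exact ⟨t₁, by simp, h' ▸ h1.right_mem⟩
        · exact ⟨t₂, by simp, Set.mem_singleton_iff.1 h' ▸ h2.left_mem⟩

/-- The free curves `𝓐₀` and the arcs `T v` from `pt v` to `pt (ρ v)` are what the set `M`, which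
contains all points `pt v`, leaves of the Jordan curves `𝓐`. -/
structure IsLinking {V : Type*} (pt : V → ℂ) (𝓐 𝓐₀ : Set (Set ℂ)) (M : Set ℂ) (ρ : V → V)
    (T : V → Set ℂ) : Prop where
  matching : IsMatching ρ
  arc : ∀ v, IsArc (pt v) (pt (ρ v)) (T v)
  symm : ∀ v, T (ρ v) = T v
  disjoint : ∀ v v', v' ≠ v → v' ≠ ρ v → Disjoint (T v) (T v')
  inter : ∀ v, T v ∩ M = {pt v, pt (ρ v)}
  subset : 𝓐₀ ⊆ 𝓐
  free : ∀ A ∈ 𝓐₀, Disjoint A M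
  free_arc : ∀ A ∈ 𝓐₀, ∀ v, Disjoint A (T v)
  union : ⋃₀ 𝓐 = ⋃₀ 𝓐₀ ∪ (⋃ v, T v) ∪ M

/-- Each end of a segment lies on exactly one remaining arc, as these arcs are disjoint, and it is
an end of that arc; the other end defines the matching. -/
theorem IsRemainder.exists_isLinking {e : Set ℂ → Bool → ℂ} {𝓐 𝓢 𝓐₀ 𝓣 : Set (Set ℂ)}
    (h : IsRemainder e 𝓐 𝓢 𝓐₀ 𝓣) (hJ : ∀ A ∈ 𝓐, IsJordanCurve A)
    (hes : ∀ s ∈ 𝓢, ∀ b, e s b ∈ s) (hinj : Injective fun v : 𝓢 × Bool => e v.1 v.2) :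
    ∃ ρ T, IsLinking (fun v : 𝓢 × Bool => e v.1 v.2) 𝓐 𝓐₀ (⋃₀ 𝓢) ρ T := by
  set pt := fun v : 𝓢 × Bool => e v.1 v.2 with hpt
  have harc : ∀ t ∈ 𝓣, ∃ u u', IsArc (pt u) (pt u') t ∧ t ∩ ⋃₀ 𝓢 = {pt u, pt u'} := by
    intro t ht
    obtain ⟨s, hs, b, s', hs', b', h1, h2⟩ := h.arc t ht
    exact ⟨(⟨s, hs⟩, b), (⟨s', hs'⟩, b'), h1, h2⟩
  have hM : ∀ v, ∃ t ∈ 𝓣, pt v ∈ t := fun v => h.ends v.1 v.1.2 v.2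
  have hpS : ∀ v, pt v ∈ ⋃₀ 𝓢 := fun v => ⟨v.1, v.1.2, hes v.1 v.1.2 v.2⟩
  have hex : ∀ v, ∃ t ∈ 𝓣, ∃ u, IsArc (pt v) (pt u) t ∧ t ∩ ⋃₀ 𝓢 = {pt v, pt u} := by
    intro v
    obtain ⟨t, ht, hv⟩ := hM v
    obtain ⟨u, u', h1, h2⟩ := harc t ht
    have : pt v ∈ ({pt u, pt u'} : Set ℂ) := h2 ▸ ⟨hv, hpS v⟩
    rcases this with h' | h'
    · rw [hinj h']
      exact ⟨t, ht, u', h1, h2⟩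
    · rw [hinj h']
      exact ⟨t, ht, u, h1.symm, by rw [h2, pair_comm]⟩
  choose T hT ρ h1 h2 using hex
  have heq : ∀ v v' z, z ∈ T v → z ∈ T v' → T v = T v' := fun v v' z hz hz' =>
    h.disjoint.elim (.inr (hT v)) (.inr (hT v')) (not_disjoint_iff.2 ⟨z, hz, hz'⟩)
  have hs : ∀ v, T (ρ v) = T v := fun v => heq _ _ _ (h1 (ρ v)).left_mem (h1 v).right_mem
  have hne : ∀ v, ρ v ≠ v := fun v hv => (h1 v).ne (by rw [hv])
  have hmem : ∀ v u, pt u ∈ T v → u = v ∨ u = ρ v := fun v u hu => by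
    have : pt u ∈ ({pt v, pt (ρ v)} : Set ℂ) := h2 v ▸ ⟨hu, hpS u⟩
    exact this.imp (fun h => hinj h) fun h => hinj h
  have hfree : ∀ A ∈ 𝓐₀, ∀ v, Disjoint A (T v) := fun A hA v =>
    h.disjoint (.inl hA) (.inr (hT v)) fun h' =>
      (hJ A (h.subset hA)).not_subset_isArc (h1 v) h'.le
  refine ⟨ρ, T, ⟨fun v => ?_, hne⟩, h1, hs, fun v v' hv hv' => ?_, h2, h.subset, h.disjoint_free,
    hfree, ?_⟩
  · refine (hmem v _ ?_).resolve_right (hne (ρ v))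
    rw [← hs v]
    exact (h1 (ρ v)).right_mem
  · refine h.disjoint (.inr (hT v)) (.inr (hT v')) fun h' => ?_
    have : pt v' ∈ T v := by
      rw [show T v = T v' from h']
      exact (h1 v').left_mem
    exact (hmem v v' this).elim hv hv'
  · rw [← h.union, union_comm, sUnion_union]
    congr 2
    refine subset_antisymm (fun z hz => ?_) (iUnion_subset fun v => subset_sUnion_of_mem (hT v))
    obtain ⟨t, ht, hz⟩ := hz
    obtain ⟨u, u', h3, -⟩ := harc t ht
    have : t = T u := h.disjoint.elim (.inr ht) (.inr (hT u))
      (not_disjoint_iff.2 ⟨_, h3.left_mem, (h1 u).left_mem⟩)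
    exact mem_iUnion.2 ⟨u, this ▸ hz⟩

end KempeParity

namespace KempeParity

/-! ### Parity of plane formations -/

open Set Function

theorem PlaneFormation.exists_segments (F : PlaneFormation) : ∃ 𝓢 : Set (Set ℂ), 𝓢.Finite ∧
    (∀ s ∈ 𝓢, IsSegment s) ∧ 𝓢.PairwiseDisjoint id ∧ ⋃₀ 𝓢 = ⋃₀ F.red ∩ ⋃₀ F.blue := by
  choose! 𝓢 h1 h2 h3 h4 using F.meet
  have hsub : ∀ A ∈ F.red, ∀ B ∈ F.blue, ∀ s ∈ 𝓢 A B, s ⊆ A ∩ B := fun A hA B hB s hs => by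
    rw [h4 A hA B hB]
    exact subset_sUnion_of_mem hs
  refine ⟨⋃ A ∈ F.red, ⋃ B ∈ F.blue, 𝓢 A B, F.red_finite.biUnion fun A hA =>
    F.blue_finite.biUnion fun B hB => h1 A hA B hB, ?_, ?_, ?_⟩
  · intro s hs
    simp only [mem_iUnion] at hs
    obtain ⟨A, hA, B, hB, hs⟩ := hs
    exact h2 A hA B hB s hs
  · intro s hs s' hs' hne
    simp only [mem_iUnion] at hs hs'
    obtain ⟨A, hA, B, hB, hs⟩ := hs
    obtain ⟨A', hA', B', hB', hs'⟩ := hs'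
    have k := hsub A hA B hB s hs
    have k' := hsub A' hA' B' hB' s' hs'
    by_cases hAA : A = A'
    · by_cases hBB : B = B'
      · subst hAA hBB
        exact h3 A hA B hB hs hs' hne
      · exact (F.blue_disjoint hB hB' hBB).mono (k.trans inter_subset_right)
          (k'.trans inter_subset_right)
    · exact (F.red_disjoint hA hA' hAA).mono (k.trans inter_subset_left)
        (k'.trans inter_subset_left)
  · ext z
    simp only [mem_sUnion, mem_iUnion, mem_inter_iff]
    constructor
    · rintro ⟨s, ⟨A, hA, B, hB, hs⟩, hz⟩
      have := hsub A hA B hB s hs hz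
      exact ⟨⟨A, hA, this.1⟩, B, hB, this.2⟩
    · rintro ⟨⟨A, hA, hzA⟩, B, hB, hzB⟩
      have : z ∈ A ∩ B := ⟨hzA, hzB⟩
      rw [h4 A hA B hB] at this
      obtain ⟨s, hs, hz⟩ := this
      exact ⟨s, ⟨A, hA, B, hB, hs⟩, hz⟩

/-- The vertices are the ends of the overlap segments, indexed by a segment and a Boolean. The
segments are the purple edges, and what they leave of the red and of the blue curves gives the red
and blue edges and the free curves. No purple curve is free, because overlaps are arcs. -/
theorem PlaneFormation.exists_isCurveNet (F : PlaneFormation) :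
    ∃ (V : Type) (_ : Finite V) (ρ : Color → V → V) (pt : V → ℂ) (S : Color → V → Set ℂ)
      (free : Color → Set (Set ℂ)), IsCurveNet ρ pt S free ∧ Carries F S free ∧
        free .purple = ∅ := by
  obtain ⟨𝓢, hfin, hseg, hdis, hU⟩ := F.exists_segments
  choose! p q harc using fun s hs => (hseg s hs).exists_isArc
  let e : Set ℂ → Bool → ℂ := fun s b => if b then q s else p s
  have he : ∀ s ∈ 𝓢, IsArc (e s false) (e s true) s := fun s hs => by simpa [e] using harc s hs
  have hes : ∀ s ∈ 𝓢, ∀ b, e s b ∈ s := by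
    rintro s hs (_ | _)
    exacts [(he s hs).left_mem, (he s hs).right_mem]
  have hinj : Injective fun v : 𝓢 × Bool => e v.1 v.2 := by
    rintro ⟨⟨s, hs⟩, b⟩ ⟨⟨s', hs'⟩, b'⟩ h
    have hss : s = s' := hdis.elim hs hs' (not_disjoint_iff.2 ⟨e s b, hes s hs b, by
      rw [show e s b = e s' b' from h]
      exact hes s' hs' b'⟩)
    subst hss
    have hne := (he s hs).ne
    cases b <;> cases b' <;> first | rfl | exact absurd h hne | exact absurd h.symm hne
  obtain ⟨𝓡, 𝓣r, hr⟩ := exists_isRemainder F.red_finite F.red_jordan F.red_disjoint hfin he hdis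
    (hU ▸ inter_subset_left)
  obtain ⟨𝓑, 𝓣b, hb⟩ := exists_isRemainder F.blue_finite F.blue_jordan F.blue_disjoint hfin he hdis
    (hU ▸ inter_subset_right)
  obtain ⟨ρr, Tr, hr⟩ := hr.exists_isLinking F.red_jordan hes hinj
  obtain ⟨ρb, Tb, hb⟩ := hb.exists_isLinking F.blue_jordan hes hinj
  set pt := fun v : 𝓢 × Bool => e v.1 v.2 with hpt
  have : Finite 𝓢 := hfin
  let ρ : Color → 𝓢 × Bool → 𝓢 × Bool := fun c => match c with
    | .red => ρr
    | .blue => ρb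
    | .purple => fun v => (v.1, !v.2)
  let S : Color → 𝓢 × Bool → Set ℂ := fun c => match c with
    | .red => Tr
    | .blue => Tb
    | .purple => fun v => v.1
  let free : Color → Set (Set ℂ) := fun c => match c with
    | .red => 𝓡
    | .blue => 𝓑
    | .purple => ∅
  have hpS : ∀ v, pt v ∈ ⋃₀ 𝓢 := fun v => ⟨v.1, v.1.2, hes v.1 v.1.2 v.2⟩
  have hSr : ∀ v, S .red v ⊆ ⋃₀ F.red := fun v => by
    rw [hr.union]
    exact (subset_iUnion Tr v).trans (subset_union_right.trans subset_union_left)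
  have hSb : ∀ v, S .blue v ⊆ ⋃₀ F.blue := fun v => by
    rw [hb.union]
    exact (subset_iUnion Tb v).trans (subset_union_right.trans subset_union_left)
  have hSp : ∀ v, S .purple v ⊆ ⋃₀ 𝓢 := fun v => subset_sUnion_of_mem v.1.2
  have hpurple : cells S .purple univ = ⋃₀ 𝓢 := by
    refine subset_antisymm (iUnion₂_subset fun v _ => hSp v) fun z ⟨s, hs, hz⟩ => ?_
    exact mem_cells.2 ⟨(⟨s, hs⟩, true), mem_univ _, hz⟩
  have hmeet : ∀ c c' v v', c ≠ c' → S c v ∩ S c' v' ⊆ ⋃₀ 𝓢 := by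
    rintro (_ | _ | _) (_ | _ | _) v v' hcc z ⟨hz, hz'⟩ <;>
      first
      | exact absurd rfl hcc
      | exact hSp _ hz
      | exact hSp _ hz'
      | exact hU ▸ ⟨hSr _ hz, hSb _ hz'⟩
      | exact hU ▸ ⟨hSr _ hz', hSb _ hz⟩
  have hrange : ∀ c, c ≠ .purple → ∀ v, S c v ∩ ⋃₀ 𝓢 = {pt v, pt (ρ c v)} := by
    rintro (_ | _ | _) hc v
    exacts [hr.inter v, hb.inter v, absurd rfl hc]
  have hrange' : ∀ c, c ≠ .purple → ∀ v, S c v ∩ ⋃₀ 𝓢 ⊆ range pt := fun c hc v => by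
    rw [hrange c hc]
    rintro z (rfl | rfl) <;> exact ⟨_, rfl⟩
  have hsame : ∀ s ∈ 𝓢, ∀ s' ∈ 𝓢, ∀ z, z ∈ s → z ∈ s' → s = s' := fun s hs s' hs' z hz hz' =>
    hdis.elim hs hs' (not_disjoint_iff.2 ⟨z, hz, hz'⟩)
  have hpair : ∀ v u : 𝓢 × Bool, u.1 = v.1 → u = v ∨ u = (v.1, !v.2) := by
    rintro ⟨s, b⟩ ⟨s', b'⟩ h
    obtain rfl : s' = s := h
    cases b <;> cases b' <;> simp
  have hN : IsNet ρ pt S := by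
    refine ⟨?_, hinj, ?_, ?_, ?_, ?_⟩
    · rintro (_ | _ | _)
      · exact hr.matching
      · exact hb.matching
      · exact ⟨fun v => by simp [ρ], fun v h => by simpa [ρ] using congrArg Prod.snd h⟩
    · rintro (_ | _ | _) v
      · exact hr.arc v
      · exact hb.arc v
      · obtain ⟨⟨s, hs⟩, _ | _⟩ := v
        exacts [he s hs, (he s hs).symm]
    · rintro (_ | _ | _) v
      exacts [hr.symm v, hb.symm v, rfl]
    · intro c c' v v' h
      by_cases hcc : c = c'
      · subst hcc
        simp only [true_and, not_or] at h
        rcases c with _ | _ | _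
        · exact (hr.disjoint v v' h.1 h.2).inter_eq.le.trans (empty_subset _)
        · exact (hb.disjoint v v' h.1 h.2).inter_eq.le.trans (empty_subset _)
        · rintro z ⟨hz, hz'⟩
          have := hsame _ v'.1.2 _ v.1.2 z hz' hz
          exact absurd (hpair v v' (Subtype.ext this)) (not_or.2 h)
      · rintro z ⟨hz, hz'⟩
        have hzS := hmeet c c' v v' hcc ⟨hz, hz'⟩
        by_cases hc : c = .purple
        · exact hrange' c' (fun h => hcc (hc.trans h.symm)) v' ⟨hz', hzS⟩
        · exact hrange' c hc v ⟨hz, hzS⟩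
    · intro c u v h
      by_cases hc : c = .purple
      · subst hc
        exact hpair v u (Subtype.ext (hsame _ u.1.2 _ v.1.2 _ (hes u.1 u.1.2 u.2) h))
      · have : pt u ∈ ({pt v, pt (ρ c v)} : Set ℂ) := hrange c hc v ▸ ⟨h, hpS u⟩
        exact this.imp (fun h => hinj h) fun h => hinj h
  have hrb : ∀ A ∈ 𝓡, Disjoint A (⋃₀ F.blue) := fun A hA => disjoint_left.2 fun z hz hz' =>
    disjoint_left.1 (hr.free A hA) hz (hU ▸ ⟨⟨A, hr.subset hA, hz⟩, hz'⟩)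
  have hbr : ∀ A ∈ 𝓑, Disjoint A (⋃₀ F.red) := fun A hA => disjoint_left.2 fun z hz hz' =>
    disjoint_left.1 (hb.free A hA) hz (hU ▸ ⟨hz', ⟨A, hb.subset hA, hz⟩⟩)
  refine ⟨𝓢 × Bool, inferInstance, ρ, pt, S, free, ⟨hN, ?_, ?_, ?_, ?_⟩, ⟨?_, ?_⟩, rfl⟩
  · rintro (_ | _ | _)
    exacts [F.red_finite.subset hr.subset, F.blue_finite.subset hb.subset, finite_empty]
  · rintro (_ | _ | _) A hA
    exacts [F.red_jordan A (hr.subset hA), F.blue_jordan A (hb.subset hA), hA.elim]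
  · rintro (_ | _ | _) (_ | _ | _) A hA B hB h
    · exact F.red_disjoint (hr.subset hA) (hr.subset hB) (h rfl)
    · exact (hrb A hA).mono_right (subset_sUnion_of_mem (hb.subset hB))
    · exact hB.elim
    · exact (hbr A hA).mono_right (subset_sUnion_of_mem (hr.subset hB))
    · exact F.blue_disjoint (hb.subset hA) (hb.subset hB) (h rfl)
    · exact hB.elim
    all_goals exact hA.elim
  · rintro (_ | _ | _) A hA (_ | _ | _) v
    · exact hr.free_arc A hA v
    · exact (hrb A hA).mono_right (hSb v)
    · exact (hr.free A hA).mono_right (hSp v)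
    · exact (hbr A hA).mono_right (hSr v)
    · exact hb.free_arc A hA v
    · exact (hb.free A hA).mono_right (hSp v)
    all_goals exact hA.elim
  · simp only [fullCells, hpurple, hr.union, free, sUnion_empty, empty_union]
    simp [cells, S]
  · simp only [fullCells, hpurple, hb.union, free, sUnion_empty, empty_union]
    simp [cells, S]

theorem PlaneFormation.parity_eq {F F' : PlaneFormation} (h : F.IsSimpleOperation F') :
    F'.parity = F.parity := by
  obtain ⟨V, _, ρ, pt, S, free, hN, hF, hp⟩ := F.exists_isCurveNet
  exact hF.parity_eq_of_isSimpleOperation hN hp h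

end KempeParity

theorem mainTheorem2 :
    (∀ (α β : Type*) (G : Graph α β), G.vertexSet.Finite → KempeParity.IsCubic G →
      KempeParity.IsPlanar G → ∀ C C' : β → KempeParity.Color, KempeParity.IsColoring G C →
      KempeParity.IsSimpleOperation G C C' →
        KempeParity.parity G C' = KempeParity.parity G C) ∧
    (∀ F F' : KempeParity.PlaneFormation, F.IsSimpleOperation F' → F'.parity = F.parity) ∧
    (KempeParity.IsCubic KempeParity.oneDeletedPetersen ∧
      ¬ KempeParity.IsPlanar KempeParity.oneDeletedPetersen ∧
      ∃ C C' : Fin 12 → KempeParity.Color,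
        KempeParity.IsColoring KempeParity.oneDeletedPetersen C ∧
        KempeParity.IsColoring KempeParity.oneDeletedPetersen C' ∧
        KempeParity.IsSimpleOperation KempeParity.oneDeletedPetersen C C' ∧
        KempeParity.circuitCount KempeParity.oneDeletedPetersen C = 5 ∧
        KempeParity.circuitCount KempeParity.oneDeletedPetersen C' = 4) := by
  open KempeParity in
  exact ⟨fun _ _ _ hfin hG hP _ _ hC hop => parity_eq_of_isPlanar hfin hG hP hC hop,
    fun _ _ h => PlaneFormation.parity_eq h,
    isModel_oneDeletedPetersen.isCubic, not_isPlanar_oneDeletedPetersen, petersenColoring,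
    petersenColoring', isModel_oneDeletedPetersen.isColoring,
    isModel_oneDeletedPetersen'.isColoring, isSimpleOperation_petersen,
    circuitCount_petersenColoring, circuitCount_petersenColoring'⟩
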